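/- **Theorem (Entanglement growth).** Consider a bosonic system with $N=N_A+N_B$ degrees of freedom, phase space $V=\mathbb R^{2N}$ with coordinates $\xi^a=(q_1,\dots,q_N,p_1,\dots,p_N)$, and Poisson brackets $\{\xi^a,\xi^b\}=\Omega^{ab}$, $\Omega=\begin{pmatrix}0&1\\-1&0\end{pmatrix}$. Let $\mathcal D=(\mathcal D_A,\mathcal D_B)$ be a Darboux basis of the space $V^*$ of linear observables, with $N_A$ canonical pairs in $\mathcal D_A$ and $N_B$ in $\mathcal D_B$; the subsystem $A$ is the symplectic subspace $A^*=\mathrm{span}\,\mathcal D_A\subset V^*$. Let $H(t)=\tfrac12 h_{ab}(t)\xi^a\xi^b+f_a(t)\xi^a$, $t\ge 0$, be a time-dependent quadratic Hamiltonian with real coefficients, $h_{ab}=h_{ba}$, whose time dependence is right-continuous and locally bounded (for instance smooth or piecewise continuous). Let $M(t)$ be its linear classical flow, $\dot M(t)=\Omega h(t)M(t)$, $M(0)=1$. Let $G$ be any inner product on $V^*$ and let $\mathcal V_A\subset A^*$ be any parallelepiped spanned by a basis of $A^*$ (for instance the symplectic cube spanned by $\mathcal D_A$). Suppose that the subsystem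 exponent $$\Lambda_A=\lim_{t\to\infty}\frac1t\log\frac{\mathrm{Vol}_G\big(M^{\mathsf T}(t)\mathcal V_A\big)}{\mathrm{Vol}_G(\mathcal V_A)}$$ exists as a real number, where $\mathrm{Vol}_G$ is the square root of the Gram determinant of the spanning vectors. On the quantum side let $\hat\xi^a$, $[\hat\xi^a,\hat\xi^b]=\mathrm i\Omega^{ab}$, act on the Hilbert space $\mathcal H=L^2(\mathbb R^{N_A})\otimes L^2(\mathbb R^{N_B})$ through the Schrödinger representation in which the elements of $\mathcal D_A$ and $\mathcal D_B$ are the positions and momenta of the two factors. For a compatible complex structure $J_0$ on $V$ ($J_0^2=-1$, $J_0\Omega J_0^{\mathsf T}=\Omega$, $\Omega^{-1}J_0$ symmetric and positive definite) and $\zeta_0\in V$, let $|J_0,\zeta_0\rangle$ be the Gaussian state, i.e. the unit vector (a Schwartz function, unique up to a phase) annihilated by all the operators $(\hat\xi^b-\zeta_0^b)+\mathrm i (J_0)^b{}_a(\hat\xi^a-\zeta_0^a)$. Let $|\psi_t\rangle=U(t)|J_0,\zeta_0\rangle$ be the evolved state, i.e. the solution in Schwartz functions of the Schrödinger equation $\mathrm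 i\,\partial_t|\psi_t\rangle=\hat H(t)|\psi_t\rangle$, $\hat H(t)=\tfrac12h_{ab}(t)\hat\xi^a\hat\xi^b+f_a(t)\hat\xi^a$, with initial state $|\psi_0\rangle=|J_0,\zeta_0\rangle$. (All time derivatives are right derivatives of continuous functions of $t$, so that $H$ may jump; for $\psi_t$ they are taken in the norm of $\mathcal H$.) Let $S_A(t)=-\mathrm{Tr}(\rho_A(t)\log\rho_A(t))$, with $\rho_A(t)=\mathrm{Tr}_B|\psi_t\rangle\langle\psi_t|$, be the entanglement entropy of $A$. Then, for every initial Gaussian state $|J_0,\zeta_0\rangle$, $S_A(t)$ is finite for all $t\ge0$ and $$\lim_{t\to\infty}\frac{S_A(t)}{t}=\Lambda_A .$$ -/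

import Mathlib

open scoped SchwartzMap Matrix InnerProductSpace ENNReal LineDeriv Topology
open MeasureTheory

noncomputable section

namespace GaussianEntanglement

/-! ## Linear phase space -/

/-- The dual phase space `V*` of a system with `N` degrees of freedom: the linear observables
`ℓ = ∑ a, ℓ a • ξ^a` in the canonical coordinates `ξ = (q_1, …, q_N, p_1, …, p_N)` of
`V = ℝ^{2N}`. The index `Sum.inl i` stands for `q_i`, the index `Sum.inr i` for `p_i`. -/
abbrev DualPhaseSpace (N : ℕ) : Type := Fin N ⊕ Fin N → ℝ

/-- The matrix `Ω^{ab}` of the Poisson brackets, `{q_i, p_j} = δ_ij`, for modes labelled by `m`. -/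
def Omega (m : Type) [DecidableEq m] : Matrix (m ⊕ m) (m ⊕ m) ℝ :=
  Matrix.fromBlocks 0 1 (-1) 0

/-- The Poisson bracket `{u, v} = Ω^{ab} u_a v_b` of two linear observables. -/
def poisson {N : ℕ} (u v : DualPhaseSpace N) : ℝ := u ⬝ᵥ (Omega (Fin N) *ᵥ v)

/-- A basis of `V*` indexed by the modes `A ⊔ B`, with `NA` modes in `A` and `NB` modes in `B`:
`D (inl k)` is the position observable and `D (inr k)` the momentum observable of the mode `k`. -/
abbrev SplitBasis (NA NB N : ℕ) : Type :=
  Module.Basis ((Fin NA ⊕ Fin NB) ⊕ (Fin NA ⊕ Fin NB)) ℝ (DualPhaseSpace N)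

/-- `D = (D_A, D_B)` is a Darboux basis of `V*`, so that `V* = A* ⊕ B*` with `A*` and `B*`
symplectic complements of each other, spanned by `D_A` and `D_B`. -/
def IsDarboux {NA NB N : ℕ} (D : SplitBasis NA NB N) : Prop :=
  ∀ r s, poisson (D r) (D s) = Omega (Fin NA ⊕ Fin NB) r s

/-- The subspace `A* ⊆ V*` of the linear observables of the subsystem `A`, spanned by `D_A`. -/
def subsystem {NA NB N : ℕ} (D : SplitBasis NA NB N) : Submodule ℝ (DualPhaseSpace N) :=
  Submodule.span ℝ (Set.range fun r : Fin NA ⊕ Fin NA => D (Sum.map Sum.inl Sum.inl r))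

/-! ## Quadratic time-dependent Hamiltonians and their classical flow -/

/-- A time-dependent quadratic Hamiltonian `H(t) = ½ h_ab(t) ξ^a ξ^b + f_a(t) ξ^a`, `t ≥ 0`.
The coefficients are right-continuous and locally bounded, which allows for smooth and for
piecewise continuous (in particular piecewise constant) time dependence. -/
structure QuadraticHamiltonian (N : ℕ) where
  /-- the coefficients of the quadratic part -/
  h : ℝ → Matrix (Fin N ⊕ Fin N) (Fin N ⊕ Fin N) ℝ
  /-- the coefficients of the linear part -/
  f : ℝ → DualPhaseSpace N
  symm : ∀ t, 0 ≤ t → (h t).IsSymm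
  rightCont_h : ∀ t, 0 ≤ t → ∀ a b, ContinuousWithinAt (fun s => h s a b) (Set.Ici t) t
  rightCont_f : ∀ t, 0 ≤ t → ∀ a, ContinuousWithinAt (fun s => f s a) (Set.Ici t) t
  locBdd_h : ∀ T : ℝ, ∃ C : ℝ, ∀ t ∈ Set.Icc 0 T, ∀ a b, |h t a b| ≤ C
  locBdd_f : ∀ T : ℝ, ∃ C : ℝ, ∀ t ∈ Set.Icc 0 T, ∀ a, |f t a| ≤ C

/-- `M` is the linear Hamiltonian flow of `H`: the solution of `Ṁ = K(t) M`, `K = Ω h`,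
`M(0) = 1`. Derivatives in time are right derivatives of continuous functions,
so that jumps of the Hamiltonian are allowed. -/
structure IsClassicalFlow {N : ℕ} (H : QuadraticHamiltonian N)
    (M : ℝ → Matrix (Fin N ⊕ Fin N) (Fin N ⊕ Fin N) ℝ) : Prop where
  init : M 0 = 1
  cont : ∀ a b, ContinuousOn (fun t => M t a b) (Set.Ici 0)
  ode : ∀ t, 0 ≤ t → ∀ a b, HasDerivWithinAt (fun s => M s a b)
    ((Omega (Fin N) * H.h t * M t) a b) (Set.Ici t) t

/-! ## The subsystem exponent -/

/-- The volume of the parallelepiped spanned by the vectors `v r` of `V*`, with respect to the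
inner product `G^{ab}` on `V*`: the square root of the Gram determinant. -/
def parallelepipedVolume {N : ℕ} {ι : Type} [Fintype ι] [DecidableEq ι]
    (G : Matrix (Fin N ⊕ Fin N) (Fin N ⊕ Fin N) ℝ) (v : ι → DualPhaseSpace N) : ℝ :=
  Real.sqrt (Matrix.det (Matrix.of fun r s => v r ⬝ᵥ (G *ᵥ v s)))

/-- `Λ` is the exponential growth rate of the `G`-volume of the parallelepiped spanned by `v`
under the action of `M(t)ᵀ` on `V*`. -/
def IsVolumeExponent {N : ℕ} {ι : Type} [Fintype ι] [DecidableEq ι]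
    (G : Matrix (Fin N ⊕ Fin N) (Fin N ⊕ Fin N) ℝ)
    (M : ℝ → Matrix (Fin N ⊕ Fin N) (Fin N ⊕ Fin N) ℝ)
    (v : ι → DualPhaseSpace N) (Λ : ℝ) : Prop :=
  Filter.Tendsto
    (fun t : ℝ => 1 / t * Real.log
      (parallelepipedVolume G (fun r => (M t)ᵀ *ᵥ v r) / parallelepipedVolume G v))
    Filter.atTop (𝓝 Λ)

/-! ## The quantum system

The Hilbert space is `L²(ℝ^NA × ℝ^NB) = L²(ℝ^NA) ⊗ L²(ℝ^NB)`, with the Schrödinger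
representation of the canonical commutation relations in which the Darboux basis `D` acts by
multiplication operators and by derivatives. All polynomials in these operators act on the
Schwartz functions, which serve as wave functions. -/

/-- Configuration space `ℝ^n` of `n` modes. -/
abbrev Config (n : ℕ) : Type := EuclideanSpace ℝ (Fin n)

/-- Schwartz wave functions of the modes of `A` and `B`. -/
abbrev WaveFunction (NA NB : ℕ) : Type := 𝓢(Config NA × Config NB, ℂ)

instance volume_hasTemperateGrowth (NA NB : ℕ) :
    (volume : Measure (Config NA × Config NB)).HasTemperateGrowth := by
  have h : (volume : Measure (Config NA × Config NB)).IsAddHaarMeasure :=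
    inferInstanceAs ((volume : Measure (Config NA)).prod
      (volume : Measure (Config NB))).IsAddHaarMeasure
  infer_instance

/-- The Hilbert space `L²(ℝ^n)` of `n` modes. -/
abbrev HilbertSpace (n : ℕ) : Type := Lp ℂ 2 (volume : Measure (Config n))

/-- The coordinate of the mode `k` on the configuration space of `A` and `B`. -/
def coord {NA NB : ℕ} : Fin NA ⊕ Fin NB → Config NA × Config NB → ℝ
  | Sum.inl i, x => x.1 i
  | Sum.inr j, x => x.2 j

/-- The unit vector in the direction of the mode `k`. -/
def unitVector {NA NB : ℕ} : Fin NA ⊕ Fin NB → Config NA × Config NB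
  | Sum.inl i => (EuclideanSpace.single i 1, 0)
  | Sum.inr j => (0, EuclideanSpace.single j 1)

/-- The operators `θ̂^r` of the Schrödinger representation: the positions act as multiplication
by the coordinates, the momenta as `-i` times the partial derivatives. -/
def canonicalOp {NA NB : ℕ} : (Fin NA ⊕ Fin NB) ⊕ (Fin NA ⊕ Fin NB) →
    WaveFunction NA NB →L[ℂ] WaveFunction NA NB
  | Sum.inl k => SchwartzMap.smulLeftCLM ℂ (fun x => (coord k x : ℂ))
  | Sum.inr k => (-Complex.I) • LineDeriv.lineDerivOpCLM ℂ (WaveFunction NA NB) (unitVector k)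

/-- The quantization `ℓ̂` of a linear observable `ℓ = ∑ r, c_r θ^r`, where `D = (θ^r)`. -/
def quantize {NA NB N : ℕ} (D : SplitBasis NA NB N) (ℓ : DualPhaseSpace N) :
    WaveFunction NA NB →L[ℂ] WaveFunction NA NB :=
  ∑ r, ((D.repr ℓ r : ℝ) : ℂ) • canonicalOp r

/-- The operator `ξ̂^a`, the quantization of the coordinate observable `ξ^a`. -/
def xiOp {NA NB N : ℕ} (D : SplitBasis NA NB N) (a : Fin N ⊕ Fin N) :
    WaveFunction NA NB →L[ℂ] WaveFunction NA NB :=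
  quantize D (Pi.single a 1)

/-- The operator `Ĥ(t) = ½ h_ab(t) ξ̂^a ξ̂^b + f_a(t) ξ̂^a`. -/
def hamiltonianOp {NA NB N : ℕ} (D : SplitBasis NA NB N) (H : QuadraticHamiltonian N) (t : ℝ) :
    WaveFunction NA NB →L[ℂ] WaveFunction NA NB :=
  (1 / 2 : ℂ) • (∑ a, ∑ b, ((H.h t a b : ℝ) : ℂ) • (xiOp D a ∘L xiOp D b))
    + ∑ a, ((H.f t a : ℝ) : ℂ) • xiOp D a

/-- `ψ_t` solves the Schrödinger equation `i ∂_t ψ_t = Ĥ(t) ψ_t` for `t ≥ 0`, with continuity and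
(right) time derivatives understood in the norm of the Hilbert space. As `Ĥ(t)` is symmetric, a
solution is determined by `ψ_0`, that is, `ψ_t = U(t) ψ_0`. -/
structure IsSchrodingerSolution {NA NB N : ℕ} (D : SplitBasis NA NB N)
    (H : QuadraticHamiltonian N) (ψ : ℝ → WaveFunction NA NB) : Prop where
  cont : ContinuousOn (fun t => (ψ t).toLp 2) (Set.Ici 0)
  schrodinger : ∀ t, 0 ≤ t → HasDerivWithinAt (fun s => (ψ s).toLp 2)
    ((-Complex.I • hamiltonianOp D H t (ψ t)).toLp 2) (Set.Ici t) t

/-! ## Gaussian states -/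

/-- `J` is a complex structure on `V` compatible with the symplectic structure: `J² = -1`,
`J` is symplectic, and `g = ω J` is symmetric and positive definite, where `ω = Ω⁻¹`. -/
structure IsCompatibleComplexStructure {N : ℕ}
    (J : Matrix (Fin N ⊕ Fin N) (Fin N ⊕ Fin N) ℝ) : Prop where
  sq : J * J = -1
  symplectic : J * Omega (Fin N) * Jᵀ = Omega (Fin N)
  posDef : ((Omega (Fin N))⁻¹ * J).PosDef

/-- `ψ` is the Gaussian state `|J, ζ⟩`: a unit vector annihilated by all the operators
`(ξ̂^b - ζ^b) + i J^b_a (ξ̂^a - ζ^a)`. -/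
structure IsGaussianState {NA NB N : ℕ} (D : SplitBasis NA NB N)
    (J : Matrix (Fin N ⊕ Fin N) (Fin N ⊕ Fin N) ℝ) (ζ : Fin N ⊕ Fin N → ℝ)
    (ψ : WaveFunction NA NB) : Prop where
  norm_eq_one : ‖ψ.toLp 2‖ = 1
  annihilated : ∀ b, (xiOp D b ψ - ((ζ b : ℝ) : ℂ) • ψ)
    + Complex.I • ∑ a, ((J b a : ℝ) : ℂ) • (xiOp D a ψ - ((ζ a : ℝ) : ℂ) • ψ) = 0

/-! ## The entanglement entropy -/

/-- The wave function `x ↦ ψ(x, y)` of the modes of `A` at fixed configuration `y` of the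
modes of `B`. -/
def slice {NA NB : ℕ} (ψ : WaveFunction NA NB) (y : Config NB) : 𝓢(Config NA, ℂ) :=
  SchwartzMap.compCLM (𝕜 := ℂ) (g := fun x : Config NA => (x, y))
    (by
      have h1 : (fun x : Config NA => (x, y)) = fun x : Config NA =>
          ContinuousLinearMap.inl ℝ (Config NA) (Config NB) x + ((0 : Config NA), y) := by
        funext x
        simp
      rw [h1]
      fun_prop)
    ⟨1, 1, fun x => by
      have h2 : ‖x‖ ≤ ‖(x, y)‖ := by
        rw [Prod.norm_def]
        exact le_max_left _ _
      simp only [pow_one, one_mul]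
      linarith⟩ ψ

/-- The reduced density operator `ρ_A = Tr_B |ψ⟩⟨ψ| = ∫ dy ⟨y|ψ⟩⟨ψ|y⟩` on `L²(ℝ^NA)`, the partial
trace being evaluated in the position representation of `B` (a Bochner integral of rank-one
operators `|ψ(·, y)⟩⟨ψ(·, y)|` in the operator norm). -/
def reducedDensity {NA NB : ℕ} (ψ : WaveFunction NA NB) :
    HilbertSpace NA →L[ℂ] HilbertSpace NA :=
  ∫ y : Config NB, InnerProductSpace.rankOne ℂ ((slice ψ y).toLp 2) ((slice ψ y).toLp 2)

/-- The trace, in `[0, ∞]`, of a positive bounded operator on a Hilbert space: the supremum of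
`∑ ⟨e, T e⟩` over the finite orthonormal families. -/
def traceOfPositive {E : Type} [NormedAddCommGroup E] [InnerProductSpace ℂ E]
    (T : E →L[ℂ] E) : ℝ≥0∞ :=
  ⨆ (s : Finset E) (_ : Orthonormal ℂ (fun e : s => (e : E))),
    ∑ e ∈ s, ENNReal.ofReal (RCLike.re ⟪e, T e⟫_ℂ)

/-- The von Neumann entropy `-Tr (ρ log ρ)`, in `[0, ∞]`, of a density operator `ρ`, where
`-ρ log ρ` is defined by the continuous functional calculus. -/
def vonNeumannEntropy {E : Type} [NormedAddCommGroup E] [InnerProductSpace ℂ E]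
    [CompleteSpace E] (ρ : E →L[ℂ] E) : ℝ≥0∞ :=
  traceOfPositive (cfc Real.negMulLog ρ)

/-- The entanglement entropy `S_A(|ψ⟩)` of the subsystem `A`. -/
def entanglementEntropy {NA NB : ℕ} (ψ : WaveFunction NA NB) : ℝ≥0∞ :=
  vonNeumannEntropy (reducedDensity ψ)

end GaussianEntanglement

end

open GaussianEntanglement

open scoped SchwartzMap Matrix InnerProductSpace ENNReal LineDeriv Topology
open MeasureTheory

set_option linter.unusedSectionVars false

noncomputable section

namespace GaussianEntanglement

section
open scoped MatrixOrder

/-! ### Multivariate Gaussian integrals. -/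

section GaussianIntegrals
variable {ι : Type*} [Fintype ι] [DecidableEq ι]

/-! The limit follows from an estimate uniform in time: the entropy `S_A(t)` and the logarithm of
the volume ratio differ by at most a constant for all `t ≥ 0`
(`exists_abs_entanglementEntropy_sub_log_le`). Division by `t` then gives the claim. Three facts
carry the estimate.

Gaussian states stay Gaussian. In Darboux coordinates the state is a multiple of `exp (-½ x·Zx +
b·x)` with `Z` complex symmetric and `Re Z` positive definite. Such a `Z` is the same as a positive
Lagrangian subspace, spanned by the columns of the frame `(1; iZ)`. The symplectic flow acts
linearly on these subspaces, hence by fractional linear maps on `Z`, and the resulting Riccati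
equation is the one that the Schrödinger equation demands. The covariance matrix `Γ`, normalized to
be the identity for `Z = 1`, becomes `M Γ Mᵀ` (`covariance_transport`). The displacement and the
linear part of the Hamiltonian enter `b` only and are invisible to `Γ`. The scalar prefactor is
never computed: equality in the Cauchy–Schwarz inequality persists in time
(`exists_eq_smul_of_hasDerivWithinAt`).

The entropy is half the logarithm of `det Γ_A`, where `Γ_A` is the restriction of `Γ` to `A`, up to
an error between `0` and `1 + 2^NA` (`entanglementEntropy_gaussian_bounds`). Fixing the
configuration of `B` turns the wave function into a multiple of a coherent state of `A`, so the
reduced density operator is a superposition of coherent states with Gaussian weight and every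
relevant integral is Gaussian. From below, the entropy dominates the Rényi entropy of order two, and
the purity is exactly `(det Γ_A)^(-1/2)`. From above, the trace is evaluated on the resolution of
the identity by coherent states and `-x log x` is replaced by an affine upper bound whose slope is
minus the logarithm of the Husimi function; this bounds the entropy by the Wehrl entropy plus one.
No symplectic diagonalization is needed.

The Gram determinant of the transported parallelepiped is a constant times the determinant of the
restriction of `M G Mᵀ` to `A` (`exists_parallelepipedVolume_eq`). Any two inner products bound each
other up to constants, this survives congruence by `M` and restriction to `A`, and determinants of
positive definite matrices are monotone. Replacing `G` by the initial covariance therefore changes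
the logarithm by a bounded amount, uniformly in `M` (`exists_abs_log_det_restrict_sub_le`). -/

theorem measurableEmbedding_mulVec {B : Matrix ι ι ℝ} (hB : B.det ≠ 0) :
    MeasurableEmbedding (Matrix.toLin' B) := by
  have hu : IsUnit B.det := isUnit_iff_ne_zero.2 hB
  have hinj : Function.Injective (Matrix.toLin' B) := by
    intro x y h
    simpa [Matrix.toLin'_apply, Matrix.mulVec_mulVec, Matrix.nonsing_inv_mul _ hu]
      using congrArg (fun z => B⁻¹ *ᵥ z) h
  exact ((Matrix.toLin' B).continuous_of_finiteDimensional).measurableEmbedding hinj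

theorem integral_comp_mulVec {E : Type*} [NormedAddCommGroup E] [NormedSpace ℝ E]
    {B : Matrix ι ι ℝ} (hB : B.det ≠ 0) (f : (ι → ℝ) → E) :
    ∫ x, f (B *ᵥ x) = |B.det|⁻¹ • ∫ x, f x := by
  have h := Real.map_matrix_volume_pi_eq_smul_volume_pi hB
  have e := measurableEmbedding_mulVec hB
  have h2 := e.integral_map (μ := volume) f
  rw [h, integral_smul_measure] at h2
  simp only [Matrix.toLin'_apply] at h2
  rw [← h2, ENNReal.toReal_ofReal (abs_nonneg _), abs_inv]

theorem integrable_comp_mulVec {E : Type*} [NormedAddCommGroup E]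
    {B : Matrix ι ι ℝ} (hB : B.det ≠ 0) {f : (ι → ℝ) → E} (hf : Integrable f) :
    Integrable (fun x => f (B *ᵥ x)) := by
  have h := Real.map_matrix_volume_pi_eq_smul_volume_pi hB
  have e := measurableEmbedding_mulVec hB
  have h2 := e.integrable_map_iff (μ := volume) (g := f)
  rw [h] at h2
  exact h2.1 (hf.smul_measure ENNReal.ofReal_ne_top)

theorem exists_transpose_mul_self {X : Matrix ι ι ℝ} (hX : X.PosDef) :
    ∃ B : Matrix ι ι ℝ, X = Bᵀ * B ∧ B.det ≠ 0 := by
  obtain ⟨B, hB⟩ := CStarAlgebra.nonneg_iff_eq_star_mul_self.1 hX.posSemidef.nonneg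
  rw [Matrix.star_eq_conjTranspose, Matrix.conjTranspose_eq_transpose_of_trivial] at hB
  refine ⟨B, hB, fun h => ?_⟩
  have := hX.det_pos
  rw [hB, Matrix.det_mul, h] at this
  simp at this

/-- The integrand of the Gaussian integral with quadratic part `X` and linear part `c`. -/
theorem gaussian_aux {X : Matrix ι ι ℝ} (hX : X.PosDef) (c : ι → ℂ) :
    Integrable (fun x : ι → ℝ => Complex.exp (-((x ⬝ᵥ X *ᵥ x : ℝ) : ℂ) + ∑ i, c i * x i)) ∧
    ∫ x : ι → ℝ, Complex.exp (-((x ⬝ᵥ X *ᵥ x : ℝ) : ℂ) + ∑ i, c i * x i) =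
      ((Real.sqrt Real.pi ^ Fintype.card ι / Real.sqrt X.det : ℝ) : ℂ) *
        Complex.exp (1 / 4 * (c ⬝ᵥ (X⁻¹.map Complex.ofReal *ᵥ c))) := by
  obtain ⟨B, hB, hd⟩ := exists_transpose_mul_self hX
  have hu : IsUnit B.det := isUnit_iff_ne_zero.2 hd
  -- The linear coefficient in the coordinates `u = B x`, in which the quadratic part becomes the
  -- sum of squares.
  set c' : ι → ℂ := (B⁻¹ᵀ).map Complex.ofReal *ᵥ c with hc'
  have h1 : ∀ x : ι → ℝ, -((x ⬝ᵥ X *ᵥ x : ℝ) : ℂ) + ∑ i, c i * x i =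
      -1 * ∑ i, (((B *ᵥ x) i : ℝ) : ℂ) ^ 2 + ∑ i, c' i * ((B *ᵥ x) i : ℝ) := by
    intro x
    congr 1
    · have : x ⬝ᵥ X *ᵥ x = ∑ i, ((B *ᵥ x) i) ^ 2 := by
        rw [hB, ← Matrix.mulVec_mulVec, Matrix.dotProduct_mulVec, Matrix.vecMul_transpose]
        simp [dotProduct, sq]
      rw [this]; push_cast; ring
    · have h2 : ∀ u : ι → ℝ, ∑ i, c' i * (u i : ℂ) = ∑ i, c i * ((B⁻¹ *ᵥ u) i : ℝ) := by
        intro u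
        have : (fun i => (((B⁻¹ *ᵥ u) i : ℝ) : ℂ)) =
            (B⁻¹.map Complex.ofReal) *ᵥ (fun i => (u i : ℂ)) := by
          funext i
          simp [Matrix.mulVec, dotProduct]
        change c' ⬝ᵥ (fun i => (u i : ℂ)) = c ⬝ᵥ (fun i => (((B⁻¹ *ᵥ u) i : ℝ) : ℂ))
        rw [this, Matrix.dotProduct_mulVec, hc', ← Matrix.vecMul_transpose]
        simp [Matrix.transpose_map]
      rw [h2, Matrix.mulVec_mulVec, Matrix.nonsing_inv_mul _ hu, Matrix.one_mulVec]
  have h3 : ∑ i, c' i ^ 2 = c ⬝ᵥ (X⁻¹.map Complex.ofReal *ᵥ c) := by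
    have : X⁻¹.map Complex.ofReal = (B⁻¹.map Complex.ofReal) * (B⁻¹ᵀ).map Complex.ofReal := by
      rw [hB, Matrix.mul_inv_rev, ← Matrix.transpose_nonsing_inv]
      exact Matrix.map_mul (f := Complex.ofRealHom)
    rw [this, ← Matrix.mulVec_mulVec, ← hc', Matrix.dotProduct_mulVec]
    have : c ᵥ* B⁻¹.map Complex.ofReal = c' := by
      rw [hc', Matrix.transpose_map, Matrix.mulVec_transpose]
    rw [this]; simp [dotProduct, sq]
  have hX' : Real.sqrt X.det = |B.det| := by
    rw [hB, Matrix.det_mul, Matrix.det_transpose, ← sq, Real.sqrt_sq_eq_abs]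
  simp_rw [h1]
  constructor
  · exact integrable_comp_mulVec hd (GaussianFourier.integrable_cexp_neg_mul_sum_add
      (b := 1) (by simp) c')
  · rw [integral_comp_mulVec hd (fun u : ι → ℝ => Complex.exp (-1 * ∑ i, ((u i : ℝ) : ℂ) ^ 2 + ∑ i, c' i * (u i : ℝ)))]
    rw [GaussianFourier.integral_cexp_neg_mul_sum_add (b := 1) (by simp) c', h3, hX',
      Complex.real_smul]
    have h4 : ((Real.pi : ℂ) / 1) ^ ((Fintype.card ι : ℂ) / 2) =
        ((Real.sqrt Real.pi ^ Fintype.card ι : ℝ) : ℂ) := by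
      rw [div_one, Real.sqrt_eq_rpow, ← Real.rpow_natCast, ← Real.rpow_mul Real.pi_pos.le,
        Complex.ofReal_cpow Real.pi_pos.le]
      congr 1
      push_cast; ring
    rw [h4, mul_one]
    push_cast
    ring_nf

theorem integrable_gaussian {X : Matrix ι ι ℝ} (hX : X.PosDef) (c : ι → ℂ) :
    Integrable (fun x : ι → ℝ => Complex.exp (-((x ⬝ᵥ X *ᵥ x : ℝ) : ℂ) + ∑ i, c i * x i)) :=
  (gaussian_aux hX c).1

theorem integral_gaussian {X : Matrix ι ι ℝ} (hX : X.PosDef) (c : ι → ℂ) :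
    ∫ x : ι → ℝ, Complex.exp (-((x ⬝ᵥ X *ᵥ x : ℝ) : ℂ) + ∑ i, c i * x i) =
      ((Real.sqrt Real.pi ^ Fintype.card ι / Real.sqrt X.det : ℝ) : ℂ) *
        Complex.exp (1 / 4 * (c ⬝ᵥ (X⁻¹.map Complex.ofReal *ᵥ c))) :=
  (gaussian_aux hX c).2

theorem gaussian_exponent_ofReal (X : Matrix ι ι ℝ) (c x : ι → ℝ) :
    Complex.exp (-((x ⬝ᵥ X *ᵥ x : ℝ) : ℂ) + ∑ i, (c i : ℂ) * x i) =
      ((Real.exp (-(x ⬝ᵥ X *ᵥ x) + c ⬝ᵥ x) : ℝ) : ℂ) := by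
  push_cast [dotProduct]
  rfl

theorem integrable_real_gaussian {X : Matrix ι ι ℝ} (hX : X.PosDef) (c : ι → ℝ) :
    Integrable (fun x : ι → ℝ => Real.exp (-(x ⬝ᵥ X *ᵥ x) + c ⬝ᵥ x)) := by
  have := integrable_gaussian hX (fun i => (c i : ℂ))
  simp_rw [gaussian_exponent_ofReal] at this
  exact this.re

theorem integral_real_gaussian {X : Matrix ι ι ℝ} (hX : X.PosDef) (c : ι → ℝ) :
    ∫ x : ι → ℝ, Real.exp (-(x ⬝ᵥ X *ᵥ x) + c ⬝ᵥ x) =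
      Real.sqrt Real.pi ^ Fintype.card ι / Real.sqrt X.det *
        Real.exp (1 / 4 * (c ⬝ᵥ (X⁻¹ *ᵥ c))) := by
  have := integral_gaussian hX (fun i => (c i : ℂ))
  simp_rw [gaussian_exponent_ofReal] at this
  rw [integral_complex_ofReal] at this
  have h2 : ((fun i => (c i : ℂ)) ⬝ᵥ X⁻¹.map Complex.ofReal *ᵥ fun i => (c i : ℂ)) =
      ((c ⬝ᵥ (X⁻¹ *ᵥ c) : ℝ) : ℂ) := by
    simp [dotProduct, Matrix.mulVec]
  rw [h2] at this
  have h3 : (1 / 4 : ℂ) * ((c ⬝ᵥ (X⁻¹ *ᵥ c) : ℝ) : ℂ) =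
      ((1 / 4 * (c ⬝ᵥ (X⁻¹ *ᵥ c)) : ℝ) : ℂ) := by push_cast; ring
  rw [h3, ← Complex.ofReal_exp, ← Complex.ofReal_mul] at this
  exact Complex.ofReal_injective this

end GaussianIntegrals

end

/-! ### Traces of positive operators and bounds on the von Neumann entropy. -/

section Traces
variable {E : Type} [NormedAddCommGroup E] [InnerProductSpace ℂ E] [CompleteSpace E]
  {Z : Type*} [MeasurableSpace Z] {ν : Measure Z}

theorem sum_enorm_inner_sq_le {s : Finset E} (hs : Orthonormal ℂ (fun e : s => (e : E))) (x : E) :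
    ∑ e ∈ s, ‖⟪x, e⟫_ℂ‖ₑ ^ 2 ≤ ‖x‖ₑ ^ 2 := by
  have h := hs.sum_inner_products_le (s := Finset.univ) x
  have h2 : ∑ e ∈ s, ‖⟪x, e⟫_ℂ‖ ^ 2 ≤ ‖x‖ ^ 2 := by
    rw [← Finset.sum_coe_sort s]
    simpa [norm_inner_symm] using h
  have h3 := ENNReal.ofReal_le_ofReal h2
  rw [ENNReal.ofReal_sum_of_nonneg (fun _ _ => by positivity)] at h3
  simpa [ENNReal.ofReal_pow, ofReal_norm] using h3

theorem exists_selfAdjoint_mul_self {T : E →L[ℂ] E} (hT : 0 ≤ T) :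
    ∃ R : E →L[ℂ] E, ContinuousLinearMap.adjoint R = R ∧ R * R = T := by
  refine ⟨CFC.sqrt T, ?_, CFC.sqrt_mul_sqrt_self T hT⟩
  exact (IsSelfAdjoint.of_nonneg (CFC.sqrt_nonneg T)).star_eq

theorem re_inner_mul_self {R : E →L[ℂ] E} (hR : ContinuousLinearMap.adjoint R = R) (x : E) :
    RCLike.re ⟪x, (R * R) x⟫_ℂ = ‖R x‖ ^ 2 := by
  have : ⟪x, (R * R) x⟫_ℂ = ⟪R x, R x⟫_ℂ := by
    conv_rhs => rw [← ContinuousLinearMap.adjoint_inner_right, hR]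
    rfl
  rw [this, inner_self_eq_norm_sq]

theorem inner_selfAdjoint {R : E →L[ℂ] E} (hR : ContinuousLinearMap.adjoint R = R) (x y : E) :
    ⟪x, R y⟫_ℂ = ⟪R x, y⟫_ℂ := by
  conv_lhs => rw [← hR, ContinuousLinearMap.adjoint_inner_right]

/-- The trace of a positive operator is at most its integral over a Parseval frame. -/
theorem sum_inner_le_lintegral {w : Z → E} (hm : ∀ f, AEMeasurable (fun z => ‖⟪w z, f⟫_ℂ‖ₑ ^ 2) ν)
    {s : Finset E} (hs : Orthonormal ℂ (fun e : s => (e : E)))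
    (R : E →L[ℂ] E) (hR : ContinuousLinearMap.adjoint R = R) :
    ∑ e ∈ s, ∫⁻ z, ‖⟪w z, R e⟫_ℂ‖ₑ ^ 2 ∂ν ≤
      ∫⁻ z, ENNReal.ofReal (RCLike.re ⟪w z, (R * R) (w z)⟫_ℂ) ∂ν := by
  rw [← lintegral_finsetSum' _ (fun e _ => hm _)]
  refine lintegral_mono fun z => ?_
  simp_rw [inner_selfAdjoint hR]
  refine (sum_enorm_inner_sq_le hs _).trans_eq ?_
  rw [re_inner_mul_self hR, ENNReal.ofReal_pow (norm_nonneg _), ofReal_norm]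

/-- With `T = R * R` and `R` self-adjoint, the Parseval property gives `⟨e, T e⟩ = ‖R e‖² = ∫ |⟨w, R
e⟩|² = ∫ |⟨R w, e⟩|²`. Bessel's inequality bounds the sum over `e` of the integrand by `‖R w‖² = ⟨w,
T w⟩`. -/
theorem traceOfPositive_le_lintegral {w : Z → E}
    (hm : ∀ f, AEMeasurable (fun z => ‖⟪w z, f⟫_ℂ‖ₑ ^ 2) ν)
    (hw : ∀ f, ∫⁻ z, ‖⟪w z, f⟫_ℂ‖ₑ ^ 2 ∂ν = ‖f‖ₑ ^ 2) {T : E →L[ℂ] E} (hT : 0 ≤ T) :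
    traceOfPositive T ≤ ∫⁻ z, ENNReal.ofReal (RCLike.re ⟪w z, T (w z)⟫_ℂ) ∂ν := by
  obtain ⟨R, hR, rfl⟩ := exists_selfAdjoint_mul_self hT
  refine iSup₂_le fun s hs => ?_
  refine le_trans (le_of_eq ?_) (sum_inner_le_lintegral hm hs R hR)
  refine Finset.sum_congr rfl fun e _ => ?_
  rw [hw, re_inner_mul_self hR, ENNReal.ofReal_pow (norm_nonneg _), ofReal_norm]

/-- Orthonormal vectors lie at distance `√2`, so the balls of radius `1/2` around them are disjoint,
and a second countable space holds only countably many disjoint nonempty open sets. -/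
theorem countable_of_orthonormal [SecondCountableTopology E] {w : Set E}
    (hw : Orthonormal ℂ (fun e : w => (e : E))) : Countable w := by
  have h : Pairwise fun i j : w => Disjoint (Metric.ball (i : E) (1 / 2)) (Metric.ball (j : E) (1 / 2)) := by
    intro i j hij
    refine Metric.ball_disjoint_ball ?_
    have h1 : ‖(i : E) - j‖ ^ 2 = 2 := by
      rw [@norm_sub_sq ℂ, hw.2 hij, hw.1 i, hw.1 j]; norm_num
    rw [dist_eq_norm]
    nlinarith [norm_nonneg ((i : E) - j)]
  exact Set.countable_univ_iff.1 (Set.PairwiseDisjoint.countable_of_isOpen (s := fun i : w => Metric.ball (i : E) (1 / 2))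
    (fun i _ j _ hij => h hij) (fun _ _ => Metric.isOpen_ball)
    (fun i _ => ⟨i, by simp⟩))

variable {ρ : E →L[ℂ] E} {φ : Z → E}

/-- A positive operator that is a superposition of rank-one operators has full trace. -/
theorem lintegral_norm_sq_le_traceOfPositive [SecondCountableTopology E]
    (hm : ∀ f, AEMeasurable (fun z => ‖⟪φ z, f⟫_ℂ‖ₑ ^ 2) ν)
    (hρ : ∀ f, ENNReal.ofReal (RCLike.re ⟪f, ρ f⟫_ℂ) = ∫⁻ z, ‖⟪φ z, f⟫_ℂ‖ₑ ^ 2 ∂ν) :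
    ∫⁻ z, ‖φ z‖ₑ ^ 2 ∂ν ≤ traceOfPositive ρ := by
  obtain ⟨w, b, hb⟩ := exists_hilbertBasis ℂ E
  have hon : Orthonormal ℂ (fun e : w => (e : E)) := hb ▸ b.orthonormal
  -- Countability of the basis permits the exchange of the Parseval sum for `‖φ z‖²` with the
  -- integral over `z`.
  have := countable_of_orthonormal hon
  have h1 : ∀ x : E, ‖x‖ₑ ^ 2 = ∑' e : w, ‖⟪x, (e : E)⟫_ℂ‖ₑ ^ 2 := by
    intro x
    have h := b.hasSum_inner_mul_inner x x
    have h' := (RCLike.reCLM (K := ℂ)).hasSum h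
    have h2 : ∀ e, RCLike.reCLM (K := ℂ) (⟪x, b e⟫_ℂ * ⟪b e, x⟫_ℂ) = ‖⟪x, b e⟫_ℂ‖ ^ 2 := by
      intro e
      rw [← inner_conj_symm (b e) x, RCLike.mul_conj]
      norm_cast
    simp_rw [h2] at h'
    have h3 : RCLike.reCLM (K := ℂ) ⟪x, x⟫_ℂ = ‖x‖ ^ 2 := by
      simp [inner_self_eq_norm_sq_to_K]
      norm_cast
    rw [h3] at h'
    have h4 := ENNReal.ofReal_tsum_of_nonneg (fun e => by positivity) h'.summable
    rw [h'.tsum_eq] at h4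
    rw [← ofReal_norm, ← ENNReal.ofReal_pow (norm_nonneg _), h4]
    refine tsum_congr fun e => ?_
    rw [ENNReal.ofReal_pow (norm_nonneg _), ofReal_norm, hb]
  simp_rw [h1]
  rw [lintegral_tsum (fun e => hm _), ENNReal.tsum_eq_iSup_sum]
  refine iSup_le fun s => ?_
  have hinj : Function.Injective (fun e : w => (e : E)) := Subtype.val_injective
  refine le_trans (le_of_eq ?_) (le_iSup₂ (s.map ⟨_, hinj⟩) ?_)
  · rw [Finset.sum_map]
    exact Finset.sum_congr rfl fun e _ => (hρ _).symm
  · refine ⟨fun e => ?_, fun i j hij => ?_⟩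
    · obtain ⟨a, _, ha⟩ := Finset.mem_map.1 e.2
      change ‖(e : E)‖ = 1
      rw [← ha]; exact hon.1 a
    · obtain ⟨a, _, ha⟩ := Finset.mem_map.1 i.2
      obtain ⟨a', _, ha'⟩ := Finset.mem_map.1 j.2
      change ⟪(i : E), (j : E)⟫_ℂ = 0
      rw [← ha, ← ha']
      refine hon.2 fun h => hij (Subtype.ext ?_)
      rw [← ha, ← ha', h]

/-- The purity bounds the Hilbert-Schmidt norm from above. -/
theorem sum_norm_sq_le_lintegral (hρ0 : 0 ≤ ρ)
    (hm : ∀ f, AEMeasurable (fun z => ‖⟪φ z, f⟫_ℂ‖ₑ ^ 2) ν)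
    (hρ : ∀ f, ENNReal.ofReal (RCLike.re ⟪f, ρ f⟫_ℂ) = ∫⁻ z, ‖⟪φ z, f⟫_ℂ‖ₑ ^ 2 ∂ν)
    {s : Finset E} (hs : Orthonormal ℂ (fun e : s => (e : E))) :
    ∑ e ∈ s, ‖ρ e‖ₑ ^ 2 ≤ ∫⁻ z, ∫⁻ z', ‖⟪φ z', φ z⟫_ℂ‖ₑ ^ 2 ∂ν ∂ν := by
  -- The inner integral of the purity is `⟨φ z, ρ (φ z)⟩`. With `ρ = R * R`, also `‖ρ e‖² = ⟨R e, ρ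
  -- (R e)⟩ = ∫ |⟨φ z, R e⟩|²`, to which the Bessel argument applies.
  simp_rw [← hρ]
  obtain ⟨R, hR, rfl⟩ := exists_selfAdjoint_mul_self hρ0
  refine le_trans (le_of_eq ?_) (sum_inner_le_lintegral hm hs R hR)
  refine Finset.sum_congr rfl fun e _ => ?_
  rw [← hρ, re_inner_mul_self hR, ENNReal.ofReal_pow (norm_nonneg _), ofReal_norm]
  rfl

/-- This is `1 + u ≤ exp u` at `u = -k - log x`, multiplied by `x`, with a term `-x` dropped. The
slope `k` stays free so that it can later be chosen separately at each point of phase space. -/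
theorem negMulLog_le_add {x k : ℝ} (hx : 0 ≤ x) :
    Real.negMulLog x ≤ k * x + Real.exp (-k) := by
  rcases hx.eq_or_lt with rfl | hx
  · simp; positivity
  · have h := Real.add_one_le_exp (-k - Real.log x)
    have h1 : Real.exp (-k - Real.log x) = Real.exp (-k) / x := by
      rw [Real.exp_sub, Real.exp_log hx]
    rw [h1, le_div_iff₀ hx] at h
    rw [Real.negMulLog]
    nlinarith

/-- This is `log u ≤ u - 1` at `u = x / c`, multiplied by `x`. The bound is quadratic in `x`, so it
controls the entropy through `Tr ρ` and `Tr ρ²` alone; taking `c` to be the purity makes it yield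
`-log c`. -/
theorem le_negMulLog {x c : ℝ} (hx : 0 ≤ x) (hc : 0 < c) :
    (1 - Real.log c) * x - c⁻¹ * (x * x) ≤ Real.negMulLog x := by
  rcases hx.eq_or_lt with rfl | hx
  · simp
  · have h := Real.log_le_sub_one_of_pos (div_pos hx hc)
    rw [Real.log_div hx.ne' hc.ne'] at h
    rw [Real.negMulLog]
    have : x / c = c⁻¹ * x := by ring
    rw [this] at h
    nlinarith

theorem re_inner_mono {S T : E →L[ℂ] E} (h : S ≤ T) (x : E) :
    RCLike.re ⟪x, S x⟫_ℂ ≤ RCLike.re ⟪x, T x⟫_ℂ := by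
  have := (ContinuousLinearMap.le_def S T).1 h
  have h2 := this.re_inner_nonneg_right x
  simp only [_root_.sub_apply, inner_sub_right, map_sub] at h2
  linarith

theorem cfc_negMulLog_nonneg (hρ0 : 0 ≤ ρ) (hρ1 : ‖ρ‖ ≤ 1) : 0 ≤ cfc Real.negMulLog ρ := by
  refine cfc_nonneg fun x hx => Real.negMulLog_nonneg (spectrum_nonneg_of_nonneg hρ0 hx) ?_
  rcases subsingleton_or_nontrivial E with h | h
  · exfalso
    have : Subsingleton (E →L[ℂ] E) := ⟨fun a b => by ext x; exact Subsingleton.elim _ _⟩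
    rw [spectrum.of_subsingleton] at hx
    exact hx
  · exact (Real.le_norm_self x).trans ((spectrum.norm_le_norm_of_mem hx).trans hρ1)

theorem inner_negMulLog_le (hρ0 : 0 ≤ ρ) (k : ℝ) (x : E) :
    RCLike.re ⟪x, cfc Real.negMulLog ρ x⟫_ℂ ≤
      k * RCLike.re ⟪x, ρ x⟫_ℂ + Real.exp (-k) * ‖x‖ ^ 2 := by
  have hsa : IsSelfAdjoint ρ := IsSelfAdjoint.of_nonneg hρ0
  have h : cfc Real.negMulLog ρ ≤ cfc (fun x : ℝ => k * x + Real.exp (-k)) ρ :=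
    cfc_mono (fun x hx => negMulLog_le_add (spectrum_nonneg_of_nonneg hρ0 hx))
      Real.continuous_negMulLog.continuousOn (by fun_prop)
  rw [cfc_add_const _ _ _ (by fun_prop), cfc_const_mul _ _ _ (by fun_prop), cfc_id' ℝ ρ] at h
  refine (re_inner_mono h x).trans_eq ?_
  rw [Algebra.algebraMap_eq_smul_one]
  have h1 : RCLike.re ⟪x, x⟫_ℂ = ‖x‖ ^ 2 := inner_self_eq_norm_sq x
  rw [← h1, _root_.add_apply, inner_add_right, map_add]
  congr 1
  · simp [inner_smul_right_eq_smul]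
  · change RCLike.re ⟪x, Real.exp (-k) • x⟫_ℂ = _
    rw [inner_smul_right_eq_smul, RCLike.smul_re]

theorem le_inner_negMulLog (hρ0 : 0 ≤ ρ) {c : ℝ} (hc : 0 < c) (x : E) :
    (1 - Real.log c) * RCLike.re ⟪x, ρ x⟫_ℂ - c⁻¹ * ‖ρ x‖ ^ 2 ≤
      RCLike.re ⟪x, cfc Real.negMulLog ρ x⟫_ℂ := by
  have hsa : IsSelfAdjoint ρ := IsSelfAdjoint.of_nonneg hρ0
  have h : cfc (fun x : ℝ => (1 - Real.log c) * x - c⁻¹ * (x * x)) ρ ≤ cfc Real.negMulLog ρ :=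
    cfc_mono (fun x hx => le_negMulLog (spectrum_nonneg_of_nonneg hρ0 hx) hc)
      (by fun_prop) Real.continuous_negMulLog.continuousOn
  rw [cfc_sub _ _ _ (by fun_prop) (by fun_prop), cfc_const_mul _ _ _ (by fun_prop),
    cfc_const_mul _ _ _ (by fun_prop), cfc_mul _ _ _ (by fun_prop) (by fun_prop), cfc_id' ℝ ρ] at h
  refine le_trans (le_of_eq ?_) (re_inner_mono h x)
  rw [← re_inner_mul_self (R := ρ) hsa.star_eq x]
  simp [inner_smul_right_eq_smul]

/-- The von Neumann entropy is at least the Rényi entropy of order two. -/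
theorem ofReal_neg_log_le_vonNeumannEntropy [SecondCountableTopology E] (hρ0 : 0 ≤ ρ)
    (hm : ∀ f, AEMeasurable (fun z => ‖⟪φ z, f⟫_ℂ‖ₑ ^ 2) ν)
    (hρ : ∀ f, ENNReal.ofReal (RCLike.re ⟪f, ρ f⟫_ℂ) = ∫⁻ z, ‖⟪φ z, f⟫_ℂ‖ₑ ^ 2 ∂ν)
    (hφ : ∫⁻ z, ‖φ z‖ₑ ^ 2 ∂ν = 1) {c : ℝ} (hc0 : 0 < c) (hc1 : c ≤ 1)
    (hc : ∫⁻ z, ∫⁻ z', ‖⟪φ z', φ z⟫_ℂ‖ₑ ^ 2 ∂ν ∂ν ≤ ENNReal.ofReal c) :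
    ENNReal.ofReal (-Real.log c) ≤ vonNeumannEntropy ρ := by
  have htr := lintegral_norm_sq_le_traceOfPositive hm hρ
  rw [hφ] at htr
  have hpos : ∀ x, 0 ≤ RCLike.re ⟪x, ρ x⟫_ℂ := fun x =>
    ((ContinuousLinearMap.nonneg_iff_isPositive ρ).1 hρ0).re_inner_nonneg_right x
  have hl : 0 ≤ 1 - Real.log c := by
    have := Real.log_nonpos hc0.le hc1
    linarith
  -- The trace is a supremum over finite families, so a family reaches only `1 - ε`. The quadratic
  -- term costs at most `1` because the purity is at most `c`, and this cancels the `1` in `1 - log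
  -- c` as `ε → 0`.
  have key : ∀ ε : ℝ, 0 < ε →
      ENNReal.ofReal ((1 - Real.log c) * (1 - ε) - 1) ≤ vonNeumannEntropy ρ := by
    intro ε hε
    have h1 : ENNReal.ofReal (1 - ε) < traceOfPositive ρ :=
      lt_of_lt_of_le (by rw [ENNReal.ofReal_lt_one]; linarith) htr
    obtain ⟨s, h2⟩ := lt_iSup_iff.1 h1
    obtain ⟨hs, h3⟩ := lt_iSup_iff.1 h2
    rw [← ENNReal.ofReal_sum_of_nonneg (fun e _ => hpos e)] at h3
    have h4 : 1 - ε ≤ ∑ e ∈ s, RCLike.re ⟪e, ρ e⟫_ℂ := by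
      by_contra! hh
      exact absurd (ENNReal.ofReal_le_ofReal hh.le) (not_le.2 h3)
    have h5 : ∑ e ∈ s, ‖ρ e‖ ^ 2 ≤ c := by
      have := (sum_norm_sq_le_lintegral hρ0 hm hρ hs).trans hc
      rw [← ENNReal.ofReal_le_ofReal_iff hc0.le, ENNReal.ofReal_sum_of_nonneg (fun _ _ => by positivity)]
      simpa [ENNReal.ofReal_pow, ofReal_norm] using this
    refine le_trans ?_ (le_iSup₂ (f := fun (s : Finset E) (_ : Orthonormal ℂ (fun e : s => (e : E))) =>
      ∑ e ∈ s, ENNReal.ofReal (RCLike.re ⟪e, (cfc Real.negMulLog ρ) e⟫_ℂ)) s hs)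
    refine le_trans ?_ (Finset.sum_le_sum fun e _ => ENNReal.ofReal_le_ofReal (le_inner_negMulLog hρ0 hc0 e))
    refine le_trans (ENNReal.ofReal_le_ofReal ?_) (Finset.le_sum_of_subadditive ENNReal.ofReal ENNReal.ofReal_zero.le
      (fun _ _ => ENNReal.ofReal_add_le) _ _)
    rw [Finset.sum_sub_distrib, ← Finset.mul_sum, ← Finset.mul_sum]
    have h6 : c⁻¹ * ∑ e ∈ s, ‖ρ e‖ ^ 2 ≤ 1 := by
      rw [inv_mul_le_iff₀ hc0]; linarith
    have h7 := mul_le_mul_of_nonneg_left h4 hl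
    linarith
  have hlim : Filter.Tendsto (fun ε : ℝ => ENNReal.ofReal ((1 - Real.log c) * (1 - ε) - 1))
      (𝓝[>] 0) (𝓝 (ENNReal.ofReal ((1 - Real.log c) * (1 - 0) - 1))) := by
    refine (ENNReal.continuous_ofReal.tendsto _).comp ?_
    exact ((by fun_prop : Continuous fun ε : ℝ => (1 - Real.log c) * (1 - ε) - 1).tendsto 0).mono_left
      nhdsWithin_le_nhds
  have := le_of_tendsto hlim (Filter.eventually_of_mem self_mem_nhdsWithin fun ε hε => key ε hε)
  simpa using this

end Traces

/-! ### Schwartz functions as vectors of `L²`. -/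

section SchwartzL2
variable {V : Type*} [NormedAddCommGroup V] [NormedSpace ℝ V] [FiniteDimensional ℝ V]
  [MeasurableSpace V] [BorelSpace V] {μ : Measure V} [μ.HasTemperateGrowth]

theorem norm_toLp_sq (f : 𝓢(V, ℂ)) : ‖f.toLp 2 μ‖ ^ 2 = ∫ x, ‖f x‖ ^ 2 ∂μ := by
  have h := SchwartzMap.inner_toL2_toL2_eq f f μ
  rw [inner_self_eq_norm_sq_to_K] at h
  simp_rw [inner_self_eq_norm_sq_to_K] at h
  have h2 : ∫ x, ((‖f x‖ : ℂ)) ^ 2 ∂μ = ((∫ x, ‖f x‖ ^ 2 ∂μ : ℝ) : ℂ) := by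
    rw [← integral_complex_ofReal]; push_cast; rfl
  exact Complex.ofReal_injective (by push_cast; exact h.trans h2)

theorem enorm_toLp_sq (f : 𝓢(V, ℂ)) : ‖f.toLp 2 μ‖ₑ ^ 2 = ∫⁻ x, ‖f x‖ₑ ^ 2 ∂μ := by
  have h := eLpNorm_nnreal_pow_eq_lintegral (μ := μ) (f := f.toLp 2 μ) (p := 2) two_ne_zero
  have h2 : ‖f.toLp 2 μ‖ₑ = eLpNorm (f.toLp 2 μ) 2 μ := by
    rw [Lp.enorm_def]
  rw [h2]
  have h3 : eLpNorm (f.toLp 2 μ) 2 μ ^ 2 = ∫⁻ x, ‖f.toLp 2 μ x‖ₑ ^ 2 ∂μ := by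
    simpa using h
  rw [h3]
  refine lintegral_congr_ae ?_
  filter_upwards [f.coeFn_toLp 2 μ] with x hx
  rw [hx]

/-- Dominated convergence for Schwartz functions in `L²`. -/
theorem tendsto_toLp {α : Type*} {l : Filter α} [l.IsCountablyGenerated] (u : α → 𝓢(V, ℂ))
    (v : 𝓢(V, ℂ)) (bound : V → ℝ) (hb : Integrable bound μ)
    (hle : ∀ᶠ a in l, ∀ x, ‖u a x - v x‖ ^ 2 ≤ bound x)
    (hlim : ∀ x, Filter.Tendsto (fun a => u a x) l (𝓝 (v x))) :
    Filter.Tendsto (fun a => (u a).toLp 2 μ) l (𝓝 (v.toLp 2 μ)) := by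
  rw [tendsto_iff_norm_sub_tendsto_zero]
  have h1 : ∀ a, ‖(u a).toLp 2 μ - v.toLp 2 μ‖ ^ 2 = ∫ x, ‖u a x - v x‖ ^ 2 ∂μ := by
    intro a
    have : (u a).toLp 2 μ - v.toLp 2 μ = (u a - v).toLp 2 μ := by
      simpa using ((SchwartzMap.toLpCLM ℂ ℂ 2 μ).map_sub (u a) v).symm
    rw [this, norm_toLp_sq]
    rfl
  have h2 : Filter.Tendsto (fun a => ∫ x, ‖u a x - v x‖ ^ 2 ∂μ) l (𝓝 (∫ _, (0 : ℝ) ∂μ)) := by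
    refine tendsto_integral_filter_of_dominated_convergence bound ?_ ?_ hb ?_
    · refine Filter.Eventually.of_forall fun a => ?_
      exact ((((u a).continuous.sub v.continuous).norm).pow 2).aestronglyMeasurable
    · filter_upwards [hle] with a ha
      refine Filter.Eventually.of_forall fun x => ?_
      rw [Real.norm_of_nonneg (by positivity)]
      exact ha x
    · refine Filter.Eventually.of_forall fun x => ?_
      have := ((hlim x).sub_const (v x)).norm.pow 2
      simpa using this
  simp_rw [← h1] at h2
  rw [integral_zero] at h2
  have h3 := h2.sqrt
  simpa [Real.sqrt_sq] using h3

end SchwartzL2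

/-! ### Integrals of rank-one operators. -/

section Superposition
variable {E : Type*} [NormedAddCommGroup E] [InnerProductSpace ℂ E] [CompleteSpace E]
  {Y : Type*} [MeasurableSpace Y] [TopologicalSpace Y] [OpensMeasurableSpace Y]
  [SecondCountableTopology Y] {μ : Measure Y} {φ : Y → E}

theorem enorm_rankOne_self (x : E) : ‖InnerProductSpace.rankOne ℂ x x‖ₑ = ‖x‖ₑ ^ 2 := by
  rw [← ofReal_norm, InnerProductSpace.norm_rankOne, ← sq, ENNReal.ofReal_pow (norm_nonneg _),
    ofReal_norm]

theorem integrable_rankOne (hc : Continuous φ) (hφ : ∫⁻ y, ‖φ y‖ₑ ^ 2 ∂μ ≠ ⊤) :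
    Integrable (fun y => InnerProductSpace.rankOne ℂ (φ y) (φ y)) μ := by
  refine ⟨?_, ?_⟩
  · refine Continuous.aestronglyMeasurable ?_
    exact (ContinuousLinearMap.smulRightL ℂ E E).continuous₂.comp
      (((innerSL ℂ).continuous.comp hc).prodMk hc)
  · rw [HasFiniteIntegral]
    simp_rw [enorm_rankOne_self]
    exact hφ.lt_top

theorem inner_integral_rankOne (hc : Continuous φ) (hφ : ∫⁻ y, ‖φ y‖ₑ ^ 2 ∂μ ≠ ⊤) (f : E) :
    Integrable (fun y => ‖⟪φ y, f⟫_ℂ‖ ^ 2) μ ∧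
    ⟪f, (∫ y, InnerProductSpace.rankOne ℂ (φ y) (φ y) ∂μ) f⟫_ℂ =
      ((∫ y, ‖⟪φ y, f⟫_ℂ‖ ^ 2 ∂μ : ℝ) : ℂ) := by
  have hi := integrable_rankOne hc hφ
  set A := (innerSL ℂ f) ∘L (ContinuousLinearMap.apply ℂ E f)
  have h2 : ∀ y, A (InnerProductSpace.rankOne ℂ (φ y) (φ y)) = ((‖⟪φ y, f⟫_ℂ‖ ^ 2 : ℝ) : ℂ) := by
    intro y
    simp only [A, ContinuousLinearMap.comp_apply, ContinuousLinearMap.apply_apply, innerSL_apply_apply,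
      InnerProductSpace.rankOne_apply, inner_smul_right]
    rw [← inner_conj_symm f, RCLike.mul_conj]
    norm_cast
  constructor
  · have := A.integrable_comp hi
    simp_rw [h2] at this
    exact this.re
  · have h1 : ⟪f, (∫ y, InnerProductSpace.rankOne ℂ (φ y) (φ y) ∂μ) f⟫_ℂ =
      A (∫ y, InnerProductSpace.rankOne ℂ (φ y) (φ y) ∂μ) := rfl
    rw [h1, ← ContinuousLinearMap.integral_comp_comm _ hi, ← integral_complex_ofReal]
    simp_rw [h2]

theorem ofReal_re_inner_integral_rankOne (hc : Continuous φ) (hφ : ∫⁻ y, ‖φ y‖ₑ ^ 2 ∂μ ≠ ⊤) (f : E) :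
    ENNReal.ofReal (RCLike.re ⟪f, (∫ y, InnerProductSpace.rankOne ℂ (φ y) (φ y) ∂μ) f⟫_ℂ) =
      ∫⁻ y, ‖⟪φ y, f⟫_ℂ‖ₑ ^ 2 ∂μ := by
  rw [(inner_integral_rankOne hc hφ f).2]
  have h3 : RCLike.re ((∫ y, ‖⟪φ y, f⟫_ℂ‖ ^ 2 ∂μ : ℝ) : ℂ) = ∫ y, ‖⟪φ y, f⟫_ℂ‖ ^ 2 ∂μ := by
    simp
  rw [h3, ofReal_integral_eq_lintegral_ofReal (inner_integral_rankOne hc hφ f).1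
    (Filter.Eventually.of_forall fun y => by positivity)]
  simp_rw [ENNReal.ofReal_pow (norm_nonneg _), ofReal_norm]

theorem integral_rankOne_nonneg (hc : Continuous φ) (hφ : ∫⁻ y, ‖φ y‖ₑ ^ 2 ∂μ ≠ ⊤) :
    0 ≤ ∫ y, InnerProductSpace.rankOne ℂ (φ y) (φ y) ∂μ := by
  rw [ContinuousLinearMap.nonneg_iff_isPositive, ContinuousLinearMap.isPositive_iff_complex]
  intro f
  rw [← inner_conj_symm, (inner_integral_rankOne hc hφ f).2, Complex.conj_ofReal]
  refine ⟨by simp, ?_⟩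
  simp only [RCLike.re_to_complex, Complex.ofReal_re]
  exact integral_nonneg fun y => by positivity

theorem measurable_enorm_inner (hc : Continuous φ) (f : E) :
    AEMeasurable (fun y => ‖⟪φ y, f⟫_ℂ‖ₑ ^ 2) μ := by
  have : Continuous fun y => ⟪φ y, f⟫_ℂ := by fun_prop
  exact (this.measurable.enorm.pow_const 2).aemeasurable

end Superposition

/-! ### Slices of a wave function. -/

section ReducedDensity
variable {NA NB : ℕ} (ψ : WaveFunction NA NB)

theorem slice_apply (y : Config NB) (x : Config NA) : slice ψ y x = ψ (x, y) := rfl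

/-- Schwartz decay bounds `|ψ (x, y)|` by an integrable function of `x` uniformly in `y`, so
pointwise continuity in `y` passes to `L²` by dominated convergence. This continuity makes the
integrand of the reduced density operator strongly measurable. -/
theorem continuous_slice_toLp : Continuous fun y => (slice ψ y).toLp 2 (volume : Measure (Config NA)) := by
  rw [continuous_iff_continuousAt]
  intro y0
  set r : ℕ := Module.finrank ℝ (Config NA) + 1 with hr
  obtain ⟨C, hC⟩ : ∃ C : ℝ, ∀ z : Config NA × Config NB, (1 + ‖z‖) ^ r * ‖ψ z‖ ≤ C := by
    refine ⟨2 ^ r * (Finset.Iic (r, 0)).sup (fun m => SchwartzMap.seminorm ℝ m.1 m.2) ψ, fun z => ?_⟩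
    simpa using SchwartzMap.one_add_le_sup_seminorm_apply (𝕜 := ℝ) (m := (r, 0)) le_rfl le_rfl ψ z
  have hC0 : 0 ≤ C := le_trans (by positivity) (hC 0)
  have hb : ∀ (y : Config NB) (x : Config NA), ‖ψ (x, y)‖ ≤ C * (1 + ‖x‖) ^ (-(r : ℝ)) := by
    intro y x
    have h1 : (1 + ‖x‖) ^ r ≤ (1 + ‖(x, y)‖) ^ r := by
      gcongr
      exact le_max_left _ _
    have h2 : 0 < (1 + ‖x‖) ^ r := by positivity
    rw [Real.rpow_neg (by positivity), Real.rpow_natCast, ← div_eq_mul_inv, le_div_iff₀ h2, mul_comm]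
    exact (mul_le_mul_of_nonneg_right h1 (norm_nonneg _)).trans (hC _)
  refine tendsto_toLp (fun y => slice ψ y) (slice ψ y0) (fun x => (2 * C) ^ 2 * (1 + ‖x‖) ^ (-(r : ℝ)))
    ((integrable_one_add_norm (by rw [hr]; push_cast; linarith)).const_mul _) ?_ ?_
  · refine Filter.Eventually.of_forall fun y x => ?_
    rw [slice_apply, slice_apply]
    have h1 : ‖ψ (x, y) - ψ (x, y0)‖ ≤ 2 * C * (1 + ‖x‖) ^ (-(r : ℝ)) := by
      refine (norm_sub_le _ _).trans ?_
      linarith [hb y x, hb y0 x]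
    have h2 : (1 + ‖x‖) ^ (-(r : ℝ)) ≤ 1 :=
      Real.rpow_le_one_of_one_le_of_nonpos (by linarith [norm_nonneg x]) (by simp)
    have h3 : 0 ≤ (1 + ‖x‖) ^ (-(r : ℝ)) := by positivity
    calc ‖ψ (x, y) - ψ (x, y0)‖ ^ 2 ≤ (2 * C * (1 + ‖x‖) ^ (-(r : ℝ))) ^ 2 := by gcongr
      _ = (2 * C) ^ 2 * ((1 + ‖x‖) ^ (-(r : ℝ)) * (1 + ‖x‖) ^ (-(r : ℝ))) := by ring
      _ ≤ (2 * C) ^ 2 * ((1 + ‖x‖) ^ (-(r : ℝ)) * 1) := by gcongr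
      _ = _ := by ring
  · intro x
    have : Continuous fun y : Config NB => ψ (x, y) := by fun_prop
    exact this.tendsto y0

theorem lintegral_enorm_slice_sq :
    ∫⁻ y, ‖(slice ψ y).toLp 2 (volume : Measure (Config NA))‖ₑ ^ 2 = ‖ψ.toLp 2‖ₑ ^ 2 := by
  rw [enorm_toLp_sq]
  simp_rw [enorm_toLp_sq, slice_apply]
  have hm : Measurable fun z : Config NA × Config NB => ‖ψ z‖ₑ ^ 2 :=
    (ψ.continuous.measurable.enorm).pow_const 2
  exact (lintegral_prod_symm' (μ := (volume : Measure (Config NA))) (ν := (volume : Measure (Config NB))) _ hm).symm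

end ReducedDensity

/-! ### Exponentials that are Schwartz functions. -/

section ExpSchwartz
open scoped ContDiff
variable {V : Type*} [NormedAddCommGroup V] [NormedSpace ℝ V]

theorem hasTemperateGrowth_fderiv {p : V → ℂ} (hp : p.HasTemperateGrowth) :
    (fderiv ℝ p).HasTemperateGrowth := by
  refine ⟨hp.1.fderiv_right (by simp), fun n => ?_⟩
  obtain ⟨k, C, h⟩ := hp.2 (n + 1)
  exact ⟨k, C, fun x => by rw [norm_iteratedFDeriv_fderiv]; exact h x⟩

/-- The derivative of `exp p` is `exp p` times the derivative of `p`, which has temperate growth. By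
Leibniz' rule the next derivative involves all lower ones, hence the strong induction; only
polynomial factors accumulate in front of `|exp p|`. -/
theorem norm_iteratedFDeriv_cexp_le {p : V → ℂ} (hp : p.HasTemperateGrowth) (n : ℕ) :
    ∃ (C : ℝ) (m : ℕ), 0 ≤ C ∧ ∀ x, ‖iteratedFDeriv ℝ n (fun y => Complex.exp (p y)) x‖ ≤
      C * (1 + ‖x‖) ^ m * ‖Complex.exp (p x)‖ := by
  have hφ : ContDiff ℝ ∞ (fun y => Complex.exp (p y)) := hp.1.cexp
  induction n using Nat.strong_induction_on with
  | _ n ih =>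
    rcases n with _ | n
    · exact ⟨1, 0, zero_le_one, fun x => by simp⟩
    · have hd : fderiv ℝ (fun y => Complex.exp (p y)) = fun y => Complex.exp (p y) • fderiv ℝ p y := by
        funext y
        exact (((hp.1.differentiable (by simp)) y).hasFDerivAt.cexp).fderiv
      choose! C m hC0 hC using ih
      choose k D hD using (hasTemperateGrowth_fderiv hp).2
      have hD0 : ∀ j, 0 ≤ D j := fun j => le_of_mul_le_mul_right (a := (1 + ‖(0 : V)‖) ^ k j)
        (by rw [zero_mul]; exact (norm_nonneg _).trans (hD j 0)) (by simp)
      set m' := ∑ i ∈ Finset.range (n + 1), (m i + k (n - i))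
      refine ⟨∑ i ∈ Finset.range (n + 1), (n.choose i : ℝ) * C i * D (n - i), m', ?_, fun x => ?_⟩
      · refine Finset.sum_nonneg fun i hi => ?_
        have := hC0 i (by simpa using hi)
        have := hD0 (n - i)
        positivity
      · rw [← norm_iteratedFDeriv_fderiv, hd]
        refine (norm_iteratedFDeriv_smul_le (N := ∞) hφ (hasTemperateGrowth_fderiv hp).1 x
          (by exact_mod_cast le_top)).trans ?_
        rw [Finset.sum_mul, Finset.sum_mul]
        refine Finset.sum_le_sum fun i hi => ?_
        have hi' : i < n + 1 := by simpa using hi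
        have h1 := hC i hi' x
        have h2 := hD (n - i) x
        have h3 : (1 + ‖x‖) ^ (m i + k (n - i)) ≤ (1 + ‖x‖) ^ m' := by
          refine pow_le_pow_right₀ (by linarith [norm_nonneg x]) ?_
          exact Finset.single_le_sum (f := fun i => m i + k (n - i)) (fun _ _ => Nat.zero_le _) hi
        have h4 := hC0 i hi'
        have h5 := hD0 (n - i)
        calc (n.choose i : ℝ) * ‖iteratedFDeriv ℝ i (fun y => Complex.exp (p y)) x‖ *
              ‖iteratedFDeriv ℝ (n - i) (fderiv ℝ p) x‖
            ≤ (n.choose i : ℝ) * (C i * (1 + ‖x‖) ^ m i * ‖Complex.exp (p x)‖) *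
              (D (n - i) * (1 + ‖x‖) ^ k (n - i)) := by gcongr
          _ = (n.choose i : ℝ) * C i * D (n - i) * (1 + ‖x‖) ^ (m i + k (n - i)) *
              ‖Complex.exp (p x)‖ := by rw [pow_add]; ring
          _ ≤ _ := by gcongr

/-- The exponential of a function of temperate growth is a Schwartz function as soon as it decays
rapidly. -/
def expSchwartz (p : V → ℂ) (hp : p.HasTemperateGrowth)
    (hd : ∀ m : ℕ, ∃ C : ℝ, ∀ x, (1 + ‖x‖) ^ m * ‖Complex.exp (p x)‖ ≤ C) : 𝓢(V, ℂ) where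
  toFun x := Complex.exp (p x)
  smooth' := hp.1.cexp
  decay' k n := by
    obtain ⟨C, m, hC0, hC⟩ := norm_iteratedFDeriv_cexp_le hp n
    obtain ⟨D, hD⟩ := hd (k + m)
    refine ⟨C * D, fun x => ?_⟩
    have h1 : ‖x‖ ^ k ≤ (1 + ‖x‖) ^ k := by gcongr; linarith
    calc ‖x‖ ^ k * ‖iteratedFDeriv ℝ n (fun x => Complex.exp (p x)) x‖
        ≤ (1 + ‖x‖) ^ k * (C * (1 + ‖x‖) ^ m * ‖Complex.exp (p x)‖) := by
          gcongr
          exact hC x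
      _ = C * ((1 + ‖x‖) ^ (k + m) * ‖Complex.exp (p x)‖) := by rw [pow_add]; ring
      _ ≤ C * D := by gcongr; exact hD x

end ExpSchwartz

/-! ### Gaussian wave functions. -/

section Gaussian
variable {ι : Type*} [Fintype ι] [DecidableEq ι]
  {V : Type*} [NormedAddCommGroup V] [NormedSpace ℝ V]

/-- The exponent `-½ x·Zx + b·x` of a Gaussian wave function. -/
def gaussianExponent (Z : Matrix ι ι ℂ) (b : ι → ℂ) (x : ι → ℝ) : ℂ :=
  -(1 / 2) * ∑ i, ∑ j, Z i j * x i * x j + ∑ i, b i * x i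

theorem pow_mul_exp_le (m : ℕ) {ε : ℝ} (hε : 0 < ε) (β : ℝ) :
    ∃ C : ℝ, ∀ r : ℝ, 0 ≤ r → (1 + r) ^ m * Real.exp (-ε * r ^ 2 + β * r) ≤ C := by
  -- The factor `(1 + r)^m` is at most `m! exp (1 + r)`; completing the square in `(β + 1) r - ε r²`
  -- gives the rest of the constant.
  refine ⟨m.factorial * Real.exp (1 + (β + 1) ^ 2 / (4 * ε)), fun r hr => ?_⟩
  have h1 := Real.pow_div_factorial_le_exp (1 + r) (by linarith) m
  rw [div_le_iff₀ (by positivity)] at h1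
  calc (1 + r) ^ m * Real.exp (-ε * r ^ 2 + β * r)
      ≤ Real.exp (1 + r) * m.factorial * Real.exp (-ε * r ^ 2 + β * r) := by gcongr
    _ = m.factorial * Real.exp (1 + r + (-ε * r ^ 2 + β * r)) := by rw [Real.exp_add (1 + r)]; ring
    _ ≤ _ := by
      refine mul_le_mul_of_nonneg_left (Real.exp_le_exp.2 ?_) (by positivity)
      have : (β + 1) ^ 2 / (4 * ε) - ((β + 1) * r - ε * r ^ 2) =
          (2 * ε * r - (β + 1)) ^ 2 / (4 * ε) := by field_simp; ring
      have h2 : 0 ≤ (2 * ε * r - (β + 1)) ^ 2 / (4 * ε) := by positivity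
      linarith

theorem exists_posDef_lower_bound {X : Matrix ι ι ℝ} (hX : X.PosDef) :
    ∃ ε : ℝ, 0 < ε ∧ ∀ x : ι → ℝ, ε * ‖x‖ ^ 2 ≤ x ⬝ᵥ X *ᵥ x := by
  obtain ⟨B, hB, hd⟩ := exists_transpose_mul_self hX
  have hu : IsUnit B.det := isUnit_iff_ne_zero.2 hd
  set T := LinearMap.toContinuousLinearMap (Matrix.toLin' B⁻¹)
  have h1 : ∀ x : ι → ℝ, ‖x‖ ≤ (‖T‖ + 1) * ‖B *ᵥ x‖ := by
    intro x
    have h : T (B *ᵥ x) = x := by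
      change B⁻¹ *ᵥ (B *ᵥ x) = x
      rw [Matrix.mulVec_mulVec, Matrix.nonsing_inv_mul _ hu, Matrix.one_mulVec]
    calc ‖x‖ = ‖T (B *ᵥ x)‖ := by rw [h]
      _ ≤ ‖T‖ * ‖B *ᵥ x‖ := T.le_opNorm _
      _ ≤ _ := by gcongr; linarith
  -- The norm on `ι → ℝ` is the supremum norm, which is dominated by the Euclidean one.
  have h2 : ∀ u : ι → ℝ, ‖u‖ ^ 2 ≤ u ⬝ᵥ u := by
    intro u
    have : ‖u‖ ≤ Real.sqrt (u ⬝ᵥ u) := by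
      refine (pi_norm_le_iff_of_nonneg (Real.sqrt_nonneg _)).2 fun i => ?_
      refine Real.le_sqrt_of_sq_le ?_
      rw [Real.norm_eq_abs, sq_abs, dotProduct, sq]
      exact Finset.single_le_sum (f := fun i => u i * u i) (fun i _ => mul_self_nonneg _) (Finset.mem_univ i)
    have h0 : 0 ≤ u ⬝ᵥ u := Finset.sum_nonneg fun i _ => mul_self_nonneg _
    calc ‖u‖ ^ 2 ≤ Real.sqrt (u ⬝ᵥ u) ^ 2 := by gcongr
      _ = _ := Real.sq_sqrt h0
  refine ⟨((‖T‖ + 1) ^ 2)⁻¹, by positivity, fun x => ?_⟩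
  have h3 : x ⬝ᵥ X *ᵥ x = (B *ᵥ x) ⬝ᵥ (B *ᵥ x) := by
    rw [hB, ← Matrix.mulVec_mulVec, Matrix.dotProduct_mulVec, Matrix.vecMul_transpose]
  rw [h3, inv_mul_le_iff₀ (by positivity)]
  calc ‖x‖ ^ 2 ≤ ((‖T‖ + 1) * ‖B *ᵥ x‖) ^ 2 := by gcongr; exact h1 x
    _ = (‖T‖ + 1) ^ 2 * ‖B *ᵥ x‖ ^ 2 := by ring
    _ ≤ _ := by gcongr; exact h2 _

theorem re_gaussianExponent (Z : Matrix ι ι ℂ) (b : ι → ℂ) (x : ι → ℝ) :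
    (gaussianExponent Z b x).re =
      -(1 / 2) * (x ⬝ᵥ Z.map Complex.re *ᵥ x) + (fun i => (b i).re) ⬝ᵥ x := by
  have h : gaussianExponent Z b x = -((1 / 2 : ℝ) : ℂ) * ∑ i, ∑ j, Z i j * (x i * x j : ℝ) + ∑ i, b i * x i := by
    simp only [gaussianExponent]
    push_cast
    simp only [mul_assoc]
  rw [h]
  simp only [← Complex.ofReal_neg, Complex.add_re, Complex.re_ofReal_mul, Complex.re_sum, Complex.re_mul_ofReal]
  simp only [dotProduct, Matrix.mulVec, Matrix.map_apply, Finset.mul_sum]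
  congr 1
  refine Finset.sum_congr rfl fun i _ => Finset.sum_congr rfl fun j _ => by ring

theorem norm_cexp_gaussianExponent (Z : Matrix ι ι ℂ) (b : ι → ℂ) (x : ι → ℝ) :
    ‖Complex.exp (gaussianExponent Z b x)‖ =
      Real.exp (-(1 / 2) * (x ⬝ᵥ Z.map Complex.re *ᵥ x) + (fun i => (b i).re) ⬝ᵥ x) := by
  rw [Complex.norm_exp, re_gaussianExponent]

theorem exists_norm_gaussian_le {Z : Matrix ι ι ℂ} (hZ : (Z.map Complex.re).PosDef) (b : ι → ℂ) :
    ∃ ε β : ℝ, 0 < ε ∧ ∀ x : ι → ℝ,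
      ‖Complex.exp (gaussianExponent Z b x)‖ ≤ Real.exp (-ε * ‖x‖ ^ 2 + β * ‖x‖) := by
  obtain ⟨ε, hε, h⟩ := exists_posDef_lower_bound hZ
  refine ⟨ε / 2, ∑ i, |(b i).re|, by positivity, fun x => ?_⟩
  rw [norm_cexp_gaussianExponent]
  refine Real.exp_le_exp.2 (add_le_add ?_ ?_)
  · have := h x; linarith
  · rw [dotProduct, Finset.sum_mul]
    refine Finset.sum_le_sum fun i _ => ?_
    refine (le_abs_self _).trans ?_
    rw [abs_mul]
    gcongr
    exact norm_le_pi_norm x i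

theorem hasTemperateGrowth_gaussianExponent (Z : Matrix ι ι ℂ) (b : ι → ℂ) (L : V ≃L[ℝ] (ι → ℝ)) :
    (fun x => gaussianExponent Z b (L x)).HasTemperateGrowth := by
  have h : ∀ i, (fun x => ((L x i : ℝ) : ℂ)).HasTemperateGrowth := fun i =>
    (Complex.ofRealCLM ∘L (ContinuousLinearMap.proj (R := ℝ) (φ := fun _ : ι => ℝ) i) ∘L (L : V →L[ℝ] (ι → ℝ))).hasTemperateGrowth
  unfold gaussianExponent
  fun_prop

theorem exists_norm_le_equiv (L : V ≃L[ℝ] (ι → ℝ)) :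
    ∃ K : ℝ, 1 ≤ K ∧ ∀ x, 1 + ‖x‖ ≤ K * (1 + ‖L x‖) := by
  refine ⟨‖(L.symm : (ι → ℝ) →L[ℝ] V)‖ + 1, by linarith [norm_nonneg (L.symm : (ι → ℝ) →L[ℝ] V)], fun x => ?_⟩
  have h := (L.symm : (ι → ℝ) →L[ℝ] V).le_opNorm (L x)
  simp only [ContinuousLinearEquiv.coe_coe, ContinuousLinearEquiv.symm_apply_apply] at h
  nlinarith [norm_nonneg (L x), norm_nonneg (L.symm : (ι → ℝ) →L[ℝ] V)]

theorem gaussian_rapidDecay {Z : Matrix ι ι ℂ} (hZ : (Z.map Complex.re).PosDef) (b : ι → ℂ)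
    (L : V ≃L[ℝ] (ι → ℝ)) (m : ℕ) :
    ∃ C : ℝ, ∀ x, (1 + ‖x‖) ^ m * ‖Complex.exp (gaussianExponent Z b (L x))‖ ≤ C := by
  obtain ⟨ε, β, hε, h⟩ := exists_norm_gaussian_le hZ b
  obtain ⟨C, hC⟩ := pow_mul_exp_le m hε β
  obtain ⟨K, hK1, hK⟩ := exists_norm_le_equiv L
  refine ⟨K ^ m * C, fun x => ?_⟩
  calc (1 + ‖x‖) ^ m * ‖Complex.exp (gaussianExponent Z b (L x))‖
      ≤ (K * (1 + ‖L x‖)) ^ m * Real.exp (-ε * ‖L x‖ ^ 2 + β * ‖L x‖) := by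
        gcongr
        · exact hK x
        · exact h _
    _ = K ^ m * ((1 + ‖L x‖) ^ m * Real.exp (-ε * ‖L x‖ ^ 2 + β * ‖L x‖)) := by
        rw [mul_pow, mul_assoc]
    _ ≤ _ := by gcongr; exact hC _ (norm_nonneg _)

open Classical in
/-- The Gaussian `exp (-½ x·Zx + b·x)` in the coordinates `L`, as a Schwartz function
(zero if the real part of `Z` is not positive definite). -/
def gaussian (L : V ≃L[ℝ] (ι → ℝ)) (Z : Matrix ι ι ℂ) (b : ι → ℂ) : 𝓢(V, ℂ) :=
  if h : (Z.map Complex.re).PosDef then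
    expSchwartz (fun x => gaussianExponent Z b (L x)) (hasTemperateGrowth_gaussianExponent Z b L)
      (gaussian_rapidDecay h b L)
  else 0

theorem gaussian_apply (L : V ≃L[ℝ] (ι → ℝ)) {Z : Matrix ι ι ℂ} (hZ : (Z.map Complex.re).PosDef)
    (b : ι → ℂ) (x : V) : gaussian L Z b x = Complex.exp (gaussianExponent Z b (L x)) := by
  rw [gaussian, dif_pos hZ]
  rfl

theorem hasFDerivAt_gaussianExponent {Z : Matrix ι ι ℂ} (hZ : Zᵀ = Z) (b : ι → ℂ)
    (L : V ≃L[ℝ] (ι → ℝ)) (x v : V) :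
    HasLineDerivAt ℝ (fun x => gaussianExponent Z b (L x))
      (∑ i, (b i - ∑ j, Z i j * L x j) * L v i) x v := by
  have h : ∀ i, HasDerivAt (fun t : ℝ => ((L (x + t • v) i : ℝ) : ℂ)) (L v i) 0 := by
    intro i
    have : HasDerivAt (fun t : ℝ => L x i + t * L v i) (L v i) 0 := by
      simpa using ((hasDerivAt_id (0 : ℝ)).mul_const (L v i)).const_add (L x i)
    simpa using this.ofReal_comp
  have h2 := ((HasDerivAt.fun_sum fun i (_ : i ∈ Finset.univ) => HasDerivAt.fun_sum fun j (_ : j ∈ Finset.univ) =>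
    ((h i).const_mul (Z i j)).mul (h j)).const_mul (-(1 / 2 : ℂ))).add
    (HasDerivAt.fun_sum fun i (_ : i ∈ Finset.univ) => (h i).const_mul (b i))
  refine h2.congr_deriv ?_
  simp only [zero_smul, add_zero]
  have h3 : ∑ i, ∑ j, (Z i j * L v i * L x j + Z i j * L x i * L v j) =
      2 * ∑ i, ∑ j, Z i j * L x j * (L v i : ℂ) := by
    simp_rw [Finset.sum_add_distrib]
    rw [Finset.sum_comm (f := fun i j => Z i j * L x i * (L v j : ℂ)), two_mul]
    congr 1
    · exact Finset.sum_congr rfl fun i _ => Finset.sum_congr rfl fun j _ => by ring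
    · exact Finset.sum_congr rfl fun i _ => Finset.sum_congr rfl fun j _ => by
        rw [← hZ, Matrix.transpose_apply, hZ]
  rw [h3]
  simp_rw [sub_mul, Finset.sum_sub_distrib, Finset.sum_mul]
  ring

end Gaussian

/-! ### Continuity and differentiability in `L²` of paths of Gaussians. -/

section GaussianPath
variable {ι : Type*} [Fintype ι] [DecidableEq ι]
  {V : Type*} [NormedAddCommGroup V] [NormedSpace ℝ V] [FiniteDimensional ℝ V]
  [MeasurableSpace V] [BorelSpace V] {μ : Measure V} [hμ : μ.HasTemperateGrowth]

theorem gaussianExponent_sub (Z Z' : Matrix ι ι ℂ) (b b' : ι → ℂ) (x : ι → ℝ) :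
    gaussianExponent Z b x - gaussianExponent Z' b' x = gaussianExponent (Z - Z') (b - b') x := by
  simp only [gaussianExponent, Matrix.sub_apply, Pi.sub_apply, sub_mul, Finset.sum_sub_distrib]
  ring

theorem norm_gaussianExponent_le (Z : Matrix ι ι ℂ) (b : ι → ℂ) (x : ι → ℝ) :
    ‖gaussianExponent Z b x‖ ≤ (∑ i, ∑ j, ‖Z i j‖ + ∑ i, ‖b i‖) * (1 + ‖x‖) ^ 2 := by
  have hx : ∀ i, ‖(x i : ℂ)‖ ≤ 1 + ‖x‖ := fun i => by
    rw [Complex.norm_real]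
    exact (norm_le_pi_norm x i).trans (by linarith)
  have h1 : ‖∑ i, ∑ j, Z i j * x i * x j‖ ≤ (∑ i, ∑ j, ‖Z i j‖) * (1 + ‖x‖) ^ 2 := by
    rw [Finset.sum_mul]
    refine norm_sum_le_of_le _ fun i _ => ?_
    rw [Finset.sum_mul]
    refine norm_sum_le_of_le _ fun j _ => ?_
    rw [norm_mul, norm_mul, mul_assoc, sq]
    have := hx i
    have := hx j
    gcongr
  have h2 : ‖∑ i, b i * x i‖ ≤ (∑ i, ‖b i‖) * (1 + ‖x‖) ^ 2 := by
    rw [Finset.sum_mul]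
    refine norm_sum_le_of_le _ fun i _ => ?_
    rw [norm_mul]
    have h := hx i
    have : (1 + ‖x‖) ≤ (1 + ‖x‖) ^ 2 := by nlinarith [norm_nonneg x]
    gcongr
    linarith
  rw [gaussianExponent, add_mul]
  refine (norm_add_le _ _).trans (add_le_add ?_ h2)
  rw [norm_mul]
  have : ‖-(1 / 2 : ℂ)‖ ≤ 1 := by norm_num
  calc _ ≤ 1 * ‖∑ i, ∑ j, Z i j * x i * x j‖ := by gcongr
    _ ≤ _ := by rw [one_mul]; exact h1

theorem norm_cexp_sub_one_le (w : ℂ) : ‖Complex.exp w - 1‖ ≤ ‖w‖ * Real.exp ‖w‖ := by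
  have := Complex.norm_exp_sub_sum_le_norm_mul_exp w 1
  simpa using this

/-- One-sided differentiability gives a Lipschitz estimate at the base point. It makes the
difference quotients of the Gaussians uniformly dominated for times close to `t`. -/
theorem exists_eventually_norm_sub_le {Z : ℝ → Matrix ι ι ℂ} {b : ℝ → ι → ℂ}
    {Z' : Matrix ι ι ℂ} {b' : ι → ℂ} {t : ℝ}
    (hZ : ∀ i j, HasDerivWithinAt (fun s => Z s i j) (Z' i j) (Set.Ici t) t)
    (hb : ∀ i, HasDerivWithinAt (fun s => b s i) (b' i) (Set.Ici t) t) :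
    ∃ K : ℝ, 0 < K ∧ ∀ᶠ s in 𝓝[>] t,
      ∑ i, ∑ j, ‖Z s i j - Z t i j‖ + ∑ i, ‖b s i - b t i‖ ≤ K * (s - t) := by
  have key : ∀ {f : ℝ → ℂ} {f' : ℂ}, HasDerivWithinAt f f' (Set.Ici t) t →
      ∀ᶠ s in 𝓝[>] t, ‖f s - f t‖ ≤ (‖f'‖ + 1) * (s - t) := by
    intro f f' hf
    have h1 := ((hasDerivWithinAt_iff_tendsto_slope' (by simp)).1 hf.Ioi_of_Ici).norm
    filter_upwards [h1.eventually_lt_const (show ‖f'‖ < ‖f'‖ + 1 by linarith), self_mem_nhdsWithin] with s hs hst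
    have hst' : 0 < s - t := sub_pos.2 hst
    rw [slope_def_module, norm_smul, Real.norm_eq_abs, abs_inv, abs_of_pos hst', inv_mul_lt_iff₀ hst'] at hs
    linarith
  refine ⟨∑ i, ∑ j, (‖Z' i j‖ + 1) + ∑ i, (‖b' i‖ + 1) + 1, by positivity, ?_⟩
  have e1 : ∀ᶠ s in 𝓝[>] t, ∀ i j, ‖Z s i j - Z t i j‖ ≤ (‖Z' i j‖ + 1) * (s - t) :=
    Filter.eventually_all.2 fun i => Filter.eventually_all.2 fun j => key (hZ i j)
  have e2 : ∀ᶠ s in 𝓝[>] t, ∀ i, ‖b s i - b t i‖ ≤ (‖b' i‖ + 1) * (s - t) :=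
    Filter.eventually_all.2 fun i => key (hb i)
  filter_upwards [e1, e2, self_mem_nhdsWithin] with s h1 h2 hst
  have hst' : 0 < s - t := sub_pos.2 hst
  rw [add_mul, add_mul, one_mul]
  have h3 : ∑ i, ∑ j, ‖Z s i j - Z t i j‖ ≤ (∑ i, ∑ j, (‖Z' i j‖ + 1)) * (s - t) := by
    simp_rw [Finset.sum_mul]
    exact Finset.sum_le_sum fun i _ => Finset.sum_le_sum fun j _ => h1 i j
  have h4 : ∑ i, ‖b s i - b t i‖ ≤ (∑ i, (‖b' i‖ + 1)) * (s - t) := by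
    rw [Finset.sum_mul]
    exact Finset.sum_le_sum fun i _ => h2 i
  linarith

/-- A continuous path of Gaussian wave functions is continuous in `L²`. -/
theorem tendsto_gaussian_toLp {α : Type*} {l : Filter α} [l.IsCountablyGenerated] (L : V ≃L[ℝ] (ι → ℝ))
    {Z : α → Matrix ι ι ℂ} {b : α → ι → ℂ} {Z₀ : Matrix ι ι ℂ} {b₀ : ι → ℂ}
    (hpos : ∀ᶠ s in l, ((Z s).map Complex.re).PosDef) (hpos₀ : (Z₀.map Complex.re).PosDef)
    (hZ : Filter.Tendsto Z l (𝓝 Z₀)) (hb : Filter.Tendsto b l (𝓝 b₀)) :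
    Filter.Tendsto (fun s => (gaussian L (Z s) (b s)).toLp 2 μ) l (𝓝 ((gaussian L Z₀ b₀).toLp 2 μ)) := by
  have hZ' : ∀ i j, Filter.Tendsto (fun s => Z s i j) l (𝓝 (Z₀ i j)) := fun i j =>
    tendsto_pi_nhds.1 (tendsto_pi_nhds.1 hZ i) j
  have hb' : ∀ i, Filter.Tendsto (fun s => b s i) l (𝓝 (b₀ i)) := tendsto_pi_nhds.1 hb
  obtain ⟨ε, β, hε, hbd⟩ := exists_norm_gaussian_le hpos₀ b₀
  obtain ⟨k, hk⟩ := hμ.exists_integrable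
  obtain ⟨A, hA1, hA⟩ := exists_norm_le_equiv L
  obtain ⟨C, hC⟩ := pow_mul_exp_le (k + 2) (half_pos hε) (β + ε)
  have hδ : ∀ᶠ s in l, ∑ i, ∑ j, ‖Z s i j - Z₀ i j‖ + ∑ i, ‖b s i - b₀ i‖ < ε / 2 := by
    have h1 : Filter.Tendsto (fun s => ∑ i, ∑ j, ‖Z s i j - Z₀ i j‖ + ∑ i, ‖b s i - b₀ i‖) l
        (𝓝 (∑ i, ∑ j, ‖Z₀ i j - Z₀ i j‖ + ∑ i, ‖b₀ i - b₀ i‖)) :=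
      (tendsto_finsetSum _ fun i _ => tendsto_finsetSum _ fun j _ => ((hZ' i j).sub_const _).norm).add
        (tendsto_finsetSum _ fun i _ => ((hb' i).sub_const _).norm)
    simp only [sub_self, norm_zero, Finset.sum_const_zero, add_zero] at h1
    exact h1.eventually_lt_const (half_pos hε)
  -- Close to the limit the exponents differ by `w` with `|w| ≤ (ε/2)(1 + r)²`, and `|exp w - 1| ≤
  -- |w| exp |w|`. Half of the decay `exp (-ε r²)` absorbs `exp |w|`; the other half absorbs the
  -- polynomial factors, including the weight `(1 + r)^k` needed for integrability. `D` is the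
  -- resulting constant.
  set D := ε / 2 * Real.exp (ε / 2) * C with hD
  refine tendsto_toLp _ _ (fun x => D ^ 2 * A ^ k * (1 + ‖x‖) ^ (-(k : ℝ))) (hk.const_mul _) ?_ ?_
  · filter_upwards [hδ, hpos] with s hs hps x
    set r := ‖L x‖ with hr
    have hr0 : 0 ≤ r := norm_nonneg _
    set e := Real.exp (-(ε / 2) * r ^ 2 + (β + ε) * r) with he
    have hmain := hC r hr0
    have hpt : ‖gaussian L Z₀ b₀ x‖ ≤ Real.exp (-ε * r ^ 2 + β * r) := by
      rw [gaussian_apply L hpos₀]; exact hbd _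
    set w := gaussianExponent (Z s - Z₀) (b s - b₀) (L x) with hw
    have hw1 : ‖w‖ ≤ ε / 2 * (1 + r) ^ 2 := by
      refine (norm_gaussianExponent_le _ _ _).trans ?_
      gcongr
      exact hs.le
    have hdiff : gaussian L (Z s) (b s) x - gaussian L Z₀ b₀ x = gaussian L Z₀ b₀ x * (Complex.exp w - 1) := by
      rw [gaussian_apply L hps, gaussian_apply L hpos₀, mul_sub, ← Complex.exp_add, hw, ← gaussianExponent_sub]
      simp
    have hub : ‖gaussian L (Z s) (b s) x - gaussian L Z₀ b₀ x‖ ≤ ε / 2 * Real.exp (ε / 2) * ((1 + r) ^ 2 * e) := by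
      rw [hdiff, norm_mul]
      calc _ ≤ Real.exp (-ε * r ^ 2 + β * r) * (ε / 2 * (1 + r) ^ 2 * Real.exp (ε / 2 * (1 + r) ^ 2)) := by
            gcongr
            refine (norm_cexp_sub_one_le w).trans ?_
            gcongr
        _ = ε / 2 * ((1 + r) ^ 2 * (Real.exp (-ε * r ^ 2 + β * r) * Real.exp (ε / 2 * (1 + r) ^ 2))) := by ring
        _ = _ := by
            have : Real.exp (-ε * r ^ 2 + β * r) * Real.exp (ε / 2 * (1 + r) ^ 2) = Real.exp (ε / 2) * e := by
              rw [he, ← Real.exp_add, ← Real.exp_add]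
              congr 1
              ring
            rw [this]; ring
    have hD1 : ‖gaussian L (Z s) (b s) x - gaussian L Z₀ b₀ x‖ * (1 + r) ^ k ≤ D := by
      calc _ ≤ ε / 2 * Real.exp (ε / 2) * ((1 + r) ^ 2 * e) * (1 + r) ^ k := by gcongr
        _ = ε / 2 * Real.exp (ε / 2) * ((1 + r) ^ (k + 2) * e) := by rw [pow_add]; ring
        _ ≤ D := by rw [hD]; gcongr
    have h1k : (1 + ‖x‖) ^ k ≤ A ^ k * (1 + r) ^ k := by
      rw [← mul_pow]
      gcongr
      exact hA x
    have h1k' : 1 ≤ (1 + r) ^ k := one_le_pow₀ (by linarith)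
    rw [Real.rpow_neg (by positivity), Real.rpow_natCast, ← div_eq_mul_inv, le_div_iff₀ (by positivity)]
    set d := ‖gaussian L (Z s) (b s) x - gaussian L Z₀ b₀ x‖
    calc d ^ 2 * (1 + ‖x‖) ^ k ≤ d ^ 2 * (A ^ k * (1 + r) ^ k) := by gcongr
      _ ≤ d ^ 2 * (A ^ k * ((1 + r) ^ k * (1 + r) ^ k)) := by
          gcongr
          nlinarith
      _ = (d * (1 + r) ^ k) ^ 2 * A ^ k := by ring
      _ ≤ D ^ 2 * A ^ k := by gcongr
  · intro x
    have hexp : Filter.Tendsto (fun s => gaussianExponent (Z s) (b s) (L x)) l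
        (𝓝 (gaussianExponent Z₀ b₀ (L x))) := by
      unfold gaussianExponent
      exact ((tendsto_finsetSum _ fun i _ => tendsto_finsetSum _ fun j _ =>
        ((hZ' i j).mul_const _).mul_const _).const_mul _).add
        (tendsto_finsetSum _ fun i _ => (hb' i).mul_const _)
    rw [gaussian_apply L hpos₀]
    refine ((Complex.continuous_exp.tendsto _).comp hexp).congr' ?_
    filter_upwards [hpos] with s hs
    rw [gaussian_apply L hs]
    rfl

/-- A differentiable path of Gaussian wave functions is differentiable in `L²`. -/
theorem hasDerivWithinAt_gaussian_toLp (L : V ≃L[ℝ] (ι → ℝ)) {Z : ℝ → Matrix ι ι ℂ}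
    {b : ℝ → ι → ℂ} {Z' : Matrix ι ι ℂ} {b' : ι → ℂ} {t : ℝ}
    (hpos : ∀ s, t ≤ s → ((Z s).map Complex.re).PosDef)
    (hZ : ∀ i j, HasDerivWithinAt (fun s => Z s i j) (Z' i j) (Set.Ici t) t)
    (hb : ∀ i, HasDerivWithinAt (fun s => b s i) (b' i) (Set.Ici t) t) (v : 𝓢(V, ℂ))
    (hv : ∀ x, v x = gaussianExponent Z' b' (L x) * gaussian L (Z t) (b t) x) :
    HasDerivWithinAt (fun s => (gaussian L (Z s) (b s)).toLp 2 μ) (v.toLp 2 μ) (Set.Ici t) t := by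
  refine HasDerivWithinAt.Ici_of_Ioi ?_
  rw [hasDerivWithinAt_iff_tendsto_slope' (by simp)]
  set φ := fun s => gaussian L (Z s) (b s) with hφ
  have hφx : ∀ s, t ≤ s → ∀ x, φ s x = Complex.exp (gaussianExponent (Z s) (b s) (L x)) :=
    fun s hs x => gaussian_apply L (hpos s hs) (b s) x
  set u : ℝ → 𝓢(V, ℂ) := fun s => (((s - t)⁻¹ : ℝ) : ℂ) • (φ s - φ t) with hu
  have hslope : slope (fun s => (φ s).toLp 2 μ) t = fun s => (u s).toLp 2 μ := by
    funext s
    rw [slope_def_module]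
    have h1 := (SchwartzMap.toLpCLM ℂ ℂ 2 μ).map_smul (((s - t)⁻¹ : ℝ) : ℂ) (φ s - φ t)
    have h2 := (SchwartzMap.toLpCLM ℂ ℂ 2 μ).map_sub (φ s) (φ t)
    simp only [SchwartzMap.toLpCLM_apply] at h1 h2
    rw [hu]
    change _ = ((((s - t)⁻¹ : ℝ) : ℂ) • (φ s - φ t)).toLp 2 μ
    rw [h1, h2]
    exact RCLike.real_smul_eq_coe_smul (K := ℂ) _ _
  rw [hslope]
  obtain ⟨ε, β, hε, hbd⟩ := exists_norm_gaussian_le (hpos t le_rfl) (b t)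
  obtain ⟨K, hK0, hK⟩ := exists_eventually_norm_sub_le hZ hb
  obtain ⟨k, hk⟩ := hμ.exists_integrable
  obtain ⟨A, hA1, hA⟩ := exists_norm_le_equiv L
  set S := ∑ i, ∑ j, ‖Z' i j‖ + ∑ i, ‖b' i‖ with hS
  have hS0 : 0 ≤ S := by positivity
  obtain ⟨C, hC⟩ := pow_mul_exp_le (k + 2) (half_pos hε) (β + ε)
  -- The part with `K` bounds the difference quotient, where the factor `s - t` of the Lipschitz
  -- estimate cancels the denominator; the part with `S` bounds the candidate derivative `v`.
  set D := (K * Real.exp (ε / 2) + S) * C with hD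
  refine tendsto_toLp u v (fun x => D ^ 2 * A ^ k * (1 + ‖x‖) ^ (-(k : ℝ))) (hk.const_mul _) ?_ ?_
  · have hsmall : ∀ᶠ s in 𝓝[>] t, K * (s - t) < ε / 2 := by
      have : Filter.Tendsto (fun s => K * (s - t)) (𝓝[>] t) (𝓝 (K * (t - t))) :=
        ((by fun_prop : Continuous fun s => K * (s - t)).tendsto t).mono_left nhdsWithin_le_nhds
      rw [sub_self, mul_zero] at this
      exact this.eventually_lt_const (half_pos hε)
    filter_upwards [hK, hsmall, self_mem_nhdsWithin] with s hs hsm hst x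
    have hst' : 0 < s - t := sub_pos.2 hst
    set r := ‖L x‖ with hr
    have hr0 : 0 ≤ r := norm_nonneg _
    set e := Real.exp (-(ε / 2) * r ^ 2 + (β + ε) * r) with he
    have hmain := hC r hr0
    have hpt : ‖φ t x‖ ≤ Real.exp (-ε * r ^ 2 + β * r) := by
      rw [hφx t le_rfl]; exact hbd _
    set w := gaussianExponent (Z s - Z t) (b s - b t) (L x) with hw
    have hw1 : ‖w‖ ≤ K * (s - t) * (1 + r) ^ 2 := by
      refine (norm_gaussianExponent_le _ _ _).trans ?_
      gcongr
      exact hs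
    have hw2 : ‖w‖ ≤ ε / 2 * (1 + r) ^ 2 := hw1.trans (by gcongr)
    have hdiff : φ s x - φ t x = φ t x * (Complex.exp w - 1) := by
      rw [hφx s hst.le, hφx t le_rfl, mul_sub, ← Complex.exp_add, hw, ← gaussianExponent_sub]
      simp
    have hub : ‖u s x‖ ≤ K * Real.exp (ε / 2) * ((1 + r) ^ 2 * e) := by
      have : u s x = (((s - t)⁻¹ : ℝ) : ℂ) * (φ t x * (Complex.exp w - 1)) := by
        rw [← hdiff]; rfl
      rw [this, norm_mul, norm_mul, Complex.norm_real, Real.norm_eq_abs, abs_inv, abs_of_pos hst',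
        inv_mul_le_iff₀ hst']
      calc ‖φ t x‖ * ‖Complex.exp w - 1‖
          ≤ Real.exp (-ε * r ^ 2 + β * r) * (K * (s - t) * (1 + r) ^ 2 * Real.exp (ε / 2 * (1 + r) ^ 2)) := by
            gcongr
            refine (norm_cexp_sub_one_le w).trans ?_
            gcongr
        _ = (s - t) * (K * ((1 + r) ^ 2 * (Real.exp (-ε * r ^ 2 + β * r) * Real.exp (ε / 2 * (1 + r) ^ 2)))) := by ring
        _ = _ := by
            have : Real.exp (-ε * r ^ 2 + β * r) * Real.exp (ε / 2 * (1 + r) ^ 2) = Real.exp (ε / 2) * e := by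
              rw [he, ← Real.exp_add, ← Real.exp_add]
              congr 1
              ring
            rw [this]; ring
    have hvb : ‖v x‖ ≤ S * ((1 + r) ^ 2 * e) := by
      rw [hv, norm_mul, ← mul_assoc]
      refine mul_le_mul (norm_gaussianExponent_le _ _ _) (hpt.trans ?_) (norm_nonneg _) (by positivity)
      refine Real.exp_le_exp.2 ?_
      nlinarith
    have hsum : ‖u s x - v x‖ ≤ (K * Real.exp (ε / 2) + S) * ((1 + r) ^ 2 * e) := by
      refine (norm_sub_le _ _).trans ?_
      linarith
    have h1r : 0 < (1 + r) ^ k := by positivity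
    have hD1 : ‖u s x - v x‖ * (1 + r) ^ k ≤ D := by
      calc ‖u s x - v x‖ * (1 + r) ^ k ≤ (K * Real.exp (ε / 2) + S) * ((1 + r) ^ 2 * e) * (1 + r) ^ k := by gcongr
        _ = (K * Real.exp (ε / 2) + S) * ((1 + r) ^ (k + 2) * e) := by rw [pow_add]; ring
        _ ≤ D := by rw [hD]; gcongr
    have h1k : (1 + ‖x‖) ^ k ≤ A ^ k * (1 + r) ^ k := by
      rw [← mul_pow]
      gcongr
      exact hA x
    have h1k' : 1 ≤ (1 + r) ^ k := one_le_pow₀ (by linarith)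
    rw [Real.rpow_neg (by positivity), Real.rpow_natCast, ← div_eq_mul_inv, le_div_iff₀ (by positivity)]
    calc ‖u s x - v x‖ ^ 2 * (1 + ‖x‖) ^ k ≤ ‖u s x - v x‖ ^ 2 * (A ^ k * (1 + r) ^ k) := by gcongr
      _ ≤ ‖u s x - v x‖ ^ 2 * (A ^ k * ((1 + r) ^ k * (1 + r) ^ k)) := by
          gcongr
          nlinarith
      _ = (‖u s x - v x‖ * (1 + r) ^ k) ^ 2 * A ^ k := by ring
      _ ≤ D ^ 2 * A ^ k := by gcongr
  · intro x
    have hexp : HasDerivWithinAt (fun s => gaussianExponent (Z s) (b s) (L x))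
        (gaussianExponent Z' b' (L x)) (Set.Ici t) t := by
      unfold gaussianExponent
      exact ((HasDerivWithinAt.fun_sum fun i _ => HasDerivWithinAt.fun_sum fun j _ =>
        ((hZ i j).mul_const _).mul_const _).const_mul _).add
        (HasDerivWithinAt.fun_sum fun i _ => (hb i).mul_const _)
    have h1 := (hasDerivWithinAt_iff_tendsto_slope' (by simp)).1 hexp.cexp.Ioi_of_Ici
    have h2 : v x = Complex.exp (gaussianExponent (Z t) (b t) (L x)) * gaussianExponent Z' b' (L x) := by
      rw [hv, ← hφx t le_rfl, mul_comm]
    rw [h2]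
    refine h1.congr' ?_
    filter_upwards [self_mem_nhdsWithin] with s hst
    have hst' : t < s := hst
    rw [slope_def_module, ← hφx s hst'.le, ← hφx t le_rfl]
    change _ = (((s - t)⁻¹ : ℝ) : ℂ) • (φ s x - φ t x)
    rw [Complex.coe_smul]

end GaussianPath

/-! ### One-sided entrywise derivatives of matrices. -/

section MatrixCalculus
variable {l m n : Type*} [Fintype l] [Fintype m] [Fintype n] {𝕜 : Type*} [RCLike 𝕜]
  {s : Set ℝ} {t : ℝ}

/-- Entrywise derivative of a path of matrices. -/
def HasEntrywiseDeriv (A : ℝ → Matrix m n 𝕜) (A' : Matrix m n 𝕜) (s : Set ℝ) (t : ℝ) : Prop :=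
  ∀ i j, HasDerivWithinAt (fun u => A u i j) (A' i j) s t

theorem HasEntrywiseDeriv.mul {A : ℝ → Matrix l m 𝕜} {A' : Matrix l m 𝕜}
    {B : ℝ → Matrix m n 𝕜} {B' : Matrix m n 𝕜} (hA : HasEntrywiseDeriv A A' s t)
    (hB : HasEntrywiseDeriv B B' s t) :
    HasEntrywiseDeriv (fun u => A u * B u) (A' * B t + A t * B') s t := by
  intro i j
  simp only [Matrix.mul_apply, Matrix.add_apply]
  rw [← Finset.sum_add_distrib]
  exact HasDerivWithinAt.fun_sum fun k _ => (hA i k).mul (hB k j)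

theorem hasEntrywiseDeriv_const (A : Matrix m n 𝕜) : HasEntrywiseDeriv (fun _ => A) 0 s t :=
  fun _ _ => hasDerivWithinAt_const _ _ _

theorem HasEntrywiseDeriv.mul_const {A : ℝ → Matrix l m 𝕜} {A' : Matrix l m 𝕜}
    (hA : HasEntrywiseDeriv A A' s t) (B : Matrix m n 𝕜) :
    HasEntrywiseDeriv (fun u => A u * B) (A' * B) s t := by
  simpa using hA.mul (hasEntrywiseDeriv_const B)

theorem HasEntrywiseDeriv.const_mul {A : ℝ → Matrix m n 𝕜} {A' : Matrix m n 𝕜}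
    (hA : HasEntrywiseDeriv A A' s t) (B : Matrix l m 𝕜) :
    HasEntrywiseDeriv (fun u => B * A u) (B * A') s t := by
  simpa using (hasEntrywiseDeriv_const B).mul hA

theorem HasEntrywiseDeriv.transpose {A : ℝ → Matrix m n 𝕜} {A' : Matrix m n 𝕜}
    (hA : HasEntrywiseDeriv A A' s t) : HasEntrywiseDeriv (fun u => (A u)ᵀ) A'ᵀ s t :=
  fun i j => hA j i

theorem HasEntrywiseDeriv.map_ofReal {A : ℝ → Matrix m n ℝ} {A' : Matrix m n ℝ}
    (hA : HasEntrywiseDeriv A A' s t) :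
    HasEntrywiseDeriv (fun u => (A u).map Complex.ofReal) (A'.map Complex.ofReal) s t :=
  fun i j => (hA i j).ofReal_comp

/-- Divide `(A u)⁻¹ - (A t)⁻¹ = -(A u)⁻¹ (A u - A t) (A t)⁻¹` by `u - t`. Only continuity of the
inverse from the right remains to be known, and the adjugate formula supplies it. -/
theorem HasEntrywiseDeriv.inv [DecidableEq m] {A : ℝ → Matrix m m ℂ} {A' : Matrix m m ℂ}
    (hA : HasEntrywiseDeriv A A' (Set.Ici t) t) (hdet : ∀ u, t ≤ u → IsUnit (A u).det) :
    HasEntrywiseDeriv (fun u => (A u)⁻¹) (-((A t)⁻¹ * A' * (A t)⁻¹)) (Set.Ici t) t := by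
  have hcont : ∀ i j, Filter.Tendsto (fun u => (A u)⁻¹ i j) (𝓝[>] t) (𝓝 ((A t)⁻¹ i j)) := by
    have h1 : Filter.Tendsto A (𝓝[>] t) (𝓝 (A t)) := by
      refine tendsto_pi_nhds.2 fun i => tendsto_pi_nhds.2 fun j => ?_
      exact ((hA i j).continuousWithinAt.mono Set.Ioi_subset_Ici_self)
    have h2 : Filter.Tendsto (fun u => (A u).det) (𝓝[>] t) (𝓝 (A t).det) :=
      ((continuous_id.matrix_det).tendsto (A t)).comp h1
    have h3 : Filter.Tendsto (fun u => (A u).adjugate) (𝓝[>] t) (𝓝 (A t).adjugate) :=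
      ((continuous_id.matrix_adjugate).tendsto (A t)).comp h1
    intro i j
    simp only [Matrix.inv_def, Ring.inverse_eq_inv', Matrix.smul_apply, smul_eq_mul]
    exact (h2.inv₀ (hdet t le_rfl).ne_zero).mul
      ((tendsto_pi_nhds.1 ((tendsto_pi_nhds.1 h3) i)) j)
  intro i j
  refine HasDerivWithinAt.Ici_of_Ioi ?_
  rw [hasDerivWithinAt_iff_tendsto_slope' (by simp)]
  have hsl : ∀ k l, Filter.Tendsto (slope (fun u => A u k l) t) (𝓝[>] t) (𝓝 (A' k l)) := fun k l =>
    (hasDerivWithinAt_iff_tendsto_slope' (by simp)).1 (hA k l).Ioi_of_Ici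
  have hlim : Filter.Tendsto (fun u => -∑ k, (∑ l, (A u)⁻¹ i l * slope (fun u => A u l k) t u) * (A t)⁻¹ k j)
      (𝓝[>] t) (𝓝 (-∑ k, (∑ l, (A t)⁻¹ i l * A' l k) * (A t)⁻¹ k j)) :=
    (tendsto_finsetSum _ fun k _ => (tendsto_finsetSum _ fun l _ =>
      (hcont i l).mul (hsl l k)).mul_const _).neg
  have hval : (-((A t)⁻¹ * A' * (A t)⁻¹)) i j = -∑ k, (∑ l, (A t)⁻¹ i l * A' l k) * (A t)⁻¹ k j := by
    simp [Matrix.mul_apply]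
  rw [hval]
  refine hlim.congr' ?_
  filter_upwards [self_mem_nhdsWithin] with u hu
  have hu' : t ≤ u := le_of_lt hu
  have h4 : (A u)⁻¹ - (A t)⁻¹ = -((A u)⁻¹ * (A u - A t) * (A t)⁻¹) := by
    rw [Matrix.mul_sub, Matrix.nonsing_inv_mul _ (hdet u hu'), Matrix.sub_mul, Matrix.one_mul,
      Matrix.mul_assoc, Matrix.mul_nonsing_inv _ (hdet t le_rfl), Matrix.mul_one]
    abel
  have h5 := congrFun (congrFun h4 i) j
  simp only [Matrix.sub_apply, Matrix.neg_apply, Matrix.mul_apply] at h5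
  simp only [slope_def_module]
  rw [h5, smul_neg, Finset.smul_sum]
  congr 1
  refine Finset.sum_congr rfl fun k _ => ?_
  rw [← smul_mul_assoc, Finset.smul_sum]
  congr 1
  refine Finset.sum_congr rfl fun l _ => ?_
  rw [mul_smul_comm]

theorem eq_of_hasEntrywiseDeriv_zero {A : ℝ → Matrix m n 𝕜}
    (hc : ∀ i j, ContinuousOn (fun u => A u i j) (Set.Ici 0))
    (h : ∀ t, 0 ≤ t → HasEntrywiseDeriv A 0 (Set.Ici t) t) {t : ℝ} (ht : 0 ≤ t) : A t = A 0 := by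
  ext i j
  exact constant_of_has_deriv_right_zero ((hc i j).mono Set.Icc_subset_Ici_self)
    (fun u hu => h u hu.1 i j) t ⟨ht, le_rfl⟩

theorem map_ofReal_mul (A : Matrix l m ℝ) (B : Matrix m n ℝ) :
    (A * B).map Complex.ofReal = A.map Complex.ofReal * B.map Complex.ofReal :=
  Matrix.map_mul (f := Complex.ofRealHom)

end MatrixCalculus

/-! ### Positive Lagrangian frames and the symplectic action on Gaussian matrices. -/

section Frames
open scoped ComplexOrder MatrixOrder
variable {m : Type} [Fintype m] [DecidableEq m]

theorem posDef_map_ofReal {X : Matrix m m ℝ} (hX : X.PosDef) : (X.map Complex.ofReal).PosDef := by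
  obtain ⟨B, hB, hd⟩ := exists_transpose_mul_self hX
  have h1 : X.map Complex.ofReal = (B.map Complex.ofReal)ᴴ * B.map Complex.ofReal := by
    rw [hB, map_ofReal_mul]
    congr 1
    ext i j
    simp
  rw [h1]
  refine Matrix.PosDef.conjTranspose_mul_self _ ?_
  have hu : IsUnit (B.map Complex.ofReal) := by
    rw [Matrix.isUnit_iff_isUnit_det]
    have : (B.map Complex.ofReal).det = ((B.det : ℝ) : ℂ) := (Complex.ofRealHom.map_det B).symm
    rw [this]
    exact isUnit_iff_ne_zero.2 (by exact_mod_cast hd)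
  exact Matrix.mulVec_injective_iff_isUnit.2 hu

theorem posDef_of_map_ofReal {X : Matrix m m ℝ} (hX : (X.map Complex.ofReal).PosDef) : X.PosDef := by
  refine Matrix.PosDef.of_dotProduct_mulVec_pos ?_ fun {x} hx => ?_
  · ext i j
    have := congrFun (congrFun hX.isHermitian i) j
    simpa using this
  · have h := hX.dotProduct_mulVec_pos (x := fun i => (x i : ℂ)) (fun h => hx (by
      funext i; simpa using congrFun h i))
    have h2 : star (fun i => (x i : ℂ)) ⬝ᵥ (X.map Complex.ofReal *ᵥ fun i => (x i : ℂ)) =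
        ((star x ⬝ᵥ X *ᵥ x : ℝ) : ℂ) := by
      simp [dotProduct, Matrix.mulVec]
    rw [h2] at h
    exact_mod_cast h

/-- The frame `(1; iZ)` of the annihilator of the Gaussian with matrix `Z`. -/
def frame (Z : Matrix m m ℂ) : Matrix (m ⊕ m) m ℂ := Matrix.fromRows 1 (Complex.I • Z)

/-- The symplectic matrix with complex entries. -/
abbrev OmegaC (m : Type) [DecidableEq m] : Matrix (m ⊕ m) (m ⊕ m) ℂ :=
  (Omega m).map Complex.ofReal

theorem omegaC_eq : OmegaC m = Matrix.fromBlocks 0 1 (-1) 0 := by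
  ext (i | i) (j | j) <;> simp [OmegaC, Omega, Matrix.one_apply, apply_ite]

theorem omegaC_mul_fromRows (Q P : Matrix m m ℂ) :
    OmegaC m * Matrix.fromRows Q P = Matrix.fromRows P (-Q) := by
  rw [omegaC_eq, Matrix.fromBlocks_mul_fromRows]
  simp

theorem fromRows_transpose_mul_omega (Q P : Matrix m m ℂ) :
    (Matrix.fromRows Q P)ᵀ * OmegaC m * Matrix.fromRows Q P = Qᵀ * P - Pᵀ * Q := by
  rw [Matrix.mul_assoc, omegaC_mul_fromRows, Matrix.transpose_fromRows, Matrix.fromCols_mul_fromRows]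
  simp [sub_eq_add_neg]

theorem fromRows_conjTranspose_mul_omega (Q P : Matrix m m ℂ) :
    (Matrix.fromRows Q P)ᴴ * OmegaC m * Matrix.fromRows Q P = Qᴴ * P - Pᴴ * Q := by
  rw [Matrix.mul_assoc, omegaC_mul_fromRows, Matrix.conjTranspose_fromRows_eq_fromCols_conjTranspose,
    Matrix.fromCols_mul_fromRows]
  simp [sub_eq_add_neg]

/-- The real part of `Z`, with complex entries. -/
abbrev reC (Z : Matrix m m ℂ) : Matrix m m ℂ := (Z.map Complex.re).map Complex.ofReal

theorem add_conjTranspose {Z : Matrix m m ℂ} (hZ : Zᵀ = Z) : Z + Zᴴ = (2 : ℂ) • reC Z := by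
  ext i j
  have : Z j i = Z i j := by rw [← Matrix.transpose_apply Z, hZ]
  simp [this, Complex.ext_iff]
  ring

/-- Symmetry of `Z` says that the frame spans a Lagrangian subspace; positivity of `Re Z` says that
the Hermitian form built from `Ω` is positive on it, up to the factor `2i` of the next lemma. Real
symplectic matrices preserve both forms, which is why transport keeps `Z` symmetric with positive
definite real part. -/
theorem frame_transpose_mul_omega {Z : Matrix m m ℂ} (hZ : Zᵀ = Z) :
    (frame Z)ᵀ * OmegaC m * frame Z = 0 := by
  rw [frame, fromRows_transpose_mul_omega]
  simp [hZ]

theorem frame_conjTranspose_mul_omega {Z : Matrix m m ℂ} (hZ : Zᵀ = Z) :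
    (frame Z)ᴴ * OmegaC m * frame Z = (2 * Complex.I) • reC Z := by
  rw [frame, fromRows_conjTranspose_mul_omega, mul_comm, mul_smul, ← add_conjTranspose hZ]
  simp [Matrix.conjTranspose_smul]

/-- The covariance matrix (twice the usual one) of the Gaussian with matrix `Z`. -/
def covariance (Z : Matrix m m ℂ) : Matrix (m ⊕ m) (m ⊕ m) ℝ :=
  (frame Z * (reC Z)⁻¹ * (frame Z)ᴴ).map Complex.re

/-- The data of a Gaussian transported by a symplectic matrix. -/
def transportTop (M : Matrix (m ⊕ m) (m ⊕ m) ℝ) (Z : Matrix m m ℂ) : Matrix m m ℂ :=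
  (M.map Complex.ofReal * frame Z).toRows₁

/-- The lower block of the transported frame. -/
def transportBot (M : Matrix (m ⊕ m) (m ⊕ m) ℝ) (Z : Matrix m m ℂ) : Matrix m m ℂ :=
  (M.map Complex.ofReal * frame Z).toRows₂

/-- The matrix of the Gaussian transported by a symplectic matrix. -/
def transport (M : Matrix (m ⊕ m) (m ⊕ m) ℝ) (Z : Matrix m m ℂ) : Matrix m m ℂ :=
  (-Complex.I) • (transportBot M Z * (transportTop M Z)⁻¹)

theorem fromRows_transport (M : Matrix (m ⊕ m) (m ⊕ m) ℝ) (Z : Matrix m m ℂ) :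
    Matrix.fromRows (transportTop M Z) (transportBot M Z) = M.map Complex.ofReal * frame Z :=
  Matrix.fromRows_toRows _

section Symplectic
variable {M : Matrix (m ⊕ m) (m ⊕ m) ℝ} (hM : Mᵀ * Omega m * M = Omega m) {Z : Matrix m m ℂ}
  (hZ : Zᵀ = Z) (hpos : (Z.map Complex.re).PosDef)
include hM hZ

theorem transport_transpose_mul :
    (transportTop M Z)ᵀ * transportBot M Z = (transportBot M Z)ᵀ * transportTop M Z := by
  rw [← sub_eq_zero, ← fromRows_transpose_mul_omega, fromRows_transport, Matrix.transpose_mul]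
  have h : (M.map Complex.ofReal)ᵀ * OmegaC m * M.map Complex.ofReal = OmegaC m := by
    rw [← Matrix.transpose_map, ← map_ofReal_mul, ← map_ofReal_mul, hM]
  calc _ = (frame Z)ᵀ * ((M.map Complex.ofReal)ᵀ * OmegaC m * M.map Complex.ofReal) * frame Z := by
        simp only [Matrix.mul_assoc]
    _ = 0 := by rw [h, frame_transpose_mul_omega hZ]

theorem transport_conjTranspose_mul :
    (transportTop M Z)ᴴ * transportBot M Z - (transportBot M Z)ᴴ * transportTop M Z =
      (2 * Complex.I) • reC Z := by
  rw [← fromRows_conjTranspose_mul_omega, fromRows_transport, Matrix.conjTranspose_mul,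
    ← frame_conjTranspose_mul_omega hZ]
  have h : (M.map Complex.ofReal)ᴴ * OmegaC m * M.map Complex.ofReal = OmegaC m := by
    have : (M.map Complex.ofReal)ᴴ = Mᵀ.map Complex.ofReal := by ext i j; simp
    rw [this, ← map_ofReal_mul, ← map_ofReal_mul, hM]
  calc _ = (frame Z)ᴴ * ((M.map Complex.ofReal)ᴴ * OmegaC m * M.map Complex.ofReal) * frame Z := by
        simp only [Matrix.mul_assoc]
    _ = _ := by rw [h]

include hpos

/-- A vector in the kernel of the upper block would be isotropic for the Hermitian form `Qᴴ P - Pᴴ Q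
= 2i Re Z`, against positivity of `Re Z`. -/
theorem isUnit_det_transportTop : IsUnit (transportTop M Z).det := by
  rw [isUnit_iff_ne_zero]
  intro h0
  obtain ⟨v, hv0, hv⟩ := Matrix.exists_mulVec_eq_zero_iff.2 h0
  have h1 := (posDef_map_ofReal hpos).dotProduct_mulVec_pos hv0
  have h2 := congrArg (fun A => star v ⬝ᵥ A *ᵥ v) (transport_conjTranspose_mul hM hZ)
  simp only [Matrix.sub_mulVec, ← Matrix.mulVec_mulVec, hv, Matrix.mulVec_zero,
    Matrix.smul_mulVec, sub_zero, dotProduct_smul] at h2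
  rw [Matrix.dotProduct_mulVec, ← Matrix.star_mulVec, hv, star_zero, zero_dotProduct] at h2
  have h3 : star v ⬝ᵥ reC Z *ᵥ v = 0 := by
    rcases smul_eq_zero.1 h2.symm with h | h
    · simp at h
    · exact h
  rw [h3] at h1
  exact lt_irrefl _ h1

/-- The transported frame spans the same subspace as the frame of the transported matrix; right
multiplication by `Q⁻¹` normalizes its upper block to `1`. The properties of `transport` below
follow from this identity and the invariance of the forms. -/
theorem frame_transport :
    frame (transport M Z) = M.map Complex.ofReal * frame Z * (transportTop M Z)⁻¹ := by
  rw [← fromRows_transport, Matrix.fromRows_mul,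
    Matrix.mul_nonsing_inv _ (isUnit_det_transportTop hM hZ hpos), frame, transport, smul_smul]
  simp

theorem transport_transpose : (transport M Z)ᵀ = transport M Z := by
  have hu := isUnit_det_transportTop hM hZ hpos
  have huT : IsUnit (transportTop M Z)ᵀ.det := by rwa [Matrix.det_transpose]
  rw [transport, Matrix.transpose_smul, Matrix.transpose_mul, Matrix.transpose_nonsing_inv]
  congr 1
  have h := transport_transpose_mul hM hZ
  calc (transportTop M Z)ᵀ⁻¹ * (transportBot M Z)ᵀ
      = (transportTop M Z)ᵀ⁻¹ * ((transportBot M Z)ᵀ * transportTop M Z) * (transportTop M Z)⁻¹ := by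
        rw [Matrix.mul_assoc, Matrix.mul_assoc, Matrix.mul_nonsing_inv _ hu, Matrix.mul_one]
    _ = _ := by
        rw [← h, ← Matrix.mul_assoc, Matrix.nonsing_inv_mul _ huT, Matrix.one_mul]

theorem reC_transport :
    reC (transport M Z) = ((transportTop M Z)⁻¹)ᴴ * reC Z * (transportTop M Z)⁻¹ := by
  have h1 := frame_conjTranspose_mul_omega (transport_transpose hM hZ hpos)
  have h2 := frame_conjTranspose_mul_omega hZ
  have h : (M.map Complex.ofReal)ᴴ * OmegaC m * M.map Complex.ofReal = OmegaC m := by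
    have : (M.map Complex.ofReal)ᴴ = Mᵀ.map Complex.ofReal := by ext i j; simp
    rw [this, ← map_ofReal_mul, ← map_ofReal_mul, hM]
  rw [frame_transport hM hZ hpos] at h1
  have h3 : (M.map Complex.ofReal * frame Z * (transportTop M Z)⁻¹)ᴴ * OmegaC m *
      (M.map Complex.ofReal * frame Z * (transportTop M Z)⁻¹) =
      ((transportTop M Z)⁻¹)ᴴ * ((frame Z)ᴴ * ((M.map Complex.ofReal)ᴴ * OmegaC m *
        M.map Complex.ofReal) * frame Z) * (transportTop M Z)⁻¹ := by
    simp only [Matrix.conjTranspose_mul, Matrix.mul_assoc]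
  rw [h3, h, h2, Matrix.mul_smul, Matrix.smul_mul] at h1
  exact (smul_right_injective _ (by simp : (2 * Complex.I) ≠ 0) h1).symm

theorem posDef_re_transport : ((transport M Z).map Complex.re).PosDef := by
  refine posDef_of_map_ofReal ?_
  change (reC (transport M Z)).PosDef
  have hu := isUnit_det_transportTop hM hZ hpos
  rw [reC_transport hM hZ hpos]
  refine (posDef_map_ofReal hpos).conjTranspose_mul_mul_same ?_
  exact Matrix.mulVec_injective_iff_isUnit.2 ((Matrix.isUnit_nonsing_inv_iff).2
    ((Matrix.isUnit_iff_isUnit_det _).2 hu))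

/-- The new frame is `M F Q⁻¹` and the new real part is `Q⁻ᴴ (Re Z) Q⁻¹`, so every factor `Q`
cancels in `F (Re Z)⁻¹ Fᴴ`. As `M` is real, it commutes with taking real parts. -/
theorem covariance_transport : covariance (transport M Z) = M * covariance Z * Mᵀ := by
  have hu := isUnit_det_transportTop hM hZ hpos
  have huH : IsUnit (transportTop M Z)ᴴ.det := by
    rw [Matrix.det_conjTranspose]; exact hu.star
  set Q := transportTop M Z with hQ
  have hX : IsUnit (reC Z).det := (posDef_map_ofReal hpos).det_pos.ne'.isUnit
  have h1 : (reC (transport M Z))⁻¹ = Q * (reC Z)⁻¹ * Qᴴ := by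
    rw [reC_transport hM hZ hpos, Matrix.mul_inv_rev, Matrix.mul_inv_rev,
      Matrix.conjTranspose_nonsing_inv, Matrix.nonsing_inv_nonsing_inv _ hu,
      Matrix.nonsing_inv_nonsing_inv _ huH, Matrix.mul_assoc]
  have h2 : frame (transport M Z) * (reC (transport M Z))⁻¹ * (frame (transport M Z))ᴴ =
      M.map Complex.ofReal * (frame Z * (reC Z)⁻¹ * (frame Z)ᴴ) * (Mᵀ).map Complex.ofReal := by
    have hMH : (M.map Complex.ofReal)ᴴ = Mᵀ.map Complex.ofReal := by ext i j; simp
    rw [h1, frame_transport hM hZ hpos, ← hMH]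
    simp only [Matrix.conjTranspose_mul]
    calc _ = M.map Complex.ofReal * frame Z * ((Q⁻¹ * Q) * (reC Z)⁻¹ * (Q⁻¹ * Q)ᴴ) * (frame Z)ᴴ *
          (M.map Complex.ofReal)ᴴ := by simp only [Matrix.conjTranspose_mul, Matrix.mul_assoc]; rfl
      _ = _ := by
        rw [Matrix.nonsing_inv_mul _ hu]
        simp only [Matrix.conjTranspose_one, Matrix.mul_one, Matrix.one_mul, Matrix.mul_assoc]
  rw [covariance, h2, covariance]
  ext i j
  simp [Matrix.mul_apply]

end Symplectic
end Frames

/-! ### Primitives of right-continuous functions. -/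

section RightContinuous

/-- The function is the pointwise limit of `u (d n t)`, where `d n t` is the first point of the grid
of mesh `1 / (n + 1)` strictly to the right of `t`. Each approximation is a function of an integer
part, hence measurable. -/
theorem measurable_of_rightContinuous {u : ℝ → ℂ}
    (hu : ∀ t, ContinuousWithinAt u (Set.Ici t) t) : Measurable u := by
  set d : ℕ → ℝ → ℝ := fun n t => ((⌊(n + 1 : ℝ) * t⌋ : ℝ) + 1) / (n + 1) with hd
  have hgt : ∀ n t, t ≤ d n t := by
    intro n t
    rw [hd, le_div_iff₀ (by positivity)]
    have := (Int.lt_floor_add_one ((n + 1 : ℝ) * t)).le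
    linarith
  have hle : ∀ n t, d n t ≤ t + 1 / ((n : ℝ) + 1) := by
    intro n t
    have e : (t + 1 / ((n : ℝ) + 1)) * (n + 1) = (n + 1) * t + 1 := by field_simp
    rw [hd, div_le_iff₀ (by positivity), e]
    have := Int.floor_le ((n + 1 : ℝ) * t)
    linarith
  have hlim : ∀ t, Filter.Tendsto (fun n => d n t) Filter.atTop (𝓝[≥] t) := by
    intro t
    refine tendsto_nhdsWithin_iff.2 ⟨?_, Filter.Eventually.of_forall fun n => hgt n t⟩
    refine tendsto_of_tendsto_of_tendsto_of_le_of_le tendsto_const_nhds ?_ (fun n => hgt n t) (fun n => hle n t)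
    simpa using (tendsto_one_div_add_atTop_nhds_zero_nat (𝕜 := ℝ)).const_add t
  refine measurable_of_tendsto_metrizable (f := fun n t => u (d n t)) (fun n => ?_)
    (tendsto_pi_nhds.2 fun t => (hu t).tendsto.comp (hlim t))
  have h1 : Measurable fun t : ℝ => ⌊(n + 1 : ℝ) * t⌋ := Int.measurable_floor.comp (measurable_const_mul _)
  exact (measurable_from_top (f := fun k : ℤ => u (((k : ℝ) + 1) / (n + 1)))).comp h1

theorem intervalIntegrable_of_rightContinuous {u : ℝ → ℂ}
    (hu : ∀ t, 0 ≤ t → ContinuousWithinAt u (Set.Ici t) t)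
    (hb : ∀ T : ℝ, ∃ C : ℝ, ∀ t ∈ Set.Icc 0 T, ‖u t‖ ≤ C) {t : ℝ} (ht : 0 ≤ t) :
    IntervalIntegrable u volume 0 t := by
  -- Precomposition with `max x 0` extends `u` from `t ≥ 0` to the line and preserves
  -- right-continuity, since it is continuous and monotone.
  have hmeas : Measurable fun x => u (max x 0) := by
    refine measurable_of_rightContinuous fun x => ?_
    have h1 := hu (max x 0) (le_max_right _ _)
    refine ContinuousWithinAt.comp (f := fun y : ℝ => max y 0) (g := u) h1
      (continuous_id.max continuous_const).continuousWithinAt fun y hy => ?_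
    exact Set.mem_Ici.2 (max_le_max_right 0 (Set.mem_Ici.1 hy))
  obtain ⟨C, hC⟩ := hb t
  have h : IntervalIntegrable (fun x => u (max x 0)) volume 0 t := by
    rw [intervalIntegrable_iff, Set.uIoc_of_le ht]
    refine Measure.integrableOn_of_bounded (M := C) (by simp) hmeas.aestronglyMeasurable ?_
    refine (ae_restrict_mem measurableSet_Ioc).mono fun x hx => ?_
    rw [max_eq_left hx.1.le]
    exact hC x ⟨hx.1.le, hx.2⟩
  refine h.congr fun x hx => ?_
  rw [Set.uIoc_of_le ht] at hx
  simp only [max_eq_left hx.1.le]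

theorem continuousOn_integral_of_rightContinuous {u : ℝ → ℂ}
    (hu : ∀ t, 0 ≤ t → ContinuousWithinAt u (Set.Ici t) t)
    (hb : ∀ T : ℝ, ∃ C : ℝ, ∀ t ∈ Set.Icc 0 T, ‖u t‖ ≤ C) :
    ContinuousOn (fun x => ∫ y in (0 : ℝ)..x, u y) (Set.Ici 0) := by
  intro t ht
  have ht1 : (0 : ℝ) ≤ t + 1 := by have : (0 : ℝ) ≤ t := ht; linarith
  have h1 := intervalIntegral.continuousOn_primitive_interval'
    (intervalIntegrable_of_rightContinuous hu hb ht1) (Set.left_mem_uIcc)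
  rw [Set.uIcc_of_le ht1] at h1
  refine (h1 t ⟨ht, by linarith⟩).mono_of_mem_nhdsWithin ?_
  filter_upwards [self_mem_nhdsWithin, mem_nhdsWithin_of_mem_nhds (Iic_mem_nhds (lt_add_one t))] with x h1 h2
  exact ⟨h1, h2⟩

theorem hasDerivWithinAt_integral_of_rightContinuous {u : ℝ → ℂ}
    (hu : ∀ t, 0 ≤ t → ContinuousWithinAt u (Set.Ici t) t)
    (hb : ∀ T : ℝ, ∃ C : ℝ, ∀ t ∈ Set.Icc 0 T, ‖u t‖ ≤ C) {t : ℝ} (ht : 0 ≤ t) :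
    HasDerivWithinAt (fun x => ∫ y in (0 : ℝ)..x, u y) (u t) (Set.Ici t) t := by
  set w : ℝ → ℂ := fun x => u (max x 0) with hw
  have hmeas : Measurable w := by
    refine measurable_of_rightContinuous fun x => ?_
    have h1 := hu (max x 0) (le_max_right _ _)
    refine ContinuousWithinAt.comp (f := fun y : ℝ => max y 0) (g := u) h1
      (continuous_id.max continuous_const).continuousWithinAt fun y hy => ?_
    exact Set.mem_Ici.2 (max_le_max_right 0 (Set.mem_Ici.1 hy))
  have hwu : ∀ x, 0 ≤ x → w x = u x := fun x hx => by rw [hw]; simp [max_eq_left hx]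
  have hint : IntervalIntegrable w volume 0 t := by
    obtain ⟨C, hC⟩ := hb t
    rw [intervalIntegrable_iff, Set.uIoc_of_le ht]
    refine Measure.integrableOn_of_bounded (M := C) (by simp) hmeas.aestronglyMeasurable ?_
    refine (ae_restrict_mem measurableSet_Ioc).mono fun x hx => ?_
    rw [hwu x hx.1.le]
    exact hC x ⟨hx.1.le, hx.2⟩
  have hcw : ContinuousWithinAt w (Set.Ioi t) t := by
    have h1 := (hu t ht).mono Set.Ioi_subset_Ici_self
    refine h1.congr (fun y hy => hwu y (ht.trans (le_of_lt hy))) (hwu t ht)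
  have hd : HasDerivWithinAt (fun x => ∫ y in (0 : ℝ)..x, w y) (w t) (Set.Ici t) t :=
    intervalIntegral.integral_hasDerivWithinAt_right hint
      (t := Set.Ioi t) ⟨Set.univ, Filter.univ_mem, hmeas.aestronglyMeasurable⟩ hcw
  rw [hwu t ht] at hd
  have heq : ∀ x, 0 ≤ x → ∫ y in (0 : ℝ)..x, u y = ∫ y in (0 : ℝ)..x, w y := fun x hx => by
    refine intervalIntegral.integral_congr fun y hy => ?_
    rw [Set.uIcc_of_le hx] at hy
    exact (hwu y hy.1).symm
  exact hd.congr (fun x hx => heq x (ht.trans hx)) (heq t ht)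

end RightContinuous

/-! ### Evolution equations for the parameters of the Gaussian. -/

section GaussianFlow
open scoped ComplexOrder MatrixOrder
variable {m : Type} [Fintype m] [DecidableEq m]

/-- The linear flow generated by the quadratic form `h`, with right derivatives. -/
structure IsLinearFlow (h M : ℝ → Matrix (m ⊕ m) (m ⊕ m) ℝ) : Prop where
  init : M 0 = 1
  cont : ∀ a b, ContinuousOn (fun t => M t a b) (Set.Ici 0)
  ode : ∀ t, 0 ≤ t → HasEntrywiseDeriv M (Omega m * h t * M t) (Set.Ici t) t

theorem omega_transpose : (Omega m)ᵀ = -Omega m := by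
  rw [Omega, Matrix.fromBlocks_transpose, Matrix.fromBlocks_neg]
  simp

theorem omega_mul_omega : Omega m * Omega m = -1 := by
  rw [Omega, Matrix.fromBlocks_multiply, ← Matrix.fromBlocks_one, Matrix.fromBlocks_neg]
  simp

variable {h M : ℝ → Matrix (m ⊕ m) (m ⊕ m) ℝ}

theorem IsLinearFlow.symplectic (hM : IsLinearFlow h M) (hs : ∀ t, 0 ≤ t → (h t)ᵀ = h t)
    {t : ℝ} (ht : 0 ≤ t) : (M t)ᵀ * Omega m * M t = Omega m := by
  have hc : ∀ i j, ContinuousOn (fun u => ((M u)ᵀ * Omega m * M u) i j) (Set.Ici 0) := by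
    intro i j
    simp only [Matrix.mul_apply, Matrix.transpose_apply]
    refine continuousOn_finsetSum _ fun k _ => ContinuousOn.mul ?_ (hM.cont _ _)
    exact continuousOn_finsetSum _ fun l _ => (hM.cont _ _).mul continuousOn_const
  have hd : ∀ t, 0 ≤ t → HasEntrywiseDeriv (fun u => (M u)ᵀ * Omega m * M u) 0 (Set.Ici t) t := by
    intro t ht
    have h1 := ((hM.ode t ht).transpose.mul_const (Omega m)).mul (hM.ode t ht)
    have h2 : (Omega m * h t * M t)ᵀ * Omega m * M t + (M t)ᵀ * Omega m * (Omega m * h t * M t) = 0 := by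
      rw [Matrix.transpose_mul, Matrix.transpose_mul, omega_transpose, hs t ht]
      calc _ = -((M t)ᵀ * h t * (Omega m * Omega m) * M t) + (M t)ᵀ * (Omega m * Omega m) * h t * M t := by
            simp only [Matrix.mul_neg, Matrix.neg_mul, Matrix.mul_assoc]
        _ = 0 := by rw [omega_mul_omega]; simp
    rw [h2] at h1
    exact h1
  have := eq_of_hasEntrywiseDeriv_zero hc hd ht
  rw [this, hM.init]
  simp

theorem frame_transpose_mul_fromRows {Z : Matrix m m ℂ} (hZ : Zᵀ = Z) {n : Type*}
    (A B : Matrix m n ℂ) : (frame Z)ᵀ * Matrix.fromRows A B = A + (Complex.I • Z) * B := by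
  rw [frame, Matrix.transpose_fromRows, Matrix.fromCols_mul_fromRows]
  simp [hZ]

theorem transport_one (Z : Matrix m m ℂ) : transport 1 Z = Z := by
  have h1 : (1 : Matrix (m ⊕ m) (m ⊕ m) ℝ).map Complex.ofReal = 1 := by
    ext i j; simp [Matrix.one_apply, apply_ite]
  rw [transport, transportTop, transportBot, h1, Matrix.one_mul, frame, Matrix.toRows₁_fromRows,
    Matrix.toRows₂_fromRows, inv_one, Matrix.mul_one, smul_smul]
  simp

theorem continuousOn_matrix_inv {n : Type*} [Fintype n] [DecidableEq n] {A : ℝ → Matrix n n ℂ} {s : Set ℝ}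
    (hA : ContinuousOn A s) (hdet : ∀ u ∈ s, IsUnit (A u).det) : ContinuousOn (fun u => (A u)⁻¹) s := by
  simp only [Matrix.inv_def, Ring.inverse_eq_inv']
  exact ((continuous_id.matrix_det.comp_continuousOn hA).inv₀ fun u hu => (hdet u hu).ne_zero).smul
    (continuous_id.matrix_adjugate.comp_continuousOn hA)

theorem continuousOn_matrix_mul {l n p : Type*} [Fintype n] {A : ℝ → Matrix l n ℂ} {B : ℝ → Matrix n p ℂ}
    {s : Set ℝ} (hA : ContinuousOn A s) (hB : ContinuousOn B s) : ContinuousOn (fun u => A u * B u) s :=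
  continuousOn_pi.2 fun i => continuousOn_pi.2 fun j => by
    simp only [Matrix.mul_apply]
    exact continuousOn_finsetSum _ fun k _ =>
      (continuousOn_pi.1 (continuousOn_pi.1 hA i) k).mul (continuousOn_pi.1 (continuousOn_pi.1 hB k) j)

theorem continuousOn_transportTop_bot (hM : IsLinearFlow h M) (Z : Matrix m m ℂ) :
    ContinuousOn (fun t => transportTop (M t) Z) (Set.Ici 0) ∧
      ContinuousOn (fun t => transportBot (M t) Z) (Set.Ici 0) := by
  have hc : ∀ a k, ContinuousOn (fun t => ((M t).map Complex.ofReal * frame Z) a k) (Set.Ici 0) := by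
    intro a k
    simp only [Matrix.mul_apply, Matrix.map_apply]
    exact continuousOn_finsetSum _ fun j _ =>
      (Complex.continuous_ofReal.comp_continuousOn (hM.cont a j)).mul continuousOn_const
  exact ⟨continuousOn_pi.2 fun i => continuousOn_pi.2 fun j => hc (Sum.inl i) j,
    continuousOn_pi.2 fun i => continuousOn_pi.2 fun j => hc (Sum.inr i) j⟩

section
variable {Z₀ : Matrix m m ℂ} (hM : IsLinearFlow h M) (hs : ∀ t, 0 ≤ t → (h t)ᵀ = h t)
  (hZ : Z₀ᵀ = Z₀) (hpos : (Z₀.map Complex.re).PosDef)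
include hM hs hZ hpos

theorem mul_frame_eq {t : ℝ} (ht : 0 ≤ t) : (M t).map Complex.ofReal * frame Z₀ =
    frame (transport (M t) Z₀) * transportTop (M t) Z₀ := by
  rw [frame_transport (hM.symplectic hs ht) hZ hpos, Matrix.mul_assoc,
    Matrix.nonsing_inv_mul _ (isUnit_det_transportTop (hM.symplectic hs ht) hZ hpos), Matrix.mul_one]

theorem hasEntrywiseDeriv_transportTop_bot {t : ℝ} (ht : 0 ≤ t) :
    HasEntrywiseDeriv (fun u => transportTop (M u) Z₀)
      (((h t).map Complex.ofReal * frame (transport (M t) Z₀)).toRows₂ * transportTop (M t) Z₀)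
      (Set.Ici t) t ∧
    HasEntrywiseDeriv (fun u => transportBot (M u) Z₀)
      (-(((h t).map Complex.ofReal * frame (transport (M t) Z₀)).toRows₁ * transportTop (M t) Z₀))
      (Set.Ici t) t := by
  have h1 := (hM.ode t ht).map_ofReal.mul_const (frame Z₀)
  set F := frame (transport (M t) Z₀)
  set Q := transportTop (M t) Z₀
  have h2 : (Omega m * h t * M t).map Complex.ofReal * frame Z₀ =
      Matrix.fromRows (((h t).map Complex.ofReal * F).toRows₂ * Q)
        (-(((h t).map Complex.ofReal * F).toRows₁ * Q)) := by
    rw [map_ofReal_mul, map_ofReal_mul, Matrix.mul_assoc, mul_frame_eq hM hs hZ hpos ht,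
      Matrix.mul_assoc, ← Matrix.mul_assoc _ F, ← Matrix.fromRows_toRows ((h t).map Complex.ofReal * F),
      Matrix.fromRows_mul]
    rw [omegaC_mul_fromRows]
    simp
    rfl
  rw [h2] at h1
  exact ⟨fun i j => h1 (Sum.inl i) j, fun i j => h1 (Sum.inr i) j⟩

/-- The matrix of the transported Gaussian solves a Riccati equation. -/
theorem continuousOn_transport : ContinuousOn (fun t => transport (M t) Z₀) (Set.Ici 0) := by
  obtain ⟨h1, h2⟩ := continuousOn_transportTop_bot hM Z₀
  have h3 := continuousOn_matrix_inv h1 fun u hu =>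
    isUnit_det_transportTop (hM.symplectic hs hu) hZ hpos
  exact (continuousOn_matrix_mul h2 h3).const_smul (-Complex.I)

/-- Let `Q`, `P` be the blocks of the transported frame and `F = (1; iZ)`, so that `iZ = P Q⁻¹`.
From `Q' = (h F)₂ Q` and `P' = -(h F)₁ Q` the derivative of `P Q⁻¹` is `-((h F)₁ + iZ (h F)₂)`, and
symmetry of `Z` identifies this with `-Fᵀ h F`. -/
theorem hasEntrywiseDeriv_transport {t : ℝ} (ht : 0 ≤ t) :
    HasEntrywiseDeriv (fun u => transport (M u) Z₀)
      (Complex.I • ((frame (transport (M t) Z₀))ᵀ * (h t).map Complex.ofReal *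
        frame (transport (M t) Z₀))) (Set.Ici t) t := by
  obtain ⟨h1, h2⟩ := hasEntrywiseDeriv_transportTop_bot hM hs hZ hpos ht
  have hu : ∀ u, 0 ≤ u → IsUnit (transportTop (M u) Z₀).det := fun u hu =>
    isUnit_det_transportTop (hM.symplectic hs hu) hZ hpos
  have h3 := h2.mul (h1.inv fun u hu' => hu u (ht.trans hu'))
  have hT := transport_transpose (hM.symplectic hs ht) hZ hpos
  have hIZ : Complex.I • transport (M t) Z₀ = transportBot (M t) Z₀ * (transportTop (M t) Z₀)⁻¹ := by
    rw [transport, smul_smul]; simp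
  set F := frame (transport (M t) Z₀) with hF
  set Q := transportTop (M t) Z₀
  set P := transportBot (M t) Z₀
  set A := (h t).map Complex.ofReal * F with hA
  have h4 : -(A.toRows₁ * Q) * Q⁻¹ + P * -(Q⁻¹ * (A.toRows₂ * Q) * Q⁻¹) = -(Fᵀ * (h t).map Complex.ofReal * F) := by
    rw [Matrix.mul_assoc Fᵀ, ← hA]
    conv_rhs => rw [← Matrix.fromRows_toRows A, hF, frame_transpose_mul_fromRows hT, hIZ]
    have hq := Matrix.mul_nonsing_inv _ (hu t ht)
    calc _ = -(A.toRows₁ * (Q * Q⁻¹)) - P * Q⁻¹ * A.toRows₂ * (Q * Q⁻¹) := by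
          simp only [Matrix.neg_mul, Matrix.mul_neg, Matrix.mul_assoc, sub_eq_add_neg]
      _ = _ := by rw [hq, Matrix.mul_one, Matrix.mul_one]; abel
  rw [h4] at h3
  intro i j
  have := (h3 i j).const_mul (-Complex.I)
  refine this.congr_deriv ?_
  simp

set_option maxHeartbeats 800000 in
/-- The linear part of the transported Gaussian. -/
theorem exists_linearPart {f : ℝ → m ⊕ m → ℝ} (b₀ : m → ℂ)
    (hf : ∀ t, 0 ≤ t → ∀ a, ContinuousWithinAt (fun s => f s a) (Set.Ici t) t)
    (hfb : ∀ T : ℝ, ∃ C : ℝ, ∀ t ∈ Set.Icc 0 T, ∀ a, |f t a| ≤ C) :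
    ∃ b : ℝ → m → ℂ, b 0 = b₀ ∧ ContinuousOn b (Set.Ici 0) ∧
      ∀ t, 0 ≤ t → ∀ k, HasDerivWithinAt (fun s => b s k)
      ((-Complex.I) * ((frame (transport (M t) Z₀))ᵀ *ᵥ ((h t).map Complex.ofReal *ᵥ
        (Sum.elim 0 (-Complex.I • b t)) + fun a => (f t a : ℂ))) k) (Set.Ici t) t := by
  set W : ℝ → Matrix (m ⊕ m) m ℂ := fun t => (M t).map Complex.ofReal * frame Z₀ with hW
  set fc : ℝ → Matrix (m ⊕ m) Unit ℂ := fun t => Matrix.of fun a _ => (f t a : ℂ) with hfc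
  have hWc : ∀ a k, ContinuousOn (fun t => W t a k) (Set.Ici 0) := by
    intro a k
    simp only [hW, Matrix.mul_apply, Matrix.map_apply]
    exact continuousOn_finsetSum _ fun j _ =>
      (Complex.continuous_ofReal.comp_continuousOn (hM.cont a j)).mul continuousOn_const
  set u : m → ℝ → ℂ := fun k t => ((W t)ᵀ * fc t) k () with hu
  have hu1 : ∀ k t, 0 ≤ t → ContinuousWithinAt (u k) (Set.Ici t) t := by
    intro k t ht
    simp only [hu, Matrix.mul_apply, Matrix.transpose_apply, hfc, Matrix.of_apply]
    refine tendsto_finsetSum _ fun a _ => Filter.Tendsto.mul ?_ ?_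
    · exact (hWc a k t ht).mono (Set.Ici_subset_Ici.2 ht)
    · exact (Complex.continuous_ofReal.tendsto _).comp (hf t ht a)
  have hu2 : ∀ k, ∀ T : ℝ, ∃ C : ℝ, ∀ t ∈ Set.Icc 0 T, ‖u k t‖ ≤ C := by
    intro k T
    obtain ⟨C, hC⟩ := hfb T
    have hbd : ∀ a, ∃ D, ∀ t ∈ Set.Icc 0 T, ‖W t a k‖ ≤ D := fun a =>
      isCompact_Icc.exists_bound_of_continuousOn ((hWc a k).mono Set.Icc_subset_Ici_self)
    choose D hD using hbd
    refine ⟨∑ a, D a * C, fun t ht => ?_⟩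
    simp only [hu, Matrix.mul_apply, Matrix.transpose_apply, hfc, Matrix.of_apply]
    refine norm_sum_le_of_le _ fun a _ => ?_
    rw [norm_mul, Complex.norm_real]
    exact mul_le_mul (hD a t ht) (hC t ht a) (norm_nonneg _) ((norm_nonneg _).trans (hD a t ht))
  -- Variation of constants: if `b` solves the equation, then `Qᵀ b` has derivative `-i Wᵀ f`, in
  -- which `b` no longer occurs. Hence `Qᵀ b` is the primitive `β`, and `b = (Qᵀ)⁻¹ β`.
  set β : ℝ → Matrix m Unit ℂ := fun t =>
    Matrix.of fun k _ => (((transportTop (M 0) Z₀)ᵀ) *ᵥ b₀) k + (-Complex.I) * ∫ y in (0 : ℝ)..t, u k y with hβ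
  have hβ' : ∀ t, 0 ≤ t → HasEntrywiseDeriv β (-Complex.I • ((W t)ᵀ * fc t)) (Set.Ici t) t := by
    intro t ht k x
    exact ((hasDerivWithinAt_integral_of_rightContinuous (hu1 k) (hu2 k) ht).const_mul _).const_add _
  have hunit : ∀ u, 0 ≤ u → IsUnit ((transportTop (M u) Z₀)ᵀ).det := fun u hu => by
    rw [Matrix.det_transpose]
    exact isUnit_det_transportTop (hM.symplectic hs hu) hZ hpos
  set B : ℝ → Matrix m Unit ℂ := fun t => ((transportTop (M t) Z₀)ᵀ)⁻¹ * β t with hB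
  refine ⟨fun t k => B t k (), ?_, ?_, fun t ht k => ?_⟩
  · funext k
    have h1 : β 0 = (transportTop (M 0) Z₀)ᵀ * (Matrix.of fun k _ => b₀ k) := by
      ext k x
      simp [hβ, Matrix.mulVec, dotProduct, Matrix.mul_apply]
    simp only [hB]
    rw [h1, ← Matrix.mul_assoc, Matrix.nonsing_inv_mul _ (hunit 0 le_rfl), Matrix.one_mul]
    rfl
  · have hβc : ContinuousOn β (Set.Ici 0) := continuousOn_pi.2 fun k => continuousOn_pi.2 fun _ =>
      continuousOn_const.add (continuousOn_const.mul
        (continuousOn_integral_of_rightContinuous (hu1 k) (hu2 k)))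
    have hBc : ContinuousOn B (Set.Ici 0) := by
      have h0 : ContinuousOn (fun t => (transportTop (M t) Z₀)ᵀ) (Set.Ici 0) :=
        continuous_id.matrix_transpose.comp_continuousOn (continuousOn_transportTop_bot hM Z₀).1
      exact continuousOn_matrix_mul (continuousOn_matrix_inv h0 fun u hu => hunit u hu) hβc
    exact continuousOn_pi.2 fun k => continuousOn_pi.1 (continuousOn_pi.1 hBc k) ()
  · have hd := ((hasEntrywiseDeriv_transportTop_bot hM hs hZ hpos ht).1.transpose.inv
      (fun u hu => hunit u (ht.trans hu))).mul (hβ' t ht)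
    refine (hd k ()).congr_deriv ?_
    have hT := transport_transpose (hM.symplectic hs ht) hZ hpos
    have hWt := mul_frame_eq hM hs hZ hpos ht
    set F := frame (transport (M t) Z₀) with hF
    set Q := transportTop (M t) Z₀
    set hc := (h t).map Complex.ofReal
    have hcT : hcᵀ = hc := by rw [← Matrix.transpose_map, hs t ht]
    have h2 : (W t)ᵀ = Qᵀ * Fᵀ := by rw [← Matrix.transpose_mul, ← hWt]
    have hq := Matrix.nonsing_inv_mul _ (hunit t ht)
    have h3 : -(Qᵀ⁻¹ * ((hc * F).toRows₂ * Q)ᵀ * Qᵀ⁻¹) * β t + Qᵀ⁻¹ * (-Complex.I • ((W t)ᵀ * fc t)) =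
        -((hc * F).toRows₂ᵀ * B t) - Complex.I • (Fᵀ * fc t) := by
      rw [h2, Matrix.transpose_mul]
      calc _ = -((Qᵀ⁻¹ * Qᵀ) * (hc * F).toRows₂ᵀ * (Qᵀ⁻¹ * β t)) - Complex.I • ((Qᵀ⁻¹ * Qᵀ) * Fᵀ * fc t) := by
            simp only [Matrix.neg_mul, Matrix.mul_neg, neg_smul, Matrix.mul_smul, Matrix.mul_assoc, sub_eq_add_neg]
        _ = _ := by rw [hq, Matrix.one_mul, Matrix.one_mul]
    rw [h3]
    have h4 : Fᵀ *ᵥ (hc *ᵥ (Sum.elim 0 (-Complex.I • fun k => B t k ()))) =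
        (-Complex.I) • ((hc * F).toRows₂ᵀ *ᵥ fun k => B t k ()) := by
      rw [Matrix.mulVec_mulVec, ← hcT, ← Matrix.transpose_mul, hcT]
      conv_lhs => rw [← Matrix.fromRows_toRows (hc * F), Matrix.transpose_fromRows, Matrix.fromCols_mulVec]
      simp [Matrix.mulVec_neg, Matrix.mulVec_smul]
    rw [Matrix.mulVec_add, h4]
    simp only [Matrix.sub_apply, Matrix.neg_apply, Matrix.smul_apply, Pi.add_apply, Pi.smul_apply, smul_eq_mul]
    have h5 : ((hc * F).toRows₂ᵀ * B t) k () = ((hc * F).toRows₂ᵀ *ᵥ fun k => B t k ()) k := rfl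
    have h6 : (Fᵀ * fc t) k () = (Fᵀ *ᵥ fun a => (f t a : ℂ)) k := rfl
    rw [h5, h6]
    linear_combination (-((hc * F).toRows₂ᵀ *ᵥ fun k => B t k ()) k) * Complex.I_mul_I

end
end GaussianFlow

/-! ### The canonical operators and the Hamiltonian acting on Gaussians. -/

section Operators
variable {NA NB N : ℕ}

/-- The labels of the modes of `A` and `B`. -/
abbrev Modes (NA NB : ℕ) : Type := Fin NA ⊕ Fin NB

/-- The coordinates of the modes as a linear equivalence. -/
def coordEquiv (NA NB : ℕ) : (Config NA × Config NB) ≃L[ℝ] (Modes NA NB → ℝ) :=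
  LinearEquiv.toContinuousLinearEquiv
    { toFun := fun x k => coord k x
      invFun := fun u => (WithLp.toLp 2 fun i => u (Sum.inl i), WithLp.toLp 2 fun j => u (Sum.inr j))
      map_add' := fun x y => by funext k; cases k <;> rfl
      map_smul' := fun c x => by funext k; cases k <;> rfl
      left_inv := fun x => rfl
      right_inv := fun u => by funext k; cases k <;> rfl }

theorem coordEquiv_apply (x : Config NA × Config NB) (k : Modes NA NB) :
    coordEquiv NA NB x k = coord k x := rfl

theorem coordEquiv_unitVector (k i : Modes NA NB) :
    coordEquiv NA NB (unitVector k) i = if i = k then 1 else 0 := by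
  rw [coordEquiv_apply]
  rcases k with k | k <;> rcases i with i | i <;> simp [coord, unitVector]

theorem canonicalOp_inl_apply (k : Modes NA NB) (ψ : WaveFunction NA NB) (x : Config NA × Config NB) :
    canonicalOp (Sum.inl k) ψ x = (coordEquiv NA NB x k : ℂ) * ψ x := by
  have h : (fun x : Config NA × Config NB => ((coord k x : ℝ) : ℂ)).HasTemperateGrowth :=
    (Complex.ofRealCLM ∘L (ContinuousLinearMap.proj (R := ℝ) (φ := fun _ : Modes NA NB => ℝ) k) ∘L
      (coordEquiv NA NB : (Config NA × Config NB) →L[ℝ] (Modes NA NB → ℝ))).hasTemperateGrowth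
  rw [canonicalOp, SchwartzMap.smulLeftCLM_apply_apply h]
  rfl

theorem canonicalOp_inr_apply {k : Modes NA NB} {ψ : WaveFunction NA NB} {x : Config NA × Config NB}
    {d : ℂ} (h : HasLineDerivAt ℝ ψ d x (unitVector k)) :
    canonicalOp (Sum.inr k) ψ x = -Complex.I * d := by
  have h1 : canonicalOp (Sum.inr k) ψ x = (-Complex.I) • (LineDeriv.lineDerivOp (unitVector k) ψ) x := rfl
  rw [h1, SchwartzMap.lineDerivOp_apply, h.lineDeriv, smul_eq_mul]

theorem hasLineDerivAt_of_canonicalOp (k : Modes NA NB) (ψ : WaveFunction NA NB) (x : Config NA × Config NB) :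
    HasLineDerivAt ℝ ψ (Complex.I * canonicalOp (Sum.inr k) ψ x) x (unitVector k) := by
  have h := ((ψ.hasFDerivAt x).hasLineDerivAt (unitVector k))
  rw [canonicalOp_inr_apply h, ← mul_assoc]
  simpa using h

/-- The coordinates of the observables `ξ^a` with respect to the Darboux basis. -/
def reprMatrix (D : SplitBasis NA NB N) : Matrix (Fin N ⊕ Fin N) (Modes NA NB ⊕ Modes NA NB) ℝ :=
  Matrix.of fun a r => D.repr (Pi.single a 1) r

/-- The matrix whose rows are the Darboux basis. -/
def basisMatrix (D : SplitBasis NA NB N) : Matrix (Modes NA NB ⊕ Modes NA NB) (Fin N ⊕ Fin N) ℝ :=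
  Matrix.of fun r a => D r a

theorem basisMatrix_mul_reprMatrix (D : SplitBasis NA NB N) : basisMatrix D * reprMatrix D = 1 := by
  ext r s
  have h : D.repr (D r) s = ∑ a, D r a * D.repr (Pi.single a 1) s := by
    conv_lhs => rw [show D r = ∑ a, D r a • (Pi.single a 1 : DualPhaseSpace N) by
      funext b; simp [Finset.sum_apply, Pi.single_apply]]
    rw [map_sum, Finsupp.finsetSum_apply]
    simp
  rw [Matrix.mul_apply]
  change ∑ a, D r a * D.repr (Pi.single a 1) s = _
  rw [← h, D.repr_self, Finsupp.single_apply, Matrix.one_apply]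

theorem reprMatrix_mul_basisMatrix (D : SplitBasis NA NB N) : reprMatrix D * basisMatrix D = 1 := by
  ext a b
  have h := congrFun (D.sum_repr (Pi.single a 1)) b
  rw [Finset.sum_apply] at h
  rw [Matrix.mul_apply, Matrix.one_apply]
  refine h.trans ?_
  rw [Pi.single_apply]
  simp [eq_comm]

theorem basisMatrix_mul_omega {D : SplitBasis NA NB N} (hD : IsDarboux D) :
    basisMatrix D * Omega (Fin N) = Omega (Modes NA NB) * (reprMatrix D)ᵀ := by
  have h1 : basisMatrix D * Omega (Fin N) * (basisMatrix D)ᵀ = Omega (Modes NA NB) := by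
    ext r s
    rw [← hD r s, poisson, Matrix.mul_assoc]
    rfl
  have h2 : (basisMatrix D)ᵀ * (reprMatrix D)ᵀ = 1 := by
    rw [← Matrix.transpose_mul, reprMatrix_mul_basisMatrix, Matrix.transpose_one]
  rw [← h1, Matrix.mul_assoc, h2, Matrix.mul_one]

/-- The quadratic part of the Hamiltonian in the Darboux basis. -/
def quadraticPart (D : SplitBasis NA NB N) (H : QuadraticHamiltonian N) (t : ℝ) :
    Matrix (Modes NA NB ⊕ Modes NA NB) (Modes NA NB ⊕ Modes NA NB) ℝ :=
  (reprMatrix D)ᵀ * H.h t * reprMatrix D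

/-- The linear part of the Hamiltonian in the Darboux basis. -/
def linearPart (D : SplitBasis NA NB N) (H : QuadraticHamiltonian N) (t : ℝ) :
    Modes NA NB ⊕ Modes NA NB → ℝ := (reprMatrix D)ᵀ *ᵥ H.f t

theorem xiOp_apply (D : SplitBasis NA NB N) (a : Fin N ⊕ Fin N) (ψ : WaveFunction NA NB) :
    xiOp D a ψ = ∑ r, ((reprMatrix D a r : ℝ) : ℂ) • canonicalOp r ψ := by
  rw [xiOp, quantize, _root_.sum_apply]
  rfl

theorem hamiltonianOp_apply (D : SplitBasis NA NB N) (H : QuadraticHamiltonian N) (t : ℝ)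
    (ψ : WaveFunction NA NB) :
    hamiltonianOp D H t ψ = (1 / 2 : ℂ) • (∑ r, ∑ s, ((quadraticPart D H t r s : ℝ) : ℂ) •
      canonicalOp r (canonicalOp s ψ)) + ∑ r, ((linearPart D H t r : ℝ) : ℂ) • canonicalOp r ψ := by
  have h1 : hamiltonianOp D H t ψ = (1 / 2 : ℂ) • (∑ a, ∑ b, ((H.h t a b : ℝ) : ℂ) •
      xiOp D a (xiOp D b ψ)) + ∑ a, ((H.f t a : ℝ) : ℂ) • xiOp D a ψ := by
    rw [hamiltonianOp]
    simp
  rw [h1]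
  congr 1
  · congr 1
    simp_rw [xiOp_apply, map_sum, map_smul, quadraticPart, Matrix.mul_apply, Matrix.transpose_apply,
      Finset.smul_sum, smul_smul, Finset.sum_mul, Complex.ofReal_sum, Finset.sum_smul]
    rw [Finset.sum_congr rfl fun a _ => Finset.sum_comm]
    rw [Finset.sum_comm]
    refine Finset.sum_congr rfl fun r _ => ?_
    rw [Finset.sum_congr rfl fun a _ => Finset.sum_comm]
    rw [Finset.sum_comm]
    refine Finset.sum_congr rfl fun s _ => ?_
    rw [Finset.sum_comm]
    refine Finset.sum_congr rfl fun a _ => Finset.sum_congr rfl fun b _ => ?_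
    push_cast
    congr 1
    ring
  · simp_rw [xiOp_apply, linearPart, Matrix.mulVec, dotProduct, Matrix.transpose_apply,
      Finset.smul_sum, smul_smul, Complex.ofReal_sum, Finset.sum_smul]
    rw [Finset.sum_comm]
    refine Finset.sum_congr rfl fun r _ => Finset.sum_congr rfl fun a _ => ?_
    push_cast
    congr 1
    ring

/-- The flow in the Darboux basis. -/
def flowMatrix (D : SplitBasis NA NB N) (M : ℝ → Matrix (Fin N ⊕ Fin N) (Fin N ⊕ Fin N) ℝ) (t : ℝ) :
    Matrix (Modes NA NB ⊕ Modes NA NB) (Modes NA NB ⊕ Modes NA NB) ℝ :=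
  basisMatrix D * M t * reprMatrix D

/-- The change to a Darboux basis is symplectic, so in the new coordinates the flow is again
generated by `Ω` and the transformed quadratic form. -/
theorem isLinearFlow_flowMatrix {D : SplitBasis NA NB N} (hD : IsDarboux D)
    {H : QuadraticHamiltonian N} {M : ℝ → Matrix (Fin N ⊕ Fin N) (Fin N ⊕ Fin N) ℝ}
    (hM : IsClassicalFlow H M) : IsLinearFlow (quadraticPart D H) (flowMatrix D M) := by
  refine ⟨?_, fun r s => ?_, fun t ht => ?_⟩
  · rw [flowMatrix, hM.init, Matrix.mul_one, basisMatrix_mul_reprMatrix]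
  · simp only [flowMatrix, Matrix.mul_apply]
    exact continuousOn_finsetSum _ fun a _ => (continuousOn_finsetSum _ fun b _ =>
      continuousOn_const.mul (hM.cont _ _)).mul continuousOn_const
  · have h1 : HasEntrywiseDeriv M (Omega (Fin N) * H.h t * M t) (Set.Ici t) t := hM.ode t ht
    have h2 := (h1.const_mul (basisMatrix D)).mul_const (reprMatrix D)
    have h3 : basisMatrix D * (Omega (Fin N) * H.h t * M t) * reprMatrix D =
        Omega (Modes NA NB) * quadraticPart D H t * flowMatrix D M t := by
      calc _ = (basisMatrix D * Omega (Fin N)) * (H.h t * M t * reprMatrix D) := by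
            simp only [Matrix.mul_assoc]
        _ = Omega (Modes NA NB) * (reprMatrix D)ᵀ * H.h t * (1 * M t) * reprMatrix D := by
            rw [basisMatrix_mul_omega hD, Matrix.one_mul]; simp only [Matrix.mul_assoc]
        _ = _ := by
            rw [← reprMatrix_mul_basisMatrix D, quadraticPart, flowMatrix]; simp only [Matrix.mul_assoc]
    rw [h3] at h2
    exact h2

theorem quadraticPart_transpose (D : SplitBasis NA NB N) (H : QuadraticHamiltonian N) {t : ℝ}
    (ht : 0 ≤ t) : (quadraticPart D H t)ᵀ = quadraticPart D H t := by
  rw [quadraticPart, Matrix.transpose_mul, Matrix.transpose_mul, Matrix.transpose_transpose,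
    (H.symm t ht).eq, Matrix.mul_assoc]

theorem linearPart_rightContinuous (D : SplitBasis NA NB N) (H : QuadraticHamiltonian N) (t : ℝ)
    (ht : 0 ≤ t) (a : Modes NA NB ⊕ Modes NA NB) :
    ContinuousWithinAt (fun s => linearPart D H s a) (Set.Ici t) t := by
  simp only [linearPart, Matrix.mulVec, dotProduct]
  exact tendsto_finsetSum _ fun i _ => (H.rightCont_f t ht i).tendsto.const_mul _

theorem linearPart_locallyBounded (D : SplitBasis NA NB N) (H : QuadraticHamiltonian N) (T : ℝ) :
    ∃ C : ℝ, ∀ t ∈ Set.Icc 0 T, ∀ a, |linearPart D H t a| ≤ C := by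
  obtain ⟨C, hC⟩ := H.locBdd_f T
  refine ⟨∑ a, ∑ i, |reprMatrix D i a| * C, fun t ht a => ?_⟩
  have h0 : ∀ a, 0 ≤ ∑ i, |reprMatrix D i a| * C := fun a => Finset.sum_nonneg fun i _ =>
    mul_nonneg (abs_nonneg _) ((abs_nonneg _).trans (hC t ht i))
  refine le_trans ?_ (Finset.single_le_sum (fun a _ => h0 a) (Finset.mem_univ a))
  simp only [linearPart, Matrix.mulVec, dotProduct]
  refine (Finset.abs_sum_le_sum_abs _ _).trans (Finset.sum_le_sum fun i _ => ?_)
  rw [abs_mul]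
  exact mul_le_mul_of_nonneg_left (hC t ht i) (abs_nonneg _)

section GaussianAction
variable {Z : Matrix (Modes NA NB) (Modes NA NB) ℂ} (hZ : Zᵀ = Z) (hpos : (Z.map Complex.re).PosDef)
  (b : Modes NA NB → ℂ)

/-- The affine function by which the canonical operators act on a Gaussian. -/
def frameValue (Z : Matrix (Modes NA NB) (Modes NA NB) ℂ) (b : Modes NA NB → ℂ)
    (x : Config NA × Config NB) : Modes NA NB ⊕ Modes NA NB → ℂ :=
  frame Z *ᵥ (fun k => (coordEquiv NA NB x k : ℂ)) + Sum.elim (0 : Modes NA NB → ℂ) (-Complex.I • b)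

theorem frameValue_inl (x : Config NA × Config NB) (k : Modes NA NB) :
    frameValue Z b x (Sum.inl k) = coordEquiv NA NB x k := by
  rw [frameValue, frame, Matrix.fromRows_mulVec]
  simp

theorem frameValue_inr (x : Config NA × Config NB) (k : Modes NA NB) :
    frameValue Z b x (Sum.inr k) = -Complex.I * (b k - ∑ j, Z k j * coordEquiv NA NB x j) := by
  rw [frameValue, frame, Matrix.fromRows_mulVec]
  simp [Matrix.mulVec, dotProduct, mul_assoc, ← Finset.mul_sum]
  ring

include hZ hpos

theorem hasLineDerivAt_gaussian (x : Config NA × Config NB) (k : Modes NA NB) :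
    HasLineDerivAt ℝ (gaussian (coordEquiv NA NB) Z b)
      (Complex.I * frameValue Z b x (Sum.inr k) * gaussian (coordEquiv NA NB) Z b x) x (unitVector k) := by
  have h := (hasFDerivAt_gaussianExponent hZ b (coordEquiv NA NB) x (unitVector k))
  have h2 := (HasDerivAt.cexp (f := fun t : ℝ => gaussianExponent Z b (coordEquiv NA NB
    (x + t • unitVector k))) h).congr_of_eventuallyEq
    (f₁ := fun t : ℝ => gaussian (coordEquiv NA NB) Z b (x + t • unitVector k))
    (Filter.Eventually.of_forall fun t => gaussian_apply _ hpos b _)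
  refine HasDerivAt.congr_deriv h2 ?_
  rw [gaussian_apply _ hpos, zero_smul, add_zero, mul_comm]
  congr 1
  simp_rw [coordEquiv_unitVector]
  rw [frameValue_inr, ← mul_assoc]
  rw [Finset.sum_eq_single k (fun i _ hi => by simp [hi]) (by simp)]
  simp [-Fintype.sum_sum_type]

theorem canonicalOp_gaussian (r : Modes NA NB ⊕ Modes NA NB) (x : Config NA × Config NB) :
    canonicalOp r (gaussian (coordEquiv NA NB) Z b) x =
      frameValue Z b x r * gaussian (coordEquiv NA NB) Z b x := by
  rcases r with k | k
  · rw [canonicalOp_inl_apply, frameValue_inl]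
  · rw [canonicalOp_inr_apply (hasLineDerivAt_gaussian hZ hpos b x k), mul_assoc, ← mul_assoc]
    simp

omit hZ hpos in
theorem hasLineDerivAt_frameValue (x : Config NA × Config NB) (k : Modes NA NB)
    (s : Modes NA NB ⊕ Modes NA NB) :
    HasLineDerivAt ℝ (fun x => frameValue Z b x s) (frame Z s k) x (unitVector k) := by
  have h : ∀ i, HasDerivAt (fun t : ℝ => ((coordEquiv NA NB (x + t • unitVector k) i : ℝ) : ℂ))
      ((if i = k then 1 else 0 : ℝ) : ℂ) 0 := by
    intro i
    have : HasDerivAt (fun t : ℝ => coordEquiv NA NB x i + t * coordEquiv NA NB (unitVector k) i)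
        (coordEquiv NA NB (unitVector k) i) 0 := by
      simpa using ((hasDerivAt_id (0 : ℝ)).mul_const (coordEquiv NA NB (unitVector k) i)).const_add
        (coordEquiv NA NB x i)
    rw [coordEquiv_unitVector] at this
    simpa [coordEquiv_unitVector] using this.ofReal_comp
  have h2 := (HasDerivAt.fun_sum fun i (_ : i ∈ Finset.univ) => (h i).const_mul (frame Z s i)).add_const
    (Sum.elim (0 : Modes NA NB → ℂ) (-Complex.I • b) s)
  refine HasDerivAt.congr_deriv h2 ?_
  rw [Finset.sum_eq_single k (fun i _ hi => by simp [hi]) (by simp)]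
  simp

/-- The extra term in the action of a product of two canonical operators. -/
def orderingTerm (Z : Matrix (Modes NA NB) (Modes NA NB) ℂ) :
    Modes NA NB ⊕ Modes NA NB → Modes NA NB ⊕ Modes NA NB → ℂ
  | Sum.inl _, _ => 0
  | Sum.inr k, s => -Complex.I * frame Z s k

theorem canonicalOp_canonicalOp_gaussian (r s : Modes NA NB ⊕ Modes NA NB) (x : Config NA × Config NB) :
    canonicalOp r (canonicalOp s (gaussian (coordEquiv NA NB) Z b)) x =
      (frameValue Z b x r * frameValue Z b x s + orderingTerm Z r s) *
        gaussian (coordEquiv NA NB) Z b x := by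
  rcases r with k | k
  · rw [canonicalOp_inl_apply, canonicalOp_gaussian hZ hpos, frameValue_inl]
    simp [orderingTerm]
    ring
  · have h1 := hasLineDerivAt_frameValue (Z := Z) b x k s
    have h2 := hasLineDerivAt_gaussian hZ hpos b x k
    have h3 := (HasDerivAt.mul h1 h2).congr_of_eventuallyEq
      (f₁ := fun t : ℝ => canonicalOp s (gaussian (coordEquiv NA NB) Z b) (x + t • unitVector k))
      (Filter.Eventually.of_forall fun t => canonicalOp_gaussian hZ hpos b s _)
    rw [canonicalOp_inr_apply (ψ := canonicalOp s (gaussian (coordEquiv NA NB) Z b)) h3, zero_smul, add_zero, orderingTerm]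
    linear_combination (-frameValue Z b x (Sum.inr k) * frameValue Z b x s *
      gaussian (coordEquiv NA NB) Z b x) * Complex.I_mul_I

/-- Each canonical operator multiplies the Gaussian by an affine function of `x`, so the Hamiltonian
multiplies it by a quadratic polynomial. Its quadratic and linear coefficients are the right-hand
sides of the equations for `Z` and `b`; the constant term, which contains the ordering terms, is
collected in `μ`, since only the ray of the state has to be followed. -/
theorem hamiltonianOp_gaussian (D : SplitBasis NA NB N) (H : QuadraticHamiltonian N) {t : ℝ} (ht : 0 ≤ t) :
    ∃ μ : ℂ, ∀ x, (-Complex.I • hamiltonianOp D H t (gaussian (coordEquiv NA NB) Z b) -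
        μ • gaussian (coordEquiv NA NB) Z b) x =
      gaussianExponent (Complex.I • ((frame Z)ᵀ * (quadraticPart D H t).map Complex.ofReal * frame Z))
        (fun k => (-Complex.I) * ((frame Z)ᵀ *ᵥ ((quadraticPart D H t).map Complex.ofReal *ᵥ
        (Sum.elim 0 (-Complex.I • b)) + fun a => (linearPart D H t a : ℂ))) k) (coordEquiv NA NB x) *
      gaussian (coordEquiv NA NB) Z b x := by
  set hc := (quadraticPart D H t).map Complex.ofReal with hhc
  set fc : Modes NA NB ⊕ Modes NA NB → ℂ := fun a => (linearPart D H t a : ℂ) with hfc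
  set g : Modes NA NB ⊕ Modes NA NB → ℂ := Sum.elim 0 (-Complex.I • b) with hg
  have hcT : hcᵀ = hc := by rw [hhc, ← Matrix.transpose_map, quadraticPart_transpose D H ht]
  refine ⟨-Complex.I * (1 / 2 * (g ⬝ᵥ hc *ᵥ g + ∑ r, ∑ s, hc r s * orderingTerm Z r s) + fc ⬝ᵥ g), fun x => ?_⟩
  set F := frame Z with hF
  set y : Modes NA NB → ℂ := fun k => (coordEquiv NA NB x k : ℂ) with hy
  have hA : frameValue Z b x = F *ᵥ y + g := rfl
  have h1 : hamiltonianOp D H t (gaussian (coordEquiv NA NB) Z b) x =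
      (1 / 2 * (frameValue Z b x ⬝ᵥ hc *ᵥ frameValue Z b x + ∑ r, ∑ s, hc r s * orderingTerm Z r s) +
        fc ⬝ᵥ frameValue Z b x) * gaussian (coordEquiv NA NB) Z b x := by
    rw [hamiltonianOp_apply]
    simp only [_root_.add_apply, _root_.smul_apply, _root_.sum_apply, smul_eq_mul,
      canonicalOp_gaussian hZ hpos, canonicalOp_canonicalOp_gaussian hZ hpos]
    rw [add_mul, mul_assoc (1 / 2 : ℂ), add_mul]
    congr 2
    · simp only [dotProduct, Matrix.mulVec, Finset.mul_sum, Finset.sum_mul, hhc, Matrix.map_apply]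
      rw [← Finset.sum_add_distrib]
      refine Finset.sum_congr rfl fun r _ => ?_
      rw [← Finset.sum_add_distrib]
      refine Finset.sum_congr rfl fun s _ => by ring
    · simp only [dotProduct, Finset.sum_mul, hfc, mul_assoc]
  have h2 : gaussianExponent (Complex.I • (Fᵀ * hc * F))
        (fun k => (-Complex.I) * (Fᵀ *ᵥ (hc *ᵥ g + fc)) k) (coordEquiv NA NB x) =
      -(1 / 2) * (Complex.I * ((F *ᵥ y) ⬝ᵥ hc *ᵥ (F *ᵥ y))) - Complex.I * ((F *ᵥ y) ⬝ᵥ (hc *ᵥ g + fc)) := by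
    have e1 : ∑ i, ∑ j, (Complex.I • (Fᵀ * hc * F)) i j * y i * y j =
        Complex.I * ((F *ᵥ y) ⬝ᵥ hc *ᵥ (F *ᵥ y)) := by
      have : (F *ᵥ y) ⬝ᵥ hc *ᵥ (F *ᵥ y) = y ⬝ᵥ (Fᵀ * hc * F) *ᵥ y := by
        rw [← Matrix.mulVec_mulVec, ← Matrix.mulVec_mulVec, Matrix.dotProduct_mulVec y,
          Matrix.vecMul_transpose]
      rw [this]
      simp only [dotProduct, Matrix.mulVec, Finset.mul_sum, Matrix.smul_apply, smul_eq_mul]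
      refine Finset.sum_congr rfl fun i _ => Finset.sum_congr rfl fun j _ => by ring
    have e2 : ∑ i, (-Complex.I) * (Fᵀ *ᵥ (hc *ᵥ g + fc)) i * y i =
        -Complex.I * ((F *ᵥ y) ⬝ᵥ (hc *ᵥ g + fc)) := by
      have : (F *ᵥ y) ⬝ᵥ (hc *ᵥ g + fc) = (Fᵀ *ᵥ (hc *ᵥ g + fc)) ⬝ᵥ y := by
        rw [dotProduct_comm, Matrix.dotProduct_mulVec, Matrix.mulVec_transpose]
      rw [this]
      simp only [dotProduct, Finset.mul_sum, mul_assoc]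
    rw [gaussianExponent]
    rw [e1, e2]
    ring
  rw [h2]
  simp only [_root_.sub_apply, _root_.smul_apply, smul_eq_mul, h1, hA]
  have h3 : g ⬝ᵥ hc *ᵥ (F *ᵥ y) = (F *ᵥ y) ⬝ᵥ hc *ᵥ g := by
    conv_rhs => rw [dotProduct_comm, ← hcT, Matrix.mulVec_transpose, ← Matrix.dotProduct_mulVec]
  simp only [Matrix.mulVec_add, add_dotProduct, dotProduct_add]
  rw [h3, dotProduct_comm fc (F *ᵥ y)]
  ring

end GaussianAction
end Operators

/-! ### Symmetry of the Hamiltonian and uniqueness of the evolved ray. -/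

section Evolution
variable {NA NB N : ℕ}

instance volume_isAddHaarMeasure : (volume : Measure (Config NA × Config NB)).IsAddHaarMeasure :=
  inferInstanceAs ((volume : Measure (Config NA)).prod (volume : Measure (Config NB))).IsAddHaarMeasure

/-- The vector of the Hilbert space given by a wave function. -/
def vec (ψ : WaveFunction NA NB) : Lp ℂ 2 (volume : Measure (Config NA × Config NB)) := ψ.toLp 2

theorem vec_def (ψ : WaveFunction NA NB) : ψ.toLp 2 = vec ψ := rfl

theorem inner_vec (φ ψ : WaveFunction NA NB) :
    ⟪vec φ, vec ψ⟫_ℂ = ∫ x, (starRingEnd ℂ) (φ x) * ψ x := by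
  refine (SchwartzMap.inner_toL2_toL2_eq φ ψ volume).trans ?_
  simp [mul_comm]

theorem vec_zero : vec (0 : WaveFunction NA NB) = 0 :=
  (SchwartzMap.toLpCLM ℂ ℂ 2 (volume : Measure (Config NA × Config NB))).map_zero

theorem vec_add (φ ψ : WaveFunction NA NB) : vec (φ + ψ) = vec φ + vec ψ :=
  (SchwartzMap.toLpCLM ℂ ℂ 2 (volume : Measure (Config NA × Config NB))).map_add φ ψ

theorem vec_sub (φ ψ : WaveFunction NA NB) : vec (φ - ψ) = vec φ - vec ψ :=
  (SchwartzMap.toLpCLM ℂ ℂ 2 (volume : Measure (Config NA × Config NB))).map_sub φ ψ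

theorem vec_smul (c : ℂ) (ψ : WaveFunction NA NB) : vec (c • ψ) = c • vec ψ :=
  (SchwartzMap.toLpCLM ℂ ℂ 2 (volume : Measure (Config NA × Config NB))).map_smul c ψ

theorem vec_sum {α : Type*} (s : Finset α) (ψ : α → WaveFunction NA NB) :
    vec (∑ i ∈ s, ψ i) = ∑ i ∈ s, vec (ψ i) :=
  map_sum (SchwartzMap.toLpCLM ℂ ℂ 2 (volume : Measure (Config NA × Config NB))) ψ s

theorem vec_injective {φ ψ : WaveFunction NA NB} (h : vec φ = vec ψ) : φ = ψ :=
  SchwartzMap.injective_toLp 2 volume h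

/-- `T` is symmetric on the Schwartz functions. -/
def IsSymmetricOp (T : WaveFunction NA NB →L[ℂ] WaveFunction NA NB) : Prop :=
  ∀ φ ψ, ⟪vec (T φ), vec ψ⟫_ℂ = ⟪vec φ, vec (T ψ)⟫_ℂ

theorem isSymmetricOp_canonicalOp (r : Modes NA NB ⊕ Modes NA NB) : IsSymmetricOp (canonicalOp r) := by
  intro φ ψ
  rw [inner_vec, inner_vec]
  rcases r with k | k
  · congr 1
    funext x
    rw [canonicalOp_inl_apply, canonicalOp_inl_apply, map_mul, Complex.conj_ofReal]
    ring
  · set B : ℂ →L[ℝ] ℂ →L[ℝ] ℂ :=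
      (ContinuousLinearMap.mul ℝ ℂ) ∘L (Complex.conjCLE : ℂ →L[ℝ] ℂ)
    have h := SchwartzMap.integral_bilinear_lineDerivOp_right_eq_neg_left
      (μ := (volume : Measure (Config NA × Config NB))) φ ψ B (unitVector k)
    have h1 : ∀ x, (starRingEnd ℂ) (canonicalOp (Sum.inr k) φ x) * ψ x =
        Complex.I * B (LineDeriv.lineDerivOp (unitVector k) φ x) (ψ x) := by
      intro x
      have : canonicalOp (Sum.inr k) φ x = -Complex.I * LineDeriv.lineDerivOp (unitVector k) φ x := rfl
      rw [this, map_mul]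
      simp [B]
      ring
    have h2 : ∀ x, (starRingEnd ℂ) (φ x) * canonicalOp (Sum.inr k) ψ x =
        -Complex.I * B (φ x) (LineDeriv.lineDerivOp (unitVector k) ψ x) := by
      intro x
      have : canonicalOp (Sum.inr k) ψ x = -Complex.I * LineDeriv.lineDerivOp (unitVector k) ψ x := rfl
      rw [this]
      simp [B]
      ring
    simp_rw [h1, h2]
    rw [integral_const_mul, integral_const_mul, h]
    ring

theorem IsSymmetricOp.real_smul {T : WaveFunction NA NB →L[ℂ] WaveFunction NA NB}
    (hT : IsSymmetricOp T) (c : ℝ) : IsSymmetricOp ((c : ℂ) • T) := by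
  intro φ ψ
  simp only [_root_.smul_apply, vec_smul, inner_smul_left, inner_smul_right, Complex.conj_ofReal]
  rw [hT]

theorem IsSymmetricOp.sum {α : Type*} {s : Finset α} {T : α → WaveFunction NA NB →L[ℂ] WaveFunction NA NB}
    (hT : ∀ i ∈ s, IsSymmetricOp (T i)) : IsSymmetricOp (∑ i ∈ s, T i) := by
  intro φ ψ
  simp only [_root_.sum_apply, vec_sum, sum_inner, inner_sum]
  exact Finset.sum_congr rfl fun i hi => hT i hi φ ψ

theorem IsSymmetricOp.add {S T : WaveFunction NA NB →L[ℂ] WaveFunction NA NB}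
    (hS : IsSymmetricOp S) (hT : IsSymmetricOp T) : IsSymmetricOp (S + T) := by
  intro φ ψ
  simp only [_root_.add_apply, vec_add, inner_add_left, inner_add_right]
  rw [hS, hT]

theorem isSymmetricOp_xiOp (D : SplitBasis NA NB N) (a : Fin N ⊕ Fin N) : IsSymmetricOp (xiOp D a) :=
  IsSymmetricOp.sum fun r _ => (isSymmetricOp_canonicalOp r).real_smul _

theorem isSymmetricOp_hamiltonianOp (D : SplitBasis NA NB N) (H : QuadraticHamiltonian N) {t : ℝ}
    (ht : 0 ≤ t) : IsSymmetricOp (hamiltonianOp D H t) := by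
  refine IsSymmetricOp.add ?_ (IsSymmetricOp.sum fun a _ => (isSymmetricOp_xiOp D a).real_smul _)
  have h2 : (1 / 2 : ℂ) = ((1 / 2 : ℝ) : ℂ) := by push_cast; rfl
  rw [h2]
  refine IsSymmetricOp.real_smul (fun φ ψ => ?_) _
  simp only [_root_.sum_apply, _root_.smul_apply, ContinuousLinearMap.comp_apply, vec_sum, vec_smul,
    sum_inner, inner_sum, inner_smul_left, inner_smul_right, Complex.conj_ofReal]
  rw [Finset.sum_comm]
  refine Finset.sum_congr rfl fun b _ => Finset.sum_congr rfl fun a _ => ?_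
  rw [isSymmetricOp_xiOp D a, isSymmetricOp_xiOp D b, ← (H.symm t ht).apply a b]

/-- A solution of the Schrödinger equation stays proportional to a path of vectors that
solves it up to scalar multiples of the path. -/
theorem exists_eq_smul_of_hasDerivWithinAt {E : Type*} [NormedAddCommGroup E] [InnerProductSpace ℂ E]
    {ψ φ Aψ Aφ : ℝ → E} {μ : ℝ → ℂ}
    (hψc : ContinuousOn ψ (Set.Ici 0)) (hφc : ContinuousOn φ (Set.Ici 0))
    (hψ : ∀ t, 0 ≤ t → HasDerivWithinAt ψ (-Complex.I • Aψ t) (Set.Ici t) t)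
    (hφ : ∀ t, 0 ≤ t → HasDerivWithinAt φ (-Complex.I • Aφ t - μ t • φ t) (Set.Ici t) t)
    (hψψ : ∀ t, 0 ≤ t → ⟪Aψ t, ψ t⟫_ℂ = ⟪ψ t, Aψ t⟫_ℂ)
    (hφφ : ∀ t, 0 ≤ t → ⟪Aφ t, φ t⟫_ℂ = ⟪φ t, Aφ t⟫_ℂ)
    (hφψ : ∀ t, 0 ≤ t → ⟪Aφ t, ψ t⟫_ℂ = ⟪φ t, Aψ t⟫_ℂ)
    (hne : ∀ t, 0 ≤ t → φ t ≠ 0) {c : ℂ} (h0 : ψ 0 = c • φ 0) {t : ℝ} (ht : 0 ≤ t) :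
    ‖ψ t‖ = ‖ψ 0‖ ∧ ∃ c : ℂ, ψ t = c • φ t := by
  have hψψ' : ∀ t, 0 ≤ t → HasDerivWithinAt (fun s => ⟪ψ s, ψ s⟫_ℂ) 0 (Set.Ici t) t := by
    intro t ht
    refine ((hψ t ht).inner ℂ (hψ t ht)).congr_deriv ?_
    rw [inner_smul_left, inner_smul_right, hψψ t ht, map_neg, Complex.conj_I]
    ring
  have hu : ∀ t, 0 ≤ t → HasDerivWithinAt (fun s => ⟪φ s, ψ s⟫_ℂ)
      (-(starRingEnd ℂ) (μ t) * ⟪φ t, ψ t⟫_ℂ) (Set.Ici t) t := by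
    intro t ht
    refine ((hφ t ht).inner ℂ (hψ t ht)).congr_deriv ?_
    rw [inner_sub_left, inner_smul_left, inner_smul_left, inner_smul_right, hφψ t ht, map_neg, Complex.conj_I]
    ring
  have hn : ∀ t, 0 ≤ t → HasDerivWithinAt (fun s => ⟪φ s, φ s⟫_ℂ)
      (-((starRingEnd ℂ) (μ t) + μ t) * ⟪φ t, φ t⟫_ℂ) (Set.Ici t) t := by
    intro t ht
    refine ((hφ t ht).inner ℂ (hφ t ht)).congr_deriv ?_
    rw [inner_sub_left, inner_sub_right, inner_smul_left, inner_smul_left, inner_smul_right, inner_smul_right,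
      hφφ t ht, map_neg, Complex.conj_I]
    ring
  have hn0 : ∀ t, 0 ≤ t → ⟪φ t, φ t⟫_ℂ ≠ 0 := fun t ht => inner_self_ne_zero.2 (hne t ht)
  -- The contributions of `μ` to the numerator and the denominator cancel, so this ratio is constant
  -- whatever the regularity of `μ`. Since `‖ψ‖` is constant too, equality in the Cauchy–Schwarz
  -- inequality holds at every time because it holds at time `0`, and it forces `ψ t` to be a
  -- multiple of `φ t`.
  have hr : ∀ t, 0 ≤ t → HasDerivWithinAt (fun s => ⟪φ s, ψ s⟫_ℂ *
      (starRingEnd ℂ) ⟪φ s, ψ s⟫_ℂ / ⟪φ s, φ s⟫_ℂ) 0 (Set.Ici t) t := by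
    intro t ht
    have h1 := (((hu t ht).mul (hu t ht).star)).div (hn t ht) (hn0 t ht)
    refine h1.congr_deriv ?_
    have h2 : star (-(starRingEnd ℂ) (μ t) * ⟪φ t, ψ t⟫_ℂ) =
        -μ t * (starRingEnd ℂ) ⟪φ t, ψ t⟫_ℂ := by
      rw [← starRingEnd_apply, map_mul, map_neg, Complex.conj_conj]
    rw [h2]
    have h3 : star ⟪φ t, ψ t⟫_ℂ = (starRingEnd ℂ) ⟪φ t, ψ t⟫_ℂ := rfl
    simp only [Pi.mul_apply, h3]
    rw [div_eq_zero_iff]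
    left
    ring
  have hcu : ContinuousOn (fun s => ⟪φ s, ψ s⟫_ℂ) (Set.Ici 0) := hφc.inner hψc
  have hconst : ∀ {g : ℝ → ℂ}, ContinuousOn g (Set.Ici 0) →
      (∀ t, 0 ≤ t → HasDerivWithinAt g 0 (Set.Ici t) t) → g t = g 0 := fun hc hd =>
    constant_of_has_deriv_right_zero (hc.mono Set.Icc_subset_Ici_self) (fun u hu => hd u hu.1) t ⟨ht, le_rfl⟩
  have e1 : ⟪ψ t, ψ t⟫_ℂ = ⟪ψ 0, ψ 0⟫_ℂ := hconst (hψc.inner hψc) hψψ'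
  have e2 := hconst ((hcu.mul hcu.star).div (hφc.inner hφc) (fun s hs => hn0 s hs)) hr
  have hnorm : ‖ψ t‖ = ‖ψ 0‖ := by
    rw [inner_self_eq_norm_sq_to_K, inner_self_eq_norm_sq_to_K] at e1
    have : ‖ψ t‖ ^ 2 = ‖ψ 0‖ ^ 2 := by exact_mod_cast e1
    exact (pow_left_inj₀ (norm_nonneg _) (norm_nonneg _) two_ne_zero).1 this
  refine ⟨hnorm, ?_⟩
  have e3 : ⟪φ t, ψ t⟫_ℂ * (starRingEnd ℂ) ⟪φ t, ψ t⟫_ℂ = ⟪ψ t, ψ t⟫_ℂ * ⟪φ t, φ t⟫_ℂ := by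
    rw [e1, ← div_eq_iff (hn0 t ht)]
    refine e2.trans ?_
    change ⟪φ 0, ψ 0⟫_ℂ * (starRingEnd ℂ) ⟪φ 0, ψ 0⟫_ℂ / ⟪φ 0, φ 0⟫_ℂ = _
    rw [div_eq_iff (hn0 0 le_rfl), h0]
    simp only [inner_smul_left, inner_smul_right, map_mul, inner_conj_symm]
    ring
  have e4 : ‖⟪φ t, ψ t⟫_ℂ‖ = ‖φ t‖ * ‖ψ t‖ := by
    rw [RCLike.mul_conj, inner_self_eq_norm_sq_to_K, inner_self_eq_norm_sq_to_K] at e3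
    have : ‖⟪φ t, ψ t⟫_ℂ‖ ^ 2 = (‖φ t‖ * ‖ψ t‖) ^ 2 := by
      rw [mul_pow, mul_comm]
      exact_mod_cast e3
    exact (pow_left_inj₀ (norm_nonneg _) (by positivity) two_ne_zero).1 this
  by_cases hz : ψ t = 0
  · exact ⟨0, by rw [hz, zero_smul]⟩
  · obtain ⟨r, _, hr⟩ := (norm_inner_eq_norm_iff (hne t ht) hz).1 e4
    exact ⟨r, hr⟩

theorem exists_eq_smul_of_isSchrodingerSolution {D : SplitBasis NA NB N} {H : QuadraticHamiltonian N}
    {ψ φ : ℝ → WaveFunction NA NB} (hψ : IsSchrodingerSolution D H ψ) (hφ0 : ∀ t, 0 ≤ t → φ t ≠ 0)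
    {μ : ℝ → ℂ} (hφ : ∀ t, 0 ≤ t → HasDerivWithinAt (fun s => (φ s).toLp 2)
      ((-Complex.I • hamiltonianOp D H t (φ t) - μ t • φ t).toLp 2) (Set.Ici t) t)
    (hφc : ContinuousOn (fun t => (φ t).toLp 2) (Set.Ici 0))
    {c : ℂ} (h0 : ψ 0 = c • φ 0) {t : ℝ} (ht : 0 ≤ t) :
    ‖(ψ t).toLp 2‖ = ‖(ψ 0).toLp 2‖ ∧ ∃ c : ℂ, ψ t = c • φ t := by
  have h := exists_eq_smul_of_hasDerivWithinAt (ψ := fun t => vec (ψ t)) (φ := fun t => vec (φ t))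
    (Aψ := fun t => vec (hamiltonianOp D H t (ψ t))) (Aφ := fun t => vec (hamiltonianOp D H t (φ t)))
    (μ := μ) (c := c) hψ.cont hφc
    (fun t ht => (hψ.schrodinger t ht).congr_deriv (by rw [vec_def, vec_smul]))
    (fun t ht => (hφ t ht).congr_deriv (by rw [vec_def, vec_sub, vec_smul, vec_smul]))
    (fun t ht => isSymmetricOp_hamiltonianOp D H ht _ _) (fun t ht => isSymmetricOp_hamiltonianOp D H ht _ _)
    (fun t ht => isSymmetricOp_hamiltonianOp D H ht _ _)
    (fun t ht h => hφ0 t ht (vec_injective (by rw [h, vec_zero])))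
    (by rw [h0, vec_smul]) ht
  refine ⟨h.1, ?_⟩
  obtain ⟨c, hc⟩ := h.2
  exact ⟨c, vec_injective (by rw [hc, vec_smul])⟩

theorem gaussian_ne_zero {Z : Matrix (Modes NA NB) (Modes NA NB) ℂ} (hpos : (Z.map Complex.re).PosDef)
    (b : Modes NA NB → ℂ) : gaussian (coordEquiv NA NB) Z b ≠ 0 := by
  intro h
  have := gaussian_apply (coordEquiv NA NB) hpos b 0
  rw [h] at this
  exact Complex.exp_ne_zero _ this.symm

/-- The quotient of `ψ` by the Gaussian has vanishing derivatives in all coordinate directions,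
hence is constant. -/
theorem exists_eq_smul_gaussian {Z : Matrix (Modes NA NB) (Modes NA NB) ℂ} (hZ : Zᵀ = Z)
    (hpos : (Z.map Complex.re).PosDef) (b : Modes NA NB → ℂ) (ψ : WaveFunction NA NB)
    (h : ∀ k x, HasLineDerivAt ℝ ψ ((b k - ∑ j, Z k j * coordEquiv NA NB x j) * ψ x) x (unitVector k)) :
    ∃ c : ℂ, ψ = c • gaussian (coordEquiv NA NB) Z b := by
  set p := fun x => gaussianExponent Z b (coordEquiv NA NB x) with hp
  have hpd : Differentiable ℝ p :=
    (hasTemperateGrowth_gaussianExponent Z b (coordEquiv NA NB)).1.differentiable (by simp)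
  have hd : Differentiable ℝ fun x => ψ x * Complex.exp (-p x) :=
    ψ.differentiable.mul (hpd.neg.cexp)
  have hz : ∀ x, fderiv ℝ (fun x => ψ x * Complex.exp (-p x)) x = 0 := by
    intro x
    have hk : ∀ k : Modes NA NB, fderiv ℝ (fun x => ψ x * Complex.exp (-p x)) x (unitVector k) = 0 := by
      intro k
      have h1 := hasFDerivAt_gaussianExponent hZ b (coordEquiv NA NB) x (unitVector k)
      have h2 := HasDerivAt.mul (h k x) (HasDerivAt.cexp (HasDerivAt.neg h1))
      have h3 : HasLineDerivAt ℝ (fun x => ψ x * Complex.exp (-p x)) 0 x (unitVector k) := by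
        refine HasDerivAt.congr_deriv h2 ?_
        have h5 : ∑ i, (b i - ∑ j, Z i j * coordEquiv NA NB x j) * coordEquiv NA NB (unitVector k) i =
            b k - ∑ j, Z k j * coordEquiv NA NB x j := by
          rw [Finset.sum_eq_single k (fun i _ hi => by simp [coordEquiv_unitVector, hi]) (by simp)]
          simp [coordEquiv_unitVector]
        rw [h5]
        simp only [zero_smul, add_zero]
        ring
      have h4 := ((hd x).hasFDerivAt.hasLineDerivAt (unitVector k)).lineDeriv
      rw [h3.lineDeriv] at h4
      exact h4.symm
    refine ContinuousLinearMap.ext fun v => ?_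
    have hv : v = ∑ k, (coordEquiv NA NB v k) • (unitVector k : Config NA × Config NB) := by
      apply (coordEquiv NA NB).injective
      rw [map_sum]
      funext i
      rw [Finset.sum_apply, Finset.sum_eq_single i (fun k _ hk => by simp [coordEquiv_unitVector, hk.symm]) (by simp)]
      simp [coordEquiv_unitVector]
    rw [hv, map_sum]
    simp only [map_smul, hk, smul_zero, Finset.sum_const_zero]
    rfl
  refine ⟨ψ 0 * Complex.exp (-p 0), ?_⟩
  ext x
  have h1 := is_const_of_fderiv_eq_zero hd hz x 0
  rw [_root_.smul_apply, gaussian_apply _ hpos, smul_eq_mul, ← h1, mul_assoc, ← Complex.exp_add]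
  simp [hp]

end Evolution

/-! ### The covariance matrix in block form. -/

section Covariance
variable {m : Type} [Fintype m] [DecidableEq m]

theorem map_re_add_I_smul (A B : Matrix m m ℝ) :
    (A.map Complex.ofReal + Complex.I • B.map Complex.ofReal).map Complex.re = A := by
  ext i j
  simp

theorem eq_map_re_add_I_smul (Z : Matrix m m ℂ) :
    Z = (Z.map Complex.re).map Complex.ofReal + Complex.I • (Z.map Complex.im).map Complex.ofReal := by
  ext i j
  simp [mul_comm Complex.I]

theorem map_ofReal_inv {X : Matrix m m ℝ} (hX : IsUnit X.det) :
    (X⁻¹).map Complex.ofReal = (X.map Complex.ofReal)⁻¹ := by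
  refine (Matrix.inv_eq_right_inv ?_).symm
  rw [← map_ofReal_mul, Matrix.mul_nonsing_inv _ hX]
  ext i j
  simp [Matrix.one_apply, apply_ite]

theorem covariance_eq_fromBlocks {Z : Matrix m m ℂ} (hZ : Zᵀ = Z) {X Y : Matrix m m ℝ}
    (hXdef : Z.map Complex.re = X) (hYdef : Z.map Complex.im = Y) (hX : X.PosDef) :
    covariance Z = Matrix.fromBlocks X⁻¹ (-(X⁻¹ * Y)) (-(Y * X⁻¹)) (X + Y * X⁻¹ * Y) := by
  have hu : IsUnit X.det := hX.det_pos.ne'.isUnit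
  have hXT : Xᵀ = X := by rw [← hXdef, ← Matrix.transpose_map, hZ]
  have hYT : Yᵀ = Y := by rw [← hYdef, ← Matrix.transpose_map, hZ]
  have hZe : Z = X.map Complex.ofReal + Complex.I • Y.map Complex.ofReal := by
    rw [← hXdef, ← hYdef]; exact eq_map_re_add_I_smul Z
  have hH : ∀ {A : Matrix m m ℝ}, Aᵀ = A → (A.map Complex.ofReal)ᴴ = A.map Complex.ofReal := by
    intro A hA
    conv_rhs => rw [← hA]
    ext i j
    simp
  have hZH : Zᴴ = X.map Complex.ofReal - Complex.I • Y.map Complex.ofReal := by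
    rw [hZe, Matrix.conjTranspose_add, Matrix.conjTranspose_smul, hH hXT, hH hYT]
    simp [sub_eq_add_neg]
  have hR : (reC Z)⁻¹ = (X⁻¹).map Complex.ofReal := by
    rw [map_ofReal_inv hu, ← hXdef]
  have h1 : frame Z * (reC Z)⁻¹ * (frame Z)ᴴ = Matrix.fromBlocks (X⁻¹.map Complex.ofReal)
      (X⁻¹.map Complex.ofReal * (Complex.I • Z)ᴴ) (Complex.I • Z * X⁻¹.map Complex.ofReal)
      (Complex.I • Z * X⁻¹.map Complex.ofReal * (Complex.I • Z)ᴴ) := by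
    rw [hR, frame, Matrix.fromRows_mul, Matrix.conjTranspose_fromRows_eq_fromCols_conjTranspose,
      Matrix.fromRows_mul_fromCols]
    simp
  have hIZ : Complex.I • Z = (-Y).map Complex.ofReal + Complex.I • X.map Complex.ofReal := by
    rw [hZe]
    ext i j
    simp [mul_add, ← mul_assoc]
    ring
  have hIZH : (Complex.I • Z)ᴴ = (-Y).map Complex.ofReal + Complex.I • (-X).map Complex.ofReal := by
    rw [Matrix.conjTranspose_smul, hZH]
    ext i j
    simp [mul_sub, ← mul_assoc]
    ring
  have hmn : ∀ A B : Matrix m m ℝ, A.map Complex.ofReal * B.map Complex.ofReal = (A * B).map Complex.ofReal :=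
    fun A B => (map_ofReal_mul A B).symm
  rw [covariance, h1, Matrix.fromBlocks_map]
  refine Matrix.fromBlocks_inj.2 ⟨?_, ?_, ?_, ?_⟩
  · ext i j; simp
  · rw [hIZH, mul_add, mul_smul_comm, hmn, hmn, map_re_add_I_smul, mul_neg]
  · rw [hIZ, add_mul, smul_mul_assoc, hmn, hmn, map_re_add_I_smul, neg_mul]
  · have : Complex.I • Z * X⁻¹.map Complex.ofReal * (Complex.I • Z)ᴴ =
        (X + Y * X⁻¹ * Y).map Complex.ofReal + Complex.I • ((-Y * X⁻¹ * -X) + (X * X⁻¹ * -Y)).map Complex.ofReal := by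
      rw [hIZH, hIZ, add_mul, smul_mul_assoc, hmn, hmn, add_mul, mul_add, mul_add, smul_mul_assoc, smul_mul_assoc,
        mul_smul_comm, mul_smul_comm, hmn, hmn, hmn, hmn, smul_smul, Complex.I_mul_I]
      rw [Matrix.mul_nonsing_inv _ hu]
      ext i j
      simp
      ring
    rw [this, map_re_add_I_smul]

/-- With `X = Re Z` and `Y = Im Z` the covariance is the block diagonal matrix of `X⁻¹` and `X`,
conjugated by the unipotent shear with lower left block `-Y`. -/
theorem posDef_covariance {Z : Matrix m m ℂ} (hZ : Zᵀ = Z) (hpos : (Z.map Complex.re).PosDef) :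
    (covariance Z).PosDef := by
  set X := Z.map Complex.re with hX
  set Y := Z.map Complex.im with hY
  have hu : IsUnit X.det := hpos.det_pos.ne'.isUnit
  have hYT : Yᵀ = Y := by rw [hY, ← Matrix.transpose_map, hZ]
  have hT : covariance Z = Matrix.fromBlocks 1 0 (-Y) 1 * Matrix.fromBlocks X⁻¹ 0 0 X *
      (Matrix.fromBlocks 1 0 (-Y) 1)ᵀ := by
    rw [covariance_eq_fromBlocks hZ hX.symm hY.symm hpos, Matrix.fromBlocks_transpose,
      Matrix.fromBlocks_multiply, Matrix.fromBlocks_multiply]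
    simp [hYT, add_comm]
  have hD : (Matrix.fromBlocks X⁻¹ 0 0 X : Matrix (m ⊕ m) (m ⊕ m) ℝ).PosDef := by
    have := hpos.inv.isUnit.invertible
    have h := (Matrix.PosDef.fromBlocks₁₁ (0 : Matrix m m ℝ) X hpos.inv)
    refine (Matrix.PosSemidef.posDef_iff_isUnit ?_).2 ?_
    · simpa using h.2 (by simpa using hpos.posSemidef)
    · rw [Matrix.isUnit_iff_isUnit_det, Matrix.det_fromBlocks_zero₂₁]
      exact hpos.inv.det_pos.ne'.isUnit.mul hu
  rw [hT]
  have hinj : IsUnit (Matrix.fromBlocks 1 0 (-Y) 1 : Matrix (m ⊕ m) (m ⊕ m) ℝ) := by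
    rw [Matrix.isUnit_iff_isUnit_det]
    simp
  have := hD.mul_mul_conjTranspose_same (B := Matrix.fromBlocks 1 0 (-Y) 1)
    (Matrix.vecMul_injective_iff_isUnit.2 hinj)
  simpa only [Matrix.conjTranspose_eq_transpose_of_trivial] using this

end Covariance

/-! ### From the complex structure to the Gaussian wave function, and its evolution. -/

section InitialState
variable {NA NB N : ℕ}

/-- The matrix of the Gaussian wave function with the complex structure `J`. -/
def gaussianMatrix {m : Type} [Fintype m] [DecidableEq m] (J : Matrix (m ⊕ m) (m ⊕ m) ℝ) : Matrix m m ℂ :=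
  (J.toBlocks₁₂)⁻¹.map Complex.ofReal + Complex.I • ((J.toBlocks₁₂)⁻¹ * J.toBlocks₁₁).map Complex.ofReal

section
variable {m : Type} [Fintype m] [DecidableEq m] {J : Matrix (m ⊕ m) (m ⊕ m) ℝ}
  (hsq : J * J = -1) (hpos : (-(Omega m * J)).PosDef)
include hpos

theorem neg_omega_mul (J : Matrix (m ⊕ m) (m ⊕ m) ℝ) : -(Omega m * J) =
    Matrix.fromBlocks (-J.toBlocks₂₁) (-J.toBlocks₂₂) J.toBlocks₁₁ J.toBlocks₁₂ := by
  conv_lhs => rw [← Matrix.fromBlocks_toBlocks J]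
  rw [Omega, Matrix.fromBlocks_multiply, Matrix.fromBlocks_neg]
  simp

theorem posDef_toBlocks₁₂ : J.toBlocks₁₂.PosDef := by
  have h := hpos.submatrix (Sum.inr_injective (α := m) (β := m))
  rw [neg_omega_mul hpos] at h
  exact h

theorem map_re_gaussianMatrix : ((gaussianMatrix J).map Complex.re).PosDef := by
  rw [gaussianMatrix, map_re_add_I_smul]
  exact (posDef_toBlocks₁₂ hpos).inv

include hsq

/-- Symmetry of `Ω J` makes `J₁₂` symmetric and gives `J₁₁ᵀ = -J₂₂`. The upper right block of `J² =
-1` then reads `J₁₁ J₁₂ = J₁₂ J₁₁ᵀ`, which is symmetry of `J₁₂⁻¹ J₁₁`. -/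
theorem gaussianMatrix_transpose : (gaussianMatrix J)ᵀ = gaussianMatrix J := by
  have h12 := posDef_toBlocks₁₂ hpos
  have hT : (J.toBlocks₁₂)ᵀ = J.toBlocks₁₂ := by
    rw [← Matrix.conjTranspose_eq_transpose_of_trivial]; exact h12.isHermitian
  have h11 : (J.toBlocks₁₁)ᵀ = -J.toBlocks₂₂ := by
    have h := hpos.isHermitian
    rw [neg_omega_mul hpos, Matrix.IsHermitian, Matrix.fromBlocks_conjTranspose, Matrix.fromBlocks_inj] at h
    simpa using h.2.1
  have hu : IsUnit (J.toBlocks₁₂).det := h12.det_pos.ne'.isUnit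
  have hJ : J.toBlocks₁₁ * J.toBlocks₁₂ = J.toBlocks₁₂ * (J.toBlocks₁₁)ᵀ := by
    have h := hsq
    rw [← Matrix.fromBlocks_toBlocks J, Matrix.fromBlocks_multiply, ← Matrix.fromBlocks_one,
      Matrix.fromBlocks_neg, Matrix.fromBlocks_inj] at h
    rw [h11, mul_neg, eq_neg_iff_add_eq_zero]
    simpa using h.2.1
  have hs : ((J.toBlocks₁₂)⁻¹ * J.toBlocks₁₁)ᵀ = (J.toBlocks₁₂)⁻¹ * J.toBlocks₁₁ := by
    rw [Matrix.transpose_mul, Matrix.transpose_nonsing_inv, hT]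
    calc _ = (J.toBlocks₁₂)⁻¹ * (J.toBlocks₁₂ * (J.toBlocks₁₁)ᵀ) * (J.toBlocks₁₂)⁻¹ := by
          rw [← Matrix.mul_assoc, Matrix.nonsing_inv_mul _ hu, Matrix.one_mul]
      _ = _ := by
          rw [← hJ, Matrix.mul_assoc, Matrix.mul_assoc, Matrix.mul_nonsing_inv _ hu, Matrix.mul_one]
  rw [gaussianMatrix, Matrix.transpose_add, Matrix.transpose_smul, ← Matrix.transpose_map, ← Matrix.transpose_map,
    hs, Matrix.transpose_nonsing_inv, hT]

end

/-- The complex structure in the Darboux basis. -/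
def darbouxMatrix (D : SplitBasis NA NB N) (J : Matrix (Fin N ⊕ Fin N) (Fin N ⊕ Fin N) ℝ) :
    Matrix (Modes NA NB ⊕ Modes NA NB) (Modes NA NB ⊕ Modes NA NB) ℝ :=
  basisMatrix D * J * reprMatrix D

theorem darbouxMatrix_sq (D : SplitBasis NA NB N) {J : Matrix (Fin N ⊕ Fin N) (Fin N ⊕ Fin N) ℝ}
    (hJ : IsCompatibleComplexStructure J) : darbouxMatrix D J * darbouxMatrix D J = -1 := by
  calc _ = basisMatrix D * J * (reprMatrix D * basisMatrix D) * J * reprMatrix D := by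
        simp only [darbouxMatrix, Matrix.mul_assoc]
    _ = basisMatrix D * (J * J) * reprMatrix D := by
        rw [reprMatrix_mul_basisMatrix, Matrix.mul_one, Matrix.mul_assoc _ J J]
    _ = _ := by
        rw [hJ.sq, Matrix.mul_neg, Matrix.neg_mul, Matrix.mul_one, basisMatrix_mul_reprMatrix]

theorem omega_inv (n : ℕ) : (Omega (Fin n))⁻¹ = -Omega (Fin n) :=
  Matrix.inv_eq_right_inv (by rw [mul_neg, omega_mul_omega, neg_neg])

theorem posDef_darbouxMatrix {D : SplitBasis NA NB N} (hD : IsDarboux D)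
    {J : Matrix (Fin N ⊕ Fin N) (Fin N ⊕ Fin N) ℝ} (hJ : IsCompatibleComplexStructure J) :
    (-(Omega (Modes NA NB) * darbouxMatrix D J)).PosDef := by
  have h1 : Omega (Modes NA NB) * basisMatrix D = (reprMatrix D)ᵀ * Omega (Fin N) := by
    have h := congrArg (fun A => -(Omega (Modes NA NB) * A * Omega (Fin N))) (basisMatrix_mul_omega hD)
    simp only [← Matrix.mul_assoc] at h
    rw [omega_mul_omega, Matrix.mul_assoc _ (Omega (Fin N)), omega_mul_omega] at h
    simpa using h
  have h2 : -(Omega (Modes NA NB) * darbouxMatrix D J) =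
      (reprMatrix D)ᴴ * ((Omega (Fin N))⁻¹ * J) * reprMatrix D := by
    rw [darbouxMatrix, ← Matrix.mul_assoc, ← Matrix.mul_assoc, h1, omega_inv,
      Matrix.conjTranspose_eq_transpose_of_trivial]
    simp [Matrix.mul_assoc]
  rw [h2]
  refine hJ.posDef.conjTranspose_mul_mul_same fun x y h => ?_
  have := congrArg (fun v => basisMatrix D *ᵥ v) h
  simpa [Matrix.mulVec_mulVec, basisMatrix_mul_reprMatrix] using this

/-- In Darboux coordinates the annihilation conditions read `u + i K u = 0`, where `u` collects the
values at `x` of the centred canonical operators applied to `ψ`. Since `K₁₂` is invertible, the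
upper half of these equations can be solved for the momentum components, and becomes the gradient
equation of a Gaussian with matrix `K₁₂⁻¹ + i K₁₂⁻¹ K₁₁`. -/
theorem IsGaussianState.canonicalOp_inr {D : SplitBasis NA NB N} (hD : IsDarboux D)
    {J : Matrix (Fin N ⊕ Fin N) (Fin N ⊕ Fin N) ℝ} (hJ : IsCompatibleComplexStructure J)
    {ζ : Fin N ⊕ Fin N → ℝ} {ψ : WaveFunction NA NB} (h : IsGaussianState D J ζ ψ) :
    ∃ b : Modes NA NB → ℂ, ∀ k x, Complex.I * canonicalOp (Sum.inr k) ψ x =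
      (b k - ∑ j, gaussianMatrix (darbouxMatrix D J) k j * coordEquiv NA NB x j) * ψ x := by
  set K := darbouxMatrix D J with hK
  set ζD := basisMatrix D *ᵥ ζ with hζD
  set Z := gaussianMatrix K with hZ
  refine ⟨fun k => Complex.I * ζD (Sum.inr k) + ∑ j, Z k j * ζD (Sum.inl j), fun k x => ?_⟩
  set u : Modes NA NB ⊕ Modes NA NB → ℂ := fun r => canonicalOp r ψ x - (ζD r : ℂ) * ψ x with hu
  set w : Fin N ⊕ Fin N → ℂ := fun a => xiOp D a ψ x - (ζ a : ℂ) * ψ x with hw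
  have hζ : ζ = reprMatrix D *ᵥ ζD := by
    rw [hζD, Matrix.mulVec_mulVec, reprMatrix_mul_basisMatrix, Matrix.one_mulVec]
  have hwu : w = (reprMatrix D).map Complex.ofReal *ᵥ u := by
    funext a
    have h1 : xiOp D a ψ x = ∑ r, (reprMatrix D a r : ℂ) * canonicalOp r ψ x := by
      rw [xiOp_apply, _root_.sum_apply]
      rfl
    have h2 : (ζ a : ℂ) = ∑ r, (reprMatrix D a r : ℂ) * ζD r := by
      rw [hζ]
      simp [Matrix.mulVec, dotProduct, -Fintype.sum_sum_type]
    simp only [hw, hu, h1, h2, Matrix.mulVec, dotProduct, Matrix.map_apply, mul_sub, Finset.sum_sub_distrib,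
      Finset.sum_mul, mul_assoc]
  have hann : w + Complex.I • (J.map Complex.ofReal *ᵥ w) = 0 := by
    funext b
    have h1 := DFunLike.congr_fun (h.annihilated b) x
    simp only [_root_.add_apply, _root_.sub_apply, _root_.smul_apply, _root_.sum_apply, smul_eq_mul,
      _root_.zero_apply] at h1
    simpa [hw, Matrix.mulVec, dotProduct, -Fintype.sum_sum_type] using h1
  have hBE : (basisMatrix D).map Complex.ofReal * (reprMatrix D).map Complex.ofReal = 1 := by
    rw [← map_ofReal_mul, basisMatrix_mul_reprMatrix]
    ext i j
    simp [Matrix.one_apply, apply_ite]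
  have hannu : u + Complex.I • (K.map Complex.ofReal *ᵥ u) = 0 := by
    have h1 := congrArg (fun v => (basisMatrix D).map Complex.ofReal *ᵥ v) hann
    simp only [hwu, Matrix.mulVec_add, Matrix.mulVec_smul, Matrix.mulVec_mulVec, Matrix.mulVec_zero] at h1
    rw [hBE, Matrix.one_mulVec, ← Matrix.mul_assoc, ← map_ofReal_mul, ← map_ofReal_mul] at h1
    exact h1
  have hp := posDef_toBlocks₁₂ (posDef_darbouxMatrix hD hJ)
  have hdet : IsUnit (K.toBlocks₁₂).det := hp.det_pos.ne'.isUnit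
  set uq : Modes NA NB → ℂ := fun k => u (Sum.inl k) with huq
  set up : Modes NA NB → ℂ := fun k => u (Sum.inr k) with hup
  have h1 : uq + Complex.I • (K.toBlocks₁₁.map Complex.ofReal *ᵥ uq + K.toBlocks₁₂.map Complex.ofReal *ᵥ up) = 0 := by
    funext k
    have := congrFun hannu (Sum.inl k)
    simp only [Pi.add_apply, Pi.smul_apply, Matrix.mulVec, dotProduct, smul_eq_mul, Pi.zero_apply,
      Fintype.sum_sum_type (α₁ := Modes NA NB) (α₂ := Modes NA NB)] at this ⊢
    exact this
  have h2 : Complex.I • up = -(Z *ᵥ uq) := by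
    have h3 := congrArg (fun v => (K.toBlocks₁₂)⁻¹.map Complex.ofReal *ᵥ v) h1
    have h4 : (K.toBlocks₁₂)⁻¹.map Complex.ofReal * K.toBlocks₁₂.map Complex.ofReal = 1 := by
      rw [← map_ofReal_mul, Matrix.nonsing_inv_mul _ hdet]
      ext i j
      simp [Matrix.one_apply, apply_ite]
    simp only [Matrix.mulVec_add, Matrix.mulVec_smul, Matrix.mulVec_mulVec, Matrix.mulVec_zero, h4,
      Matrix.one_mulVec, ← map_ofReal_mul] at h3
    rw [hZ, gaussianMatrix, Matrix.add_mulVec, Matrix.smul_mulVec, eq_neg_iff_add_eq_zero, ← h3]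
    module
  have h3 := congrFun h2 k
  have h4 : (Z *ᵥ uq) k = (∑ j, Z k j * coordEquiv NA NB x j - ∑ j, Z k j * ζD (Sum.inl j)) * ψ x := by
    simp only [Matrix.mulVec, dotProduct, huq, hu, canonicalOp_inl_apply, ← Finset.sum_sub_distrib, Finset.sum_mul]
    refine Finset.sum_congr rfl fun j _ => ?_
    ring
  rw [Pi.smul_apply, Pi.neg_apply, h4] at h3
  simp only [hup, hu, smul_eq_mul] at h3
  linear_combination h3

theorem IsGaussianState.exists_eq_smul_gaussian {D : SplitBasis NA NB N} (hD : IsDarboux D)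
    {J : Matrix (Fin N ⊕ Fin N) (Fin N ⊕ Fin N) ℝ} (hJ : IsCompatibleComplexStructure J)
    {ζ : Fin N ⊕ Fin N → ℝ} {ψ : WaveFunction NA NB} (h : IsGaussianState D J ζ ψ) :
    ∃ (b : Modes NA NB → ℂ) (c : ℂ),
      ψ = c • gaussian (coordEquiv NA NB) (gaussianMatrix (darbouxMatrix D J)) b := by
  obtain ⟨b, hb⟩ := h.canonicalOp_inr hD hJ
  refine ⟨b, GaussianEntanglement.exists_eq_smul_gaussian
    (gaussianMatrix_transpose (darbouxMatrix_sq D hJ) (posDef_darbouxMatrix hD hJ))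
    (map_re_gaussianMatrix (posDef_darbouxMatrix hD hJ)) b ψ fun k x => ?_⟩
  rw [← hb]
  exact hasLineDerivAt_of_canonicalOp k ψ x

/-- Gaussian states stay Gaussian. -/
theorem exists_eq_smul_gaussian_of_isSchrodingerSolution {D : SplitBasis NA NB N} (hD : IsDarboux D)
    {H : QuadraticHamiltonian N} {M : ℝ → Matrix (Fin N ⊕ Fin N) (Fin N ⊕ Fin N) ℝ} (hM : IsClassicalFlow H M)
    {J : Matrix (Fin N ⊕ Fin N) (Fin N ⊕ Fin N) ℝ} (hJ : IsCompatibleComplexStructure J)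
    {ζ : Fin N ⊕ Fin N → ℝ} {ψ : ℝ → WaveFunction NA NB} (h0 : IsGaussianState D J ζ (ψ 0))
    (hψ : IsSchrodingerSolution D H ψ) {t : ℝ} (ht : 0 ≤ t) :
    ‖(ψ t).toLp 2‖ = 1 ∧ ∃ (b : Modes NA NB → ℂ) (c : ℂ), ψ t = c • gaussian (coordEquiv NA NB)
      (transport (flowMatrix D M t) (gaussianMatrix (darbouxMatrix D J))) b := by
  set Z₀ := gaussianMatrix (darbouxMatrix D J)
  have hZ : Z₀ᵀ = Z₀ := gaussianMatrix_transpose (darbouxMatrix_sq D hJ) (posDef_darbouxMatrix hD hJ)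
  have hpos : (Z₀.map Complex.re).PosDef := map_re_gaussianMatrix (posDef_darbouxMatrix hD hJ)
  obtain ⟨b₀, c₀, hc₀⟩ := h0.exists_eq_smul_gaussian hD hJ
  have hF := isLinearFlow_flowMatrix hD hM
  have hs : ∀ t, 0 ≤ t → (quadraticPart D H t)ᵀ = quadraticPart D H t := fun t ht => quadraticPart_transpose D H ht
  obtain ⟨b, hb0, hbc, hb⟩ := exists_linearPart hF hs hZ hpos b₀ (linearPart_rightContinuous D H)
    (linearPart_locallyBounded D H)
  have hpt : ∀ t, 0 ≤ t → ((transport (flowMatrix D M t) Z₀).map Complex.re).PosDef := fun t ht =>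
    posDef_re_transport (hF.symplectic hs ht) hZ hpos
  have hZt : ∀ t, 0 ≤ t → (transport (flowMatrix D M t) Z₀)ᵀ = transport (flowMatrix D M t) Z₀ := fun t ht =>
    transport_transpose (hF.symplectic hs ht) hZ hpos
  set φ : ℝ → WaveFunction NA NB := fun t =>
    gaussian (coordEquiv NA NB) (transport (flowMatrix D M t) Z₀) (b t) with hφ
  -- The scalar is merely chosen at each time; its values for `t < 0` play no role and are set to
  -- `0`.
  have hμ : ∀ t : ℝ, ∃ μ : ℂ, 0 ≤ t → HasDerivWithinAt (fun s => (φ s).toLp 2)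
      ((-Complex.I • hamiltonianOp D H t (φ t) - μ • φ t).toLp 2) (Set.Ici t) t := by
    intro t
    by_cases ht : 0 ≤ t
    · obtain ⟨μ, hμ⟩ := hamiltonianOp_gaussian (hZt t ht) (hpt t ht) (b t) D H ht
      exact ⟨μ, fun _ => hasDerivWithinAt_gaussian_toLp (coordEquiv NA NB)
        (fun s hs => hpt s (ht.trans hs)) (hasEntrywiseDeriv_transport hF hs hZ hpos ht) (hb t ht) _ hμ⟩
    · exact ⟨0, fun h => absurd h ht⟩
  choose μ hμ using hμ
  have hcont : ContinuousOn (fun t => (φ t).toLp 2) (Set.Ici 0) := by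
    intro t ht
    refine tendsto_gaussian_toLp (coordEquiv NA NB) ?_ (hpt t ht)
      (continuousOn_transport hF hs hZ hpos t ht) (hbc t ht)
    filter_upwards [self_mem_nhdsWithin] with s hs using hpt s hs
  have hφ0 : ψ 0 = c₀ • φ 0 := by
    rw [hc₀, hφ]
    simp only [hb0]
    rw [hF.init, transport_one]
  obtain ⟨h1, c, hc⟩ := exists_eq_smul_of_isSchrodingerSolution hψ
    (fun t ht => gaussian_ne_zero (hpt t ht) (b t)) hμ hcont hφ0 ht
  exact ⟨h1.trans h0.norm_eq_one, b t, c, hc⟩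

end InitialState

/-! ### Determinant inequalities and identities. -/

section RealGaussian
variable {ι : Type} [Fintype ι] [DecidableEq ι]

theorem lintegral_real_gaussian {X : Matrix ι ι ℝ} (hX : X.PosDef) (c : ι → ℝ) (A d : ℝ) (hA : 0 ≤ A) :
    ∫⁻ x, ENNReal.ofReal (A * Real.exp (-(x ⬝ᵥ X *ᵥ x) + c ⬝ᵥ x + d)) =
      ENNReal.ofReal (A * (Real.sqrt Real.pi ^ Fintype.card ι / Real.sqrt X.det) *
        Real.exp (1 / 4 * (c ⬝ᵥ (X⁻¹ *ᵥ c)) + d)) := by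
  have h1 : ∀ x : ι → ℝ, A * Real.exp (-(x ⬝ᵥ X *ᵥ x) + c ⬝ᵥ x + d) =
      (A * Real.exp d) * Real.exp (-(x ⬝ᵥ X *ᵥ x) + c ⬝ᵥ x) := fun x => by
    rw [Real.exp_add (_ + _) d]; ring
  simp_rw [h1]
  rw [← ofReal_integral_eq_lintegral_ofReal ((integrable_real_gaussian hX c).const_mul _)
    (Filter.Eventually.of_forall fun x => by positivity), integral_const_mul, integral_real_gaussian hX,
    Real.exp_add (1 / 4 * _) d]
  congr 1
  ring

theorem dotProduct_mulVec_transpose {κ : Type} [Fintype κ] (L : Matrix ι κ ℝ) (u : ι → ℝ) (v : κ → ℝ) :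
    (Lᵀ *ᵥ u) ⬝ᵥ v = u ⬝ᵥ (L *ᵥ v) := by
  rw [Matrix.mulVec_transpose, Matrix.dotProduct_mulVec]

/-- The integral of `exp (-x·Xx)` is inversely proportional to `√(det X)`, and a larger quadratic
form has a smaller integrand. -/
theorem det_le_det_of_posSemidef_sub {A B : Matrix ι ι ℝ} (hA : A.PosDef) (hAB : (B - A).PosSemidef) :
    A.det ≤ B.det := by
  have hB : B.PosDef := by simpa using hA.add_posSemidef hAB
  have h1 := integral_real_gaussian hA 0
  have h2 := integral_real_gaussian hB 0
  have h3 : ∫ x, Real.exp (-(x ⬝ᵥ B *ᵥ x) + (0 : ι → ℝ) ⬝ᵥ x) ≤ ∫ x, Real.exp (-(x ⬝ᵥ A *ᵥ x) + (0 : ι → ℝ) ⬝ᵥ x) := by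
    refine integral_mono (integrable_real_gaussian hB 0) (integrable_real_gaussian hA 0) fun x => ?_
    refine Real.exp_le_exp.2 ?_
    have := hAB.dotProduct_mulVec_nonneg x
    rw [Matrix.sub_mulVec, dotProduct_sub] at this
    simp only [star_trivial] at this
    linarith
  rw [h1, h2] at h3
  simp only [zero_dotProduct, mul_zero, Real.exp_zero, mul_one] at h3
  have hp : 0 < Real.sqrt Real.pi ^ Fintype.card ι := pow_pos (Real.sqrt_pos.2 Real.pi_pos) _
  rw [div_le_div_iff_of_pos_left hp (Real.sqrt_pos.2 hB.det_pos) (Real.sqrt_pos.2 hA.det_pos)] at h3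
  exact (Real.sqrt_le_sqrt_iff hB.det_pos.le).1 h3

variable {κ : Type} [Fintype κ] [DecidableEq κ] {S : Matrix κ κ ℝ} (hS : S.PosDef) (L : Matrix ι κ ℝ)
include hS

/-- After `S` is factored out, `det (1 + U V) = det (1 + V U)` moves the determinant from the index
type of `S` to that of the rows of `L`: later, from configurations of `B` to phase space of `A`. -/
theorem det_add_transpose_mul (s : ℝ) :
    (S + s • (Lᵀ * L)).det = S.det * (1 + s • (L * S⁻¹ * Lᵀ)).det := by
  have hu : IsUnit S.det := hS.det_pos.ne'.isUnit
  have h1 : S + s • (Lᵀ * L) = S * (1 + (s • (S⁻¹ * Lᵀ)) * L) := by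
    rw [Matrix.mul_add, Matrix.mul_one, Matrix.smul_mul, Matrix.mul_smul, ← Matrix.mul_assoc, ← Matrix.mul_assoc,
      Matrix.mul_nonsing_inv _ hu, Matrix.one_mul]
  rw [h1, Matrix.det_mul, Matrix.det_one_add_mul_comm, Matrix.mul_smul, Matrix.mul_assoc L]

theorem posSemidef_mul_inv_mul_transpose : (L * S⁻¹ * Lᵀ).PosSemidef := by
  simpa using hS.inv.posSemidef.mul_mul_conjTranspose_same L

theorem posDef_one_add {s : ℝ} (hs : 0 ≤ s) : (1 + s • (L * S⁻¹ * Lᵀ)).PosDef :=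
  Matrix.PosDef.one.add_posSemidef ((posSemidef_mul_inv_mul_transpose hS L).smul hs)

theorem posDef_add_transpose_mul {s : ℝ} (hs : 0 ≤ s) : (S + s • (Lᵀ * L)).PosDef := by
  refine hS.add_posSemidef (Matrix.PosSemidef.smul ?_ hs)
  simpa using Matrix.posSemidef_conjTranspose_mul_self L

/-- The Woodbury identity; it rewrites the exponent left by a Gaussian integral over `κ` as a
quadratic form on `ι`. -/
theorem inv_one_add {s : ℝ} (hs : 0 ≤ s) : (1 + s • (L * S⁻¹ * Lᵀ))⁻¹ =
    1 - s • (L * (S + s • (Lᵀ * L))⁻¹ * Lᵀ) := by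
  have hu : IsUnit S.det := hS.det_pos.ne'.isUnit
  set T := S + s • (Lᵀ * L) with hT
  have hTu : IsUnit T.det := (posDef_add_transpose_mul hS L hs).det_pos.ne'.isUnit
  refine Matrix.inv_eq_right_inv ?_
  have h1 : s • (S⁻¹ * (Lᵀ * L) * T⁻¹) = S⁻¹ - T⁻¹ := by
    have : s • (Lᵀ * L) = T - S := by rw [hT]; abel
    rw [← Matrix.smul_mul, ← Matrix.mul_smul, this, Matrix.mul_sub, Matrix.sub_mul, Matrix.mul_assoc,
      Matrix.mul_nonsing_inv _ hTu, Matrix.mul_one, Matrix.nonsing_inv_mul _ hu, Matrix.one_mul]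
  have h2 : (s • (L * S⁻¹ * Lᵀ)) * (s • (L * T⁻¹ * Lᵀ)) = s • (L * (s • (S⁻¹ * (Lᵀ * L) * T⁻¹)) * Lᵀ) := by
    simp only [Matrix.smul_mul, Matrix.mul_smul, Matrix.mul_assoc]
  rw [Matrix.add_mul, Matrix.mul_sub, Matrix.mul_sub, h2, h1, Matrix.one_mul, Matrix.mul_one, Matrix.one_mul,
    Matrix.mul_sub, Matrix.sub_mul, smul_sub]
  abel

end RealGaussian

/-! ### Entropy of Gaussian superpositions of coherent states. -/

section EntropyBounds
variable {E : Type} [NormedAddCommGroup E] [InnerProductSpace ℂ E] [CompleteSpace E]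
  [SecondCountableTopology E] {ι κ : Type} [Fintype ι] [DecidableEq ι] [Fintype κ] [DecidableEq κ]

/-- A family of coherent states: unit vectors `w z` labelled by `z ∈ ℝ^ι` with Gaussian overlaps,
which resolve the identity. -/
structure IsCoherentFamily (w : (ι → ℝ) → E) : Prop where
  norm_eq_one : ∀ z, ‖w z‖ = 1
  overlap : ∀ z z', ‖⟪w z, w z'⟫_ℂ‖ ^ 2 = Real.exp (-(1 / 2) * ((z - z') ⬝ᵥ (z - z')))
  measurable : ∀ f, Measurable fun z => ‖⟪w z, f⟫_ℂ‖ₑ ^ 2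
  resolution : ∀ f, ∫⁻ z, ‖⟪w z, f⟫_ℂ‖ₑ ^ 2 =
    ENNReal.ofReal (Real.sqrt (2 * Real.pi) ^ Fintype.card ι) * ‖f‖ₑ ^ 2

/-- A Gaussian superposition of coherent states. -/
structure IsGaussianSuperposition (w : (ι → ℝ) → E) (S : Matrix κ κ ℝ) (L : Matrix ι κ ℝ)
    (φ : (κ → ℝ) → E) : Prop where
  continuous : Continuous φ
  normalized : ∫⁻ y, ‖φ y‖ₑ ^ 2 = 1
  eq_smul : ∃ (C : ℝ) (y₀ : κ → ℝ) (s : ι → ℝ) (α : (κ → ℝ) → ℂ), 0 ≤ C ∧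
    (∀ y, ‖α y‖ ^ 2 = C * Real.exp (-((y - y₀) ⬝ᵥ S *ᵥ (y - y₀)))) ∧
    ∀ y, φ y = α y • w (s + L *ᵥ (y - y₀))

variable {w : (ι → ℝ) → E} (hw : IsCoherentFamily w) {S : Matrix κ κ ℝ} (hS : S.PosDef)
  {L : Matrix ι κ ℝ}

theorem ofReal_norm_sq_eq_enorm {F : Type*} [NormedAddCommGroup F] (x : F) :
    ‖x‖ₑ ^ 2 = ENNReal.ofReal (‖x‖ ^ 2) := by
  rw [ENNReal.ofReal_pow (norm_nonneg _), ofReal_norm]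

theorem normalization_const {C : ℝ} (hC : 0 ≤ C) (y₀ : κ → ℝ)
    (h : ∫⁻ y, ENNReal.ofReal (C * Real.exp (-((y - y₀) ⬝ᵥ S *ᵥ (y - y₀)))) = 1) (hS : S.PosDef) :
    C = Real.sqrt S.det / Real.sqrt Real.pi ^ Fintype.card κ := by
  have h1 := lintegral_sub_right_eq_self (μ := (volume : Measure (κ → ℝ)))
    (fun y => ENNReal.ofReal (C * Real.exp (-(y ⬝ᵥ S *ᵥ y)))) y₀
  rw [h] at h1
  have h2 := lintegral_real_gaussian hS 0 C 0 hC
  simp only [zero_dotProduct, add_zero, mul_zero, Real.exp_zero, mul_one] at h2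
  rw [h2, eq_comm, ENNReal.ofReal_eq_one] at h1
  have hp : 0 < Real.sqrt Real.pi ^ Fintype.card κ := pow_pos (Real.sqrt_pos.2 Real.pi_pos) _
  have hd := Real.sqrt_pos.2 hS.det_pos
  field_simp at h1 ⊢
  linarith

include hw hS

/-- This computes the Husimi function. The labels are Gaussian distributed around `s` with
covariance `½ L S⁻¹ Lᵀ`, and the overlap is a Gaussian with covariance `1`. Convolution adds the
covariances. -/
theorem IsGaussianSuperposition.lintegral_inner_sq {φ : (κ → ℝ) → E} (hφ : IsGaussianSuperposition w S L φ) :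
    ∃ s : ι → ℝ, ∀ z, ∫⁻ y, ‖⟪φ y, w z⟫_ℂ‖ₑ ^ 2 = ENNReal.ofReal
      ((Real.sqrt (1 + (1 / 2 : ℝ) • (L * S⁻¹ * Lᵀ)).det)⁻¹ * Real.exp (-(1 / 2) *
        ((z - s) ⬝ᵥ (1 + (1 / 2 : ℝ) • (L * S⁻¹ * Lᵀ))⁻¹ *ᵥ (z - s)))) := by
  obtain ⟨C, y₀, s, α, hC, hα, hφα⟩ := hφ.eq_smul
  have hnorm : ∀ y, ‖φ y‖ₑ ^ 2 = ENNReal.ofReal (C * Real.exp (-((y - y₀) ⬝ᵥ S *ᵥ (y - y₀)))) := fun y => by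
    rw [ofReal_norm_sq_eq_enorm, hφα, norm_smul, hw.norm_eq_one, mul_one, hα]
  have hn := hφ.normalized
  simp_rw [hnorm] at hn
  have hCe := normalization_const hC y₀ hn hS
  refine ⟨s, fun z => ?_⟩
  set T := S + (1 / 2 : ℝ) • (Lᵀ * L) with hT
  have hTp : T.PosDef := posDef_add_transpose_mul hS L (by norm_num)
  obtain ⟨δ, hδ⟩ : ∃ δ, δ = z - s := ⟨_, rfl⟩
  rw [← hδ]
  have h1 : ∀ y, ‖⟪φ y, w z⟫_ℂ‖ₑ ^ 2 = ENNReal.ofReal (C * Real.exp (-((y - y₀) ⬝ᵥ T *ᵥ (y - y₀)) +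
      (Lᵀ *ᵥ δ) ⬝ᵥ (y - y₀) + -(1 / 2) * (δ ⬝ᵥ δ))) := by
    intro y
    rw [ofReal_norm_sq_eq_enorm, hφα, inner_smul_left, norm_mul, mul_pow, RCLike.norm_conj, hα, hw.overlap, mul_assoc,
      ← Real.exp_add]
    congr 3
    obtain ⟨η, hη⟩ : ∃ η, η = y - y₀ := ⟨_, rfl⟩
    rw [← hη]
    have e1 : s + L *ᵥ η - z = L *ᵥ η - δ := by rw [hδ]; abel
    have e2 : (Lᵀ * L) *ᵥ η = Lᵀ *ᵥ (L *ᵥ η) := by rw [Matrix.mulVec_mulVec]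
    have e3 : η ⬝ᵥ (Lᵀ *ᵥ (L *ᵥ η)) = (L *ᵥ η) ⬝ᵥ (L *ᵥ η) := by
      rw [dotProduct_comm, dotProduct_mulVec_transpose]
    rw [e1, hT, Matrix.add_mulVec, Matrix.smul_mulVec, dotProduct_add, dotProduct_smul, e2, e3,
      dotProduct_mulVec_transpose, sub_dotProduct, dotProduct_sub, dotProduct_sub, dotProduct_comm (L *ᵥ η) δ,
      smul_eq_mul]
    ring
  simp_rw [h1]
  rw [lintegral_sub_right_eq_self (fun y => ENNReal.ofReal (C * Real.exp (-(y ⬝ᵥ T *ᵥ y) +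
      (Lᵀ *ᵥ δ) ⬝ᵥ y + -(1 / 2) * (δ ⬝ᵥ δ)))) y₀, lintegral_real_gaussian hTp _ _ _ hC]
  congr 1
  have hp : 0 < Real.sqrt Real.pi ^ Fintype.card κ := pow_pos (Real.sqrt_pos.2 Real.pi_pos) _
  have hd := Real.sqrt_pos.2 hS.det_pos
  have hW := Real.sqrt_pos.2 (posDef_one_add hS L (s := 1 / 2) (by norm_num)).det_pos
  congr 1
  · rw [hCe, hT, det_add_transpose_mul hS, Real.sqrt_mul hS.det_pos.le]
    field_simp
  · congr 1
    rw [inv_one_add hS L (by norm_num), ← hT, Matrix.sub_mulVec, Matrix.one_mulVec, dotProduct_sub, Matrix.smul_mulVec,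
      dotProduct_smul, ← Matrix.mulVec_mulVec, ← Matrix.mulVec_mulVec, dotProduct_mulVec_transpose,
      smul_eq_mul]
    ring

/-- This computes the purity. For two independent configurations the difference `σ` has covariance
`S⁻¹`, and the purity is the expectation of the overlap `exp (-½ |L σ|²)`. -/
theorem IsGaussianSuperposition.lintegral_lintegral_inner_sq {φ : (κ → ℝ) → E}
    (hφ : IsGaussianSuperposition w S L φ) :
    ∫⁻ y, ∫⁻ y', ‖⟪φ y', φ y⟫_ℂ‖ₑ ^ 2 = ENNReal.ofReal (Real.sqrt (1 + L * S⁻¹ * Lᵀ).det)⁻¹ := by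
  obtain ⟨C, y₀, s, α, hC, hα, hφα⟩ := hφ.eq_smul
  have hnorm : ∀ y, ‖φ y‖ₑ ^ 2 = ENNReal.ofReal (C * Real.exp (-((y - y₀) ⬝ᵥ S *ᵥ (y - y₀)))) := fun y => by
    rw [ofReal_norm_sq_eq_enorm, hφα, norm_smul, hw.norm_eq_one, mul_one, hα]
  have hn := hφ.normalized
  simp_rw [hnorm] at hn
  have hCe := normalization_const hC y₀ hn hS
  -- The integrand in the variables `η = y - y₀` and `σ = y - y'`. The `η`-integral at fixed `σ` is
  -- Gaussian with form `2 S` and leaves a Gaussian in `σ` with form `½ (S + Lᵀ L)`.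
  set f : (κ → ℝ) → (κ → ℝ) → ℝ := fun η σ => C ^ 2 * Real.exp (-(η ⬝ᵥ ((2 : ℝ) • S) *ᵥ η) +
    (((2 : ℝ) • S) *ᵥ σ) ⬝ᵥ η + (-(σ ⬝ᵥ S *ᵥ σ) - 1 / 2 * ((L *ᵥ σ) ⬝ᵥ (L *ᵥ σ)))) with hf
  have hST : Sᵀ = S := by simpa using hS.isHermitian.eq
  have h1 : ∀ y y', ‖⟪φ y', φ y⟫_ℂ‖ₑ ^ 2 = ENNReal.ofReal (f (y - y₀) (y - y')) := by
    intro y y'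
    rw [ofReal_norm_sq_eq_enorm, hφα, hφα, inner_smul_left, inner_smul_right, norm_mul, norm_mul, mul_pow, mul_pow,
      RCLike.norm_conj, hα, hα, hw.overlap]
    congr 1
    have e1 : s + L *ᵥ (y' - y₀) - (s + L *ᵥ (y - y₀)) = -(L *ᵥ (y - y')) := by
      simp only [Matrix.mulVec_sub]; abel
    have e2 : y' - y₀ = (y - y₀) - (y - y') := by abel
    rw [e1, e2]
    set η := y - y₀
    set σ := y - y'
    have e3 : σ ⬝ᵥ S *ᵥ η = η ⬝ᵥ S *ᵥ σ := by
      rw [Matrix.dotProduct_mulVec, ← Matrix.mulVec_transpose, hST, dotProduct_comm]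
    have e4 : (S *ᵥ σ) ⬝ᵥ η = η ⬝ᵥ S *ᵥ σ := dotProduct_comm _ _
    rw [hf]
    simp only [Matrix.mulVec_sub, dotProduct_sub, sub_dotProduct, Matrix.smul_mulVec, dotProduct_smul, smul_dotProduct,
      neg_dotProduct, dotProduct_neg, smul_eq_mul, e3, e4]
    rw [show ∀ a b c d e : ℝ, a * b * (a * c * d) = a ^ 2 * (b * c * d) from fun a b c d e => by ring]
    · rw [← Real.exp_add, ← Real.exp_add]
      congr 2
      ring
    · exact 0
  have hfm : Measurable fun p : (κ → ℝ) × (κ → ℝ) => ENNReal.ofReal (f p.1 p.2) := by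
    have : Continuous fun p : (κ → ℝ) × (κ → ℝ) => f p.1 p.2 := by
      simp only [hf]
      fun_prop
    exact this.measurable.ennreal_ofReal
  simp_rw [h1]
  have h2 : ∀ y, ∫⁻ y', ENNReal.ofReal (f (y - y₀) (y - y')) = ∫⁻ σ, ENNReal.ofReal (f (y - y₀) σ) := fun y =>
    lintegral_sub_left_eq_self (fun σ => ENNReal.ofReal (f (y - y₀) σ)) y
  simp_rw [h2]
  rw [lintegral_sub_right_eq_self (fun η => ∫⁻ σ, ENNReal.ofReal (f η σ)) y₀,
    lintegral_lintegral_swap hfm.aemeasurable]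
  have h2S : ((2 : ℝ) • S).PosDef := hS.smul (by norm_num)
  set T := S + (1 : ℝ) • (Lᵀ * L) with hT
  have hTp : T.PosDef := posDef_add_transpose_mul hS L (by norm_num)
  have h3 : ∀ σ, ∫⁻ η, ENNReal.ofReal (f η σ) = ENNReal.ofReal
      (C ^ 2 * (Real.sqrt Real.pi ^ Fintype.card κ / Real.sqrt ((2 : ℝ) • S).det) *
        Real.exp (-(σ ⬝ᵥ ((1 / 2 : ℝ) • T) *ᵥ σ) + (0 : κ → ℝ) ⬝ᵥ σ + 0)) := by
    intro σ
    rw [lintegral_real_gaussian h2S _ _ _ (by positivity)]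
    congr 3
    have e2 : (Lᵀ * L) *ᵥ σ = Lᵀ *ᵥ (L *ᵥ σ) := by rw [Matrix.mulVec_mulVec]
    have e3 : σ ⬝ᵥ (Lᵀ *ᵥ (L *ᵥ σ)) = (L *ᵥ σ) ⬝ᵥ (L *ᵥ σ) := by
      rw [dotProduct_comm, dotProduct_mulVec_transpose]
    rw [Matrix.mulVec_mulVec, Matrix.nonsing_inv_mul _ h2S.det_pos.ne'.isUnit, Matrix.one_mulVec, hT]
    simp only [Matrix.smul_mulVec, Matrix.add_mulVec, dotProduct_add, dotProduct_smul, smul_dotProduct, one_smul, e2, e3,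
      zero_dotProduct, smul_eq_mul, dotProduct_comm (S *ᵥ σ) σ]
    ring
  simp_rw [h3]
  have h2T : ((1 / 2 : ℝ) • T).PosDef := hTp.smul (by norm_num)
  rw [lintegral_real_gaussian h2T _ _ _ (by positivity)]
  congr 1
  have hp : 0 < Real.sqrt Real.pi ^ Fintype.card κ := pow_pos (Real.sqrt_pos.2 Real.pi_pos) _
  have hd := Real.sqrt_pos.2 hS.det_pos
  have hTd := Real.sqrt_pos.2 hTp.det_pos
  have h4 : Real.sqrt ((2 : ℝ) • S).det * Real.sqrt ((1 / 2 : ℝ) • T).det = Real.sqrt S.det * Real.sqrt T.det := by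
    rw [← Real.sqrt_mul h2S.det_pos.le, ← Real.sqrt_mul hS.det_pos.le, Matrix.det_smul, Matrix.det_smul]
    congr 1
    rw [mul_mul_mul_comm, ← mul_pow]
    norm_num
  have h5 : Real.sqrt T.det = Real.sqrt S.det * Real.sqrt (1 + L * S⁻¹ * Lᵀ).det := by
    rw [hT, det_add_transpose_mul hS, Real.sqrt_mul hS.det_pos.le, one_smul]
  simp only [zero_dotProduct, mul_zero, add_zero, Real.exp_zero, mul_one]
  have h6 : Real.sqrt (1 + L * S⁻¹ * Lᵀ).det ≠ 0 := fun h => by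
    rw [h, mul_zero] at h5
    exact hTd.ne' h5
  rw [mul_assoc, div_mul_div_comm, h4, h5, hCe]
  field_simp

theorem IsGaussianSuperposition.le_vonNeumannEntropy {φ : (κ → ℝ) → E} (hφ : IsGaussianSuperposition w S L φ)
    {ρ : E →L[ℂ] E} (hρ0 : 0 ≤ ρ)
    (hρ : ∀ f, ENNReal.ofReal (RCLike.re ⟪f, ρ f⟫_ℂ) = ∫⁻ y, ‖⟪φ y, f⟫_ℂ‖ₑ ^ 2) :
    ENNReal.ofReal (1 / 2 * Real.log (1 + L * S⁻¹ * Lᵀ).det) ≤ vonNeumannEntropy ρ := by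
  have hK : (1 + L * S⁻¹ * Lᵀ).PosDef := by simpa using posDef_one_add hS L (s := 1) zero_le_one
  have hK1 : 1 ≤ (1 + L * S⁻¹ * Lᵀ).det := by
    have := det_le_det_of_posSemidef_sub (B := 1 + L * S⁻¹ * Lᵀ) (Matrix.PosDef.one (n := ι) (R := ℝ))
      (by simpa using posSemidef_mul_inv_mul_transpose hS L)
    simpa using this
  have h := ofReal_neg_log_le_vonNeumannEntropy hρ0 (fun f => measurable_enorm_inner hφ.continuous f) hρ hφ.normalized
    (c := (Real.sqrt (1 + L * S⁻¹ * Lᵀ).det)⁻¹) (inv_pos.2 (Real.sqrt_pos.2 hK.det_pos))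
    (inv_le_one_of_one_le₀ (Real.one_le_sqrt.2 hK1)) (hφ.lintegral_lintegral_inner_sq hw hS).le
  rwa [Real.log_inv, neg_neg, Real.log_sqrt hK.det_pos.le, div_eq_inv_mul, ← one_div] at h

/-- The trace of `-ρ log ρ` is bounded by its integral over coherent states, and at each of them the
affine bound on `-x log x` is used with its own slope. The Husimi function is Gaussian with
covariance `W = 1 + ½ L S⁻¹ Lᵀ`, which lies below `1 + L S⁻¹ Lᵀ`, so its Wehrl entropy is controlled
by the stated determinant. -/
theorem IsGaussianSuperposition.vonNeumannEntropy_le {φ : (κ → ℝ) → E} (hφ : IsGaussianSuperposition w S L φ)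
    {ρ : E →L[ℂ] E} (hρ0 : 0 ≤ ρ) (hρ1 : ‖ρ‖ ≤ 1)
    (hρ : ∀ f, ENNReal.ofReal (RCLike.re ⟪f, ρ f⟫_ℂ) = ∫⁻ y, ‖⟪φ y, f⟫_ℂ‖ₑ ^ 2) :
    vonNeumannEntropy ρ ≤ ENNReal.ofReal (1 / 2 * Real.log (1 + L * S⁻¹ * Lᵀ).det +
      (1 + Real.sqrt 2 ^ Fintype.card ι)) := by
  obtain ⟨s, hs⟩ := hφ.lintegral_inner_sq hw hS
  set W := 1 + (1 / 2 : ℝ) • (L * S⁻¹ * Lᵀ) with hW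
  have hWp : W.PosDef := posDef_one_add hS L (by norm_num)
  have hWd := Real.sqrt_pos.2 hWp.det_pos
  have hPSD := posSemidef_mul_inv_mul_transpose hS L
  have hW1 : 1 ≤ W.det := by
    have := det_le_det_of_posSemidef_sub (B := W) (Matrix.PosDef.one (n := ι) (R := ℝ))
      (by rw [hW, add_sub_cancel_left]; exact hPSD.smul (by norm_num))
    simpa using this
  have hWK : W.det ≤ (1 + L * S⁻¹ * Lᵀ).det := by
    refine det_le_det_of_posSemidef_sub hWp ?_
    have : 1 + L * S⁻¹ * Lᵀ - W = (1 / 2 : ℝ) • (L * S⁻¹ * Lᵀ) := by rw [hW]; module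
    rw [this]
    exact hPSD.smul (by norm_num)
  set q : (ι → ℝ) → ℝ := fun z => 1 / 2 * (z ⬝ᵥ W⁻¹ *ᵥ z) with hq
  have hq0 : ∀ z, 0 ≤ q z := fun z => by
    have := hWp.inv.posSemidef.dotProduct_mulVec_nonneg z
    simp only [star_trivial] at this
    simp only [hq]; positivity
  set a := (Real.sqrt W.det)⁻¹ with ha
  have ha0 : 0 < a := inv_pos.2 hWd
  have hla : -Real.log a = 1 / 2 * Real.log W.det := by
    rw [ha, Real.log_inv, neg_neg, Real.log_sqrt hWp.det_pos.le]; ring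
  have hre : ∀ z, RCLike.re ⟪w z, ρ (w z)⟫_ℂ = a * Real.exp (-q (z - s)) := by
    intro z
    have h1 := (hρ (w z)).trans (hs z)
    have h2 := ((ContinuousLinearMap.nonneg_iff_isPositive ρ).1 hρ0).re_inner_nonneg_right (w z)
    rw [ENNReal.ofReal_eq_ofReal_iff h2 (by positivity)] at h1
    rw [h1, hq]
    congr 2
    ring
  set k0 := 1 / 2 * Real.log W.det with hk0
  have hk00 : 0 ≤ k0 := mul_nonneg (by norm_num) (Real.log_nonneg hW1)
  have hpt : ∀ z, RCLike.re ⟪w z, cfc Real.negMulLog ρ (w z)⟫_ℂ ≤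
      (k0 + 1) * a * Real.exp (-q (z - s)) + a * Real.exp (-(1 / 2) * q (z - s)) := by
    intro z
    -- The slope is minus the logarithm of the Husimi function at `z`, so the intercept `exp (-k)`
    -- is the Husimi function itself.
    have h1 := inner_negMulLog_le hρ0 (k0 + q (z - s)) (w z)
    rw [hw.norm_eq_one, hre] at h1
    have h2 : Real.exp (-(k0 + q (z - s))) = a * Real.exp (-q (z - s)) := by
      rw [neg_add, Real.exp_add, ← hla, neg_neg, Real.exp_log ha0]
    rw [h2] at h1
    -- This crude bound keeps the remaining integrand a pure Gaussian; its doubled covariance is the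
    -- source of the constant `√2 ^ card ι`.
    have h3 : q (z - s) * Real.exp (-q (z - s)) ≤ Real.exp (-(1 / 2) * q (z - s)) := by
      set t := q (z - s)
      have ht : 0 ≤ t := hq0 _
      have h4 : t ≤ Real.exp (1 / 2 * t) := by
        have h5 := Real.add_one_le_exp (1 / 4 * t)
        have h6 : Real.exp (1 / 2 * t) = Real.exp (1 / 4 * t) ^ 2 := by
          rw [← Real.exp_nat_mul]; congr 1; push_cast; ring
        rw [h6]
        nlinarith [sq_nonneg (1 - 1 / 4 * t)]
      calc t * Real.exp (-t) ≤ Real.exp (1 / 2 * t) * Real.exp (-t) := by gcongr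
        _ = _ := by rw [← Real.exp_add]; congr 1; ring
    nlinarith [mul_le_mul_of_nonneg_left h3 ha0.le]
  have hgauss : ∀ r : ℝ, 0 < r → ∀ A : ℝ, 0 ≤ A →
      ∫⁻ z, ENNReal.ofReal (A * Real.exp (-r * q (z - s))) = ENNReal.ofReal
        (A * (Real.sqrt Real.pi ^ Fintype.card ι / Real.sqrt ((r / 2) ^ Fintype.card ι * W.det⁻¹))) := by
    intro r hr A hA
    have hX : ((r / 2) • W⁻¹).PosDef := hWp.inv.smul (by positivity)
    have h1 := lintegral_real_gaussian hX 0 A 0 hA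
    simp only [zero_dotProduct, add_zero, mul_zero, Real.exp_zero, mul_one, Matrix.det_smul, Matrix.det_nonsing_inv,
      Ring.inverse_eq_inv'] at h1
    rw [← h1, lintegral_sub_right_eq_self (fun z => ENNReal.ofReal (A * Real.exp (-r * q z))) s]
    refine lintegral_congr fun z => ?_
    congr 3
    rw [hq, Matrix.smul_mulVec, dotProduct_smul, smul_eq_mul]
    ring
  set c := Real.sqrt (2 * Real.pi) ^ Fintype.card ι with hc
  have hc0 : 0 < c := pow_pos (Real.sqrt_pos.2 (by positivity)) _
  -- Rescaling Lebesgue measure turns the resolution of the identity into a Parseval frame; the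
  -- Husimi function then has total mass `1`.
  set ν : Measure (ι → ℝ) := (ENNReal.ofReal c)⁻¹ • volume with hν
  have hres : ∀ f, ∫⁻ z, ‖⟪w z, f⟫_ℂ‖ₑ ^ 2 ∂ν = ‖f‖ₑ ^ 2 := by
    intro f
    rw [hν, lintegral_smul_measure, hw.resolution, smul_eq_mul, ← mul_assoc,
      ENNReal.inv_mul_cancel (by simpa using hc0) ENNReal.ofReal_ne_top, one_mul]
  have hmain := traceOfPositive_le_lintegral (ν := ν) (fun f => (hw.measurable f).aemeasurable) hres
    (cfc_negMulLog_nonneg hρ0 hρ1)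
  refine hmain.trans ?_
  rw [hν, lintegral_smul_measure, smul_eq_mul]
  have hint : ∫⁻ z, ENNReal.ofReal (RCLike.re ⟪w z, cfc Real.negMulLog ρ (w z)⟫_ℂ) ≤
      ENNReal.ofReal (c * (k0 + 1 + Real.sqrt 2 ^ Fintype.card ι)) := by
    have hmeas : Measurable fun z => ENNReal.ofReal ((k0 + 1) * a * Real.exp (-1 * q (z - s))) := by
      have : Continuous fun z => (k0 + 1) * a * Real.exp (-1 * q (z - s)) := by
        simp only [hq]; fun_prop
      exact this.measurable.ennreal_ofReal
    calc _ ≤ ∫⁻ z, (ENNReal.ofReal ((k0 + 1) * a * Real.exp (-1 * q (z - s))) +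
          ENNReal.ofReal (a * Real.exp (-(1 / 2) * q (z - s)))) := by
          refine lintegral_mono fun z => ?_
          refine (ENNReal.ofReal_le_ofReal (hpt z)).trans ?_
          rw [← ENNReal.ofReal_add (by positivity) (by positivity)]
          simp
      _ = _ := by
          rw [lintegral_add_left hmeas, hgauss 1 one_pos _ (by positivity), hgauss (1 / 2) (by norm_num) _ ha0.le,
            ← ENNReal.ofReal_add (by positivity) (by positivity)]
          congr 1
          have e1 : ∀ r : ℝ, 0 < r → Real.sqrt ((r / 2) ^ Fintype.card ι * W.det⁻¹) =
              Real.sqrt (r / 2) ^ Fintype.card ι * (Real.sqrt W.det)⁻¹ := by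
            intro r hr
            rw [Real.sqrt_mul (by positivity), Real.sqrt_inv]
            congr 1
            rw [Real.sqrt_eq_iff_mul_self_eq (by positivity) (by positivity), ← mul_pow, Real.mul_self_sqrt (by positivity)]
          rw [e1 1 one_pos, e1 (1 / 2) (by norm_num), ha, hc, Real.sqrt_mul (by norm_num)]
          have e2 : Real.sqrt (1 / 2) = (Real.sqrt 2)⁻¹ := by rw [one_div, Real.sqrt_inv]
          have e3 : Real.sqrt (1 / 2 / 2) = 1 / 2 := by
            rw [Real.sqrt_eq_iff_mul_self_eq (by norm_num) (by norm_num)]; norm_num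
          have e4 : (2 : ℝ) ^ Fintype.card ι = Real.sqrt 2 ^ Fintype.card ι * Real.sqrt 2 ^ Fintype.card ι := by
            rw [← mul_pow, Real.mul_self_sqrt (by norm_num)]
          rw [e2, e3, mul_pow, inv_pow, one_div_pow]
          have h2 : Real.sqrt 2 ^ Fintype.card ι ≠ 0 := by positivity
          field_simp
          rw [e4]
          ring
  calc _ ≤ (ENNReal.ofReal c)⁻¹ * ENNReal.ofReal (c * (k0 + 1 + Real.sqrt 2 ^ Fintype.card ι)) := by gcongr
    _ = ENNReal.ofReal (k0 + 1 + Real.sqrt 2 ^ Fintype.card ι) := by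
        rw [ENNReal.ofReal_mul hc0.le, ← mul_assoc, ENNReal.inv_mul_cancel (by simpa using hc0)
          ENNReal.ofReal_ne_top, one_mul]
    _ ≤ _ := by
        refine ENNReal.ofReal_le_ofReal ?_
        have := Real.log_le_log hWp.det_pos hWK
        rw [hk0]
        linarith

end EntropyBounds

/-! ### Extending a resolution of the identity from a dense set. -/

section Resolution
variable {E : Type*} [NormedAddCommGroup E] [InnerProductSpace ℂ E]
  {Z : Type*} [MeasurableSpace Z] {ν : Measure Z} {w : Z → E}

/-- A resolution of the identity may be tested on a dense set. -/
theorem lintegral_inner_sq_eq_of_dense (hm : ∀ f, Measurable fun z => ⟪w z, f⟫_ℂ) (c : ℝ≥0∞)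
    (hc : c ≠ ⊤) {s : Set E} (hs : Dense s)
    (h : ∀ f ∈ s, ∫⁻ z, ‖⟪w z, f⟫_ℂ‖ₑ ^ 2 ∂ν = c ^ 2 * ‖f‖ₑ ^ 2) (f : E) :
    ∫⁻ z, ‖⟪w z, f⟫_ℂ‖ₑ ^ 2 ∂ν = c ^ 2 * ‖f‖ₑ ^ 2 := by
  have hL : ∀ g, eLpNorm (fun z => ⟪w z, g⟫_ℂ) 2 ν ^ 2 = ∫⁻ z, ‖⟪w z, g⟫_ℂ‖ₑ ^ 2 ∂ν := fun g => by
    simpa using eLpNorm_nnreal_pow_eq_lintegral (μ := ν) (f := fun z => ⟪w z, g⟫_ℂ) (p := 2) two_ne_zero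
  have hsL : ∀ g ∈ s, eLpNorm (fun z => ⟪w z, g⟫_ℂ) 2 ν = c * ‖g‖ₑ := fun g hg => by
    have := (hL g).trans (h g hg)
    rw [← mul_pow] at this
    exact (ENNReal.pow_right_strictMono two_ne_zero).injective this
  -- Fatou's lemma along a sequence from the dense set gives one inequality for every vector.
  have hupper : ∀ g, eLpNorm (fun z => ⟪w z, g⟫_ℂ) 2 ν ≤ c * ‖g‖ₑ := by
    intro g
    obtain ⟨u, hu, hlim⟩ := mem_closure_iff_seq_limit.1 (hs g)
    have h1 : ∀ z, Filter.Tendsto (fun k => ‖⟪w z, u k⟫_ℂ‖ₑ ^ 2) Filter.atTop (𝓝 (‖⟪w z, g⟫_ℂ‖ₑ ^ 2)) :=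
      fun z => (ENNReal.continuous_pow 2).tendsto _ |>.comp (tendsto_const_nhds.inner hlim).enorm
    have h2 := lintegral_liminf_le (μ := ν) (u := Filter.atTop) (f := fun k z => ‖⟪w z, u k⟫_ℂ‖ₑ ^ 2)
      fun k => ((hm (u k)).enorm.pow_const 2)
    simp_rw [fun z => (h1 z).liminf_eq, fun k => h (u k) (hu k)] at h2
    have h3 : Filter.Tendsto (fun k => c ^ 2 * ‖u k‖ₑ ^ 2) Filter.atTop (𝓝 (c ^ 2 * ‖g‖ₑ ^ 2)) :=
      ENNReal.Tendsto.const_mul ((ENNReal.continuous_pow 2).tendsto _ |>.comp hlim.enorm)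
        (Or.inr (ENNReal.pow_ne_top hc))
    rw [h3.liminf_eq, ← hL, ← mul_pow] at h2
    exact (ENNReal.pow_right_strictMono two_ne_zero).le_iff_le.1 h2
  obtain ⟨u, hu, hlim⟩ := mem_closure_iff_seq_limit.1 (hs f)
  -- The reverse inequality follows from Minkowski's inequality, where the error `u k - f` is
  -- controlled by `hupper`.
  have hlower : c * ‖f‖ₑ ≤ eLpNorm (fun z => ⟪w z, f⟫_ℂ) 2 ν := by
    have h1 : ∀ k, c * ‖u k‖ₑ ≤ eLpNorm (fun z => ⟪w z, f⟫_ℂ) 2 ν + c * ‖u k - f‖ₑ := by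
      intro k
      rw [← hsL _ (hu k)]
      have h2 : (fun z => ⟪w z, u k⟫_ℂ) = (fun z => ⟪w z, f⟫_ℂ) + fun z => ⟪w z, u k - f⟫_ℂ := by
        funext z
        simp
      rw [h2]
      exact (eLpNorm_add_le (hm f).aestronglyMeasurable (hm _).aestronglyMeasurable one_le_two).trans
        (by gcongr; exact hupper _)
    have h3 : Filter.Tendsto (fun k => c * ‖u k‖ₑ) Filter.atTop (𝓝 (c * ‖f‖ₑ)) :=
      ENNReal.Tendsto.const_mul hlim.enorm (Or.inr hc)
    have h4 : Filter.Tendsto (fun k => eLpNorm (fun z => ⟪w z, f⟫_ℂ) 2 ν + c * ‖u k - f‖ₑ) Filter.atTop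
        (𝓝 (eLpNorm (fun z => ⟪w z, f⟫_ℂ) 2 ν + c * 0)) := by
      refine tendsto_const_nhds.add (ENNReal.Tendsto.const_mul ?_ (Or.inr hc))
      have : Filter.Tendsto (fun k => u k - f) Filter.atTop (𝓝 0) := by simpa using hlim.sub_const f
      simpa using this.enorm
    rw [mul_zero, add_zero] at h4
    exact le_of_tendsto_of_tendsto' h3 h4 h1
  rw [← hL, le_antisymm (hupper f) hlower, mul_pow]

end Resolution

/-! ### Gaussian windows as coherent states. -/

section Windows
variable {n : ℕ}

theorem lintegral_comp_mulVec {ι : Type} [Fintype ι] [DecidableEq ι] {B : Matrix ι ι ℝ} (hB : B.det ≠ 0)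
    (f : (ι → ℝ) → ℝ≥0∞) :
    ∫⁻ x, f (B *ᵥ x) = ENNReal.ofReal |B.det|⁻¹ * ∫⁻ x, f x := by
  have h := Real.map_matrix_volume_pi_eq_smul_volume_pi hB
  have h2 := (measurableEmbedding_mulVec hB).lintegral_map (μ := volume) f
  rw [h, lintegral_smul_measure, abs_inv] at h2
  exact h2.symm

theorem lintegral_config (f : (Fin n → ℝ) → ℝ≥0∞) :
    ∫⁻ x : Config n, f (WithLp.ofLp x) = ∫⁻ x, f x :=
  (PiLp.volume_preserving_ofLp (Fin n)).lintegral_comp_emb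
    (MeasurableEquiv.toLp 2 (Fin n → ℝ)).symm.measurableEmbedding f

theorem integral_config (f : (Fin n → ℝ) → ℂ) : ∫ x : Config n, f (WithLp.ofLp x) = ∫ x, f x :=
  (PiLp.volume_preserving_ofLp (Fin n)).integral_comp
    (MeasurableEquiv.toLp 2 (Fin n → ℝ)).symm.measurableEmbedding f

theorem lintegral_sum_pi {α β : Type} [Fintype α] [Fintype β] {f : (α ⊕ β → ℝ) → ℝ≥0∞} (hf : Measurable f) :
    ∫⁻ z, f z = ∫⁻ p : α → ℝ, ∫⁻ q : β → ℝ, f (Sum.elim p q) := by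
  have h := (volume_measurePreserving_sumPiEquivProdPi (fun _ : α ⊕ β => ℝ)).symm
  have h1 := h.lintegral_comp hf
  rw [← h1]
  have hm : Measurable fun a : (α → ℝ) × (β → ℝ) =>
      f ((MeasurableEquiv.sumPiEquivProdPi fun _ : α ⊕ β => ℝ).symm a) :=
    hf.comp (MeasurableEquiv.measurable _)
  refine (lintegral_prod _ hm.aemeasurable).trans ?_
  refine lintegral_congr fun p => lintegral_congr fun q => ?_
  rfl

/-- The coordinates of the configuration space of `n` modes. -/
abbrev modeEquiv (n : ℕ) : Config n ≃L[ℝ] (Fin n → ℝ) := EuclideanSpace.equiv (Fin n) ℝ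

theorem conj_gaussianExponent_add {ι : Type} [Fintype ι] (Z : Matrix ι ι ℂ) (a a' : ι → ℂ) (x : ι → ℝ) :
    (starRingEnd ℂ) (gaussianExponent Z a x) + gaussianExponent Z a' x =
      -((x ⬝ᵥ Z.map Complex.re *ᵥ x : ℝ) : ℂ) + ∑ i, ((starRingEnd ℂ) (a i) + a' i) * x i := by
  have h1 : (starRingEnd ℂ) (∑ i, ∑ j, Z i j * x i * x j) + ∑ i, ∑ j, Z i j * x i * x j =
      2 * ((x ⬝ᵥ Z.map Complex.re *ᵥ x : ℝ) : ℂ) := by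
    simp only [dotProduct, Matrix.mulVec, Matrix.map_apply, map_sum, map_mul, Complex.conj_ofReal,
      Complex.ofReal_sum, Complex.ofReal_mul, Finset.mul_sum, ← Finset.sum_add_distrib]
    refine Finset.sum_congr rfl fun i _ => Finset.sum_congr rfl fun j _ => ?_
    have := Complex.add_conj (Z i j)
    push_cast at this
    linear_combination (x i : ℂ) * x j * this
  simp only [gaussianExponent, map_add, map_mul, map_neg, map_sum, Complex.conj_ofReal, add_mul,
    Finset.sum_add_distrib, map_div₀, map_one, map_ofNat] at h1 ⊢
  linear_combination (-(1 / 2) : ℂ) * h1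

theorem integral_conj_gaussian_mul {Z : Matrix (Fin n) (Fin n) ℂ} (hpos : (Z.map Complex.re).PosDef)
    (a a' : Fin n → ℂ) :
    ∫ x, (starRingEnd ℂ) (gaussian (modeEquiv n) Z a x) * gaussian (modeEquiv n) Z a' x =
      ((Real.sqrt Real.pi ^ n / Real.sqrt (Z.map Complex.re).det : ℝ) : ℂ) *
        Complex.exp (1 / 4 * ((fun i => (starRingEnd ℂ) (a i) + a' i) ⬝ᵥ
          ((Z.map Complex.re)⁻¹.map Complex.ofReal *ᵥ fun i => (starRingEnd ℂ) (a i) + a' i))) := by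
  have h := integral_gaussian hpos fun i => (starRingEnd ℂ) (a i) + a' i
  rw [Fintype.card_fin] at h
  rw [← h, ← integral_config]
  congr 1
  funext x
  rw [gaussian_apply _ hpos, gaussian_apply _ hpos, ← Complex.exp_conj, ← Complex.exp_add,
    conj_gaussianExponent_add]
  rfl

/-- The linear coefficient of the window labelled by `z = (p, q)`. -/
def windowParameter (B : Matrix (Fin n) (Fin n) ℝ) (z : Fin n ⊕ Fin n → ℝ) : Fin n → ℂ :=
  (Bᵀ).map Complex.ofReal *ᵥ fun k => (z (Sum.inl k) : ℂ) + Complex.I * z (Sum.inr k)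

/-- The modulus of the normalization constant of the windows. -/
def windowConst (B : Matrix (Fin n) (Fin n) ℝ) (p : Fin n → ℝ) : ℝ :=
  Real.sqrt (|B.det| / Real.sqrt Real.pi ^ n) * Real.exp (-(1 / 2) * (p ⬝ᵥ p))

/-- The normalized Gaussian windows. -/
def window (B : Matrix (Fin n) (Fin n) ℝ) (Z : Matrix (Fin n) (Fin n) ℂ) (z : Fin n ⊕ Fin n → ℝ) :
    𝓢(Config n, ℂ) :=
  (windowConst B (fun k => z (Sum.inl k)) : ℂ) • gaussian (modeEquiv n) Z (windowParameter B z)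

theorem windowConst_sq (B : Matrix (Fin n) (Fin n) ℝ) (p : Fin n → ℝ) :
    windowConst B p ^ 2 = |B.det| / Real.sqrt Real.pi ^ n * Real.exp (-(p ⬝ᵥ p)) := by
  rw [windowConst, mul_pow, Real.sq_sqrt (by positivity), ← Real.exp_nat_mul]
  congr 2
  push_cast
  ring

theorem windowConst_pos {B : Matrix (Fin n) (Fin n) ℝ} (hB : B.det ≠ 0) (p : Fin n → ℝ) :
    0 < windowConst B p := by
  have : 0 < |B.det| := abs_pos.2 hB
  have : 0 < Real.sqrt Real.pi := Real.sqrt_pos.2 Real.pi_pos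
  rw [windowConst]
  positivity

variable {B : Matrix (Fin n) (Fin n) ℝ} {Z : Matrix (Fin n) (Fin n) ℂ} (hB : B.det ≠ 0)
  (hpos : (Z.map Complex.re).PosDef) (hZB : Z.map Complex.re = Bᵀ * B)
include hB hpos hZB

theorem sqrt_det_eq_abs_det : Real.sqrt (Z.map Complex.re).det = |B.det| := by
  rw [hZB, Matrix.det_mul, Matrix.det_transpose, Real.sqrt_mul_self_eq_abs]

/-- The linear coefficient `Bᵀ (p + i q)` is adapted to `Re Z = Bᵀ B`: the inverse form in the
Gaussian integral becomes a plain sum of squares, and `Im Z` drops out. All families of windows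
therefore have the overlaps of standard coherent states. -/
theorem inner_window (z z' : Fin n ⊕ Fin n → ℝ) :
    ⟪(window B Z z).toLp 2 (volume : Measure (Config n)), (window B Z z').toLp 2 volume⟫_ℂ =
      ((windowConst B (fun k => z (Sum.inl k)) * windowConst B (fun k => z' (Sum.inl k)) *
        (Real.sqrt Real.pi ^ n / |B.det|) : ℝ) : ℂ) * Complex.exp (1 / 4 *
          ∑ k, ((z (Sum.inl k) + z' (Sum.inl k) : ℂ) + Complex.I * (z' (Sum.inr k) - z (Sum.inr k))) ^ 2) := by
  have h0 : ⟪(window B Z z).toLp 2 (volume : Measure (Config n)), (window B Z z').toLp 2 volume⟫_ℂ =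
      ∫ x, ((windowConst B (fun k => z (Sum.inl k)) * windowConst B (fun k => z' (Sum.inl k)) : ℝ) : ℂ) *
      ((starRingEnd ℂ) (gaussian (modeEquiv n) Z (windowParameter B z) x) *
        gaussian (modeEquiv n) Z (windowParameter B z') x) := by
    refine (SchwartzMap.inner_toL2_toL2_eq _ _ volume).trans ?_
    congr 1
    funext x
    simp only [window, _root_.smul_apply, smul_eq_mul, RCLike.inner_apply, map_mul, Complex.conj_ofReal,
      Complex.ofReal_mul]
    ring
  rw [h0, integral_const_mul, integral_conj_gaussian_mul hpos, sqrt_det_eq_abs_det hB hpos hZB, ← mul_assoc]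
  have hu : IsUnit B.det := hB.isUnit
  have huT : IsUnit Bᵀ.det := by rwa [Matrix.det_transpose]
  set γ : Fin n → ℂ := fun k => (z (Sum.inl k) + z' (Sum.inl k) : ℂ) + Complex.I * (z' (Sum.inr k) - z (Sum.inr k))
  have h1 : (fun i => (starRingEnd ℂ) (windowParameter B z i) + windowParameter B z' i) =
      Bᵀ.map Complex.ofReal *ᵥ γ := by
    funext i
    simp only [windowParameter, Matrix.mulVec, dotProduct, map_sum, map_mul, Matrix.map_apply, Complex.conj_ofReal,
      ← Finset.sum_add_distrib, map_add, Complex.conj_I]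
    refine Finset.sum_congr rfl fun k _ => ?_
    ring
  have h2 : (Z.map Complex.re)⁻¹.map Complex.ofReal *ᵥ (Bᵀ.map Complex.ofReal *ᵥ γ) =
      (B⁻¹).map Complex.ofReal *ᵥ γ := by
    rw [Matrix.mulVec_mulVec, ← map_ofReal_mul, hZB, Matrix.mul_inv_rev, Matrix.mul_assoc,
      Matrix.nonsing_inv_mul _ huT, Matrix.mul_one]
  have h3 : (Bᵀ.map Complex.ofReal *ᵥ γ) ⬝ᵥ ((B⁻¹).map Complex.ofReal *ᵥ γ) = ∑ k, γ k ^ 2 := by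
    rw [Matrix.transpose_map, Matrix.mulVec_transpose, ← Matrix.dotProduct_mulVec, Matrix.mulVec_mulVec,
      ← map_ofReal_mul, Matrix.mul_nonsing_inv _ hu]
    have : (1 : Matrix (Fin n) (Fin n) ℝ).map Complex.ofReal = 1 := by
      ext i j; simp [Matrix.one_apply, apply_ite]
    rw [this, Matrix.one_mulVec, dotProduct]
    exact Finset.sum_congr rfl fun k _ => (sq _).symm
  rw [h1, h2, h3]
  push_cast
  ring

theorem norm_inner_window_sq (z z' : Fin n ⊕ Fin n → ℝ) :
    ‖⟪(window B Z z).toLp 2 (volume : Measure (Config n)), (window B Z z').toLp 2 volume⟫_ℂ‖ ^ 2 =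
      Real.exp (-(1 / 2) * ((z - z') ⬝ᵥ (z - z'))) := by
  have hB' : 0 < |B.det| := abs_pos.2 hB
  have hp : 0 < Real.sqrt Real.pi ^ n := pow_pos (Real.sqrt_pos.2 Real.pi_pos) _
  rw [inner_window hB hpos hZB, norm_mul, Complex.norm_real, Real.norm_eq_abs, mul_pow, sq_abs, mul_pow, mul_pow,
    windowConst_sq, windowConst_sq, Complex.norm_exp, ← Real.exp_nat_mul]
  have h1 : |B.det| / Real.sqrt Real.pi ^ n * Real.exp (-((fun k => z (Sum.inl k)) ⬝ᵥ fun k => z (Sum.inl k))) *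
      (|B.det| / Real.sqrt Real.pi ^ n * Real.exp (-((fun k => z' (Sum.inl k)) ⬝ᵥ fun k => z' (Sum.inl k)))) *
      (Real.sqrt Real.pi ^ n / |B.det|) ^ 2 =
      Real.exp (-((fun k => z (Sum.inl k)) ⬝ᵥ fun k => z (Sum.inl k)) +
        -((fun k => z' (Sum.inl k)) ⬝ᵥ fun k => z' (Sum.inl k))) := by
    rw [Real.exp_add]
    field_simp
  rw [h1, ← Real.exp_add]
  congr 1
  have h2 : ∀ k, (((z (Sum.inl k) + z' (Sum.inl k) : ℂ) + Complex.I * (z' (Sum.inr k) - z (Sum.inr k))) ^ 2).re =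
      (z (Sum.inl k) + z' (Sum.inl k)) ^ 2 - (z' (Sum.inr k) - z (Sum.inr k)) ^ 2 := fun k => by
    simp [sq]
  have h3 : (1 / 4 * ∑ k, ((z (Sum.inl k) + z' (Sum.inl k) : ℂ) + Complex.I * (z' (Sum.inr k) - z (Sum.inr k))) ^ 2).re =
      1 / 4 * ∑ k, ((z (Sum.inl k) + z' (Sum.inl k)) ^ 2 - (z' (Sum.inr k) - z (Sum.inr k)) ^ 2) := by
    simp_rw [← h2, ← Complex.re_sum]
    rw [← Complex.re_ofReal_mul]
    push_cast
    rfl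
  rw [h3]
  simp only [dotProduct, Fintype.sum_sum_type, Pi.sub_apply, mul_add, Finset.mul_sum, ← Finset.sum_neg_distrib,
    ← Finset.sum_add_distrib]
  refine Finset.sum_congr rfl fun k _ => ?_
  push_cast
  ring

theorem continuous_window : Continuous fun z => (window B Z z).toLp 2 (volume : Measure (Config n)) := by
  have h : ∀ z, (window B Z z).toLp 2 (volume : Measure (Config n)) =
      (windowConst B (fun k => z (Sum.inl k)) : ℂ) •
        (gaussian (modeEquiv n) Z (windowParameter B z)).toLp 2 (volume : Measure (Config n)) := fun z =>
    (SchwartzMap.toLpCLM ℂ ℂ 2 (volume : Measure (Config n))).map_smul _ _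
  simp_rw [h]
  have h1 : Continuous fun z : Fin n ⊕ Fin n → ℝ => ((windowConst B (fun k => z (Sum.inl k)) : ℝ) : ℂ) := by
    simp only [windowConst]
    fun_prop
  have h2 : Continuous fun z : Fin n ⊕ Fin n → ℝ =>
      (gaussian (modeEquiv n) Z (windowParameter B z)).toLp 2 (volume : Measure (Config n)) := by
    have hb : Continuous fun z => windowParameter B z := by
      simp only [windowParameter]
      fun_prop
    rw [continuous_iff_continuousAt]
    intro z
    exact tendsto_gaussian_toLp (modeEquiv n) (Filter.Eventually.of_forall fun _ => hpos) hpos tendsto_const_nhds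
      (hb.tendsto z)
  exact h1.smul h2

theorem norm_window_apply_sq (p : Fin n → ℝ) (x : Config n) :
    ‖window B Z (Sum.elim p 0) x‖ ^ 2 = |B.det| / Real.sqrt Real.pi ^ n *
      Real.exp (-(p ⬝ᵥ (1 : Matrix (Fin n) (Fin n) ℝ) *ᵥ p) + ((2 : ℝ) • (B *ᵥ WithLp.ofLp x)) ⬝ᵥ p +
        -((B *ᵥ WithLp.ofLp x) ⬝ᵥ (B *ᵥ WithLp.ofLp x))) := by
  have h1 : (fun i => (windowParameter B (Sum.elim p 0) i).re) = Bᵀ *ᵥ p := by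
    funext i
    simp [windowParameter, Matrix.mulVec, dotProduct]
  rw [window, _root_.smul_apply, smul_eq_mul, norm_mul, mul_pow, Complex.norm_real, Real.norm_eq_abs, sq_abs,
    windowConst_sq, gaussian_apply _ hpos, norm_cexp_gaussianExponent, h1, ← Real.exp_nat_mul, mul_assoc,
    ← Real.exp_add, hZB, dotProduct_mulVec_transpose]
  change _ * Real.exp (_ + _ * (-(1 / 2) * (WithLp.ofLp x ⬝ᵥ (Bᵀ * B) *ᵥ WithLp.ofLp x) + p ⬝ᵥ B *ᵥ WithLp.ofLp x)) = _
  have h2 : WithLp.ofLp x ⬝ᵥ (Bᵀ * B) *ᵥ WithLp.ofLp x = (B *ᵥ WithLp.ofLp x) ⬝ᵥ (B *ᵥ WithLp.ofLp x) := by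
    rw [← Matrix.mulVec_mulVec, dotProduct_comm, dotProduct_mulVec_transpose]
  rw [h2, Matrix.one_mulVec, smul_dotProduct, dotProduct_comm (B *ᵥ WithLp.ofLp x) p, smul_eq_mul]
  congr 2
  simp only [Sum.elim_inl]
  push_cast
  ring

theorem window_apply_sum_elim (p q : Fin n → ℝ) (x : Config n) :
    window B Z (Sum.elim p q) x = Complex.exp (Complex.I * ((q ⬝ᵥ (B *ᵥ WithLp.ofLp x) : ℝ) : ℂ)) *
      window B Z (Sum.elim p 0) x := by
  rw [window, window, _root_.smul_apply, _root_.smul_apply, gaussian_apply _ hpos, gaussian_apply _ hpos]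
  simp only [smul_eq_mul, Sum.elim_inl]
  rw [mul_left_comm, ← Complex.exp_add]
  congr 2
  have h1 : ∑ i, windowParameter B (Sum.elim p q) i * (modeEquiv n x i : ℂ) =
      Complex.I * ((q ⬝ᵥ (B *ᵥ WithLp.ofLp x) : ℝ) : ℂ) +
        ∑ i, windowParameter B (Sum.elim p 0) i * (modeEquiv n x i : ℂ) := by
    have h2 : ((q ⬝ᵥ (B *ᵥ WithLp.ofLp x) : ℝ) : ℂ) = ∑ i, ∑ k, (B k i : ℂ) * q k * (WithLp.ofLp x i : ℂ) := by
      simp only [dotProduct, Matrix.mulVec, Complex.ofReal_sum, Complex.ofReal_mul, Finset.mul_sum]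
      rw [Finset.sum_comm]
      refine Finset.sum_congr rfl fun i _ => Finset.sum_congr rfl fun k _ => ?_
      ring
    rw [h2, Finset.mul_sum, ← Finset.sum_add_distrib]
    refine Finset.sum_congr rfl fun i _ => ?_
    simp only [windowParameter, Matrix.mulVec, dotProduct, Matrix.map_apply, Matrix.transpose_apply, Sum.elim_inl,
      Sum.elim_inr, Pi.zero_apply, Complex.ofReal_zero, mul_zero, add_zero, Finset.sum_mul, Finset.mul_sum]
    rw [← Finset.sum_add_distrib]
    refine Finset.sum_congr rfl fun k _ => ?_
    change _ * (WithLp.ofLp x i : ℂ) = _ + _ * (WithLp.ofLp x i : ℂ)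
    ring
  rw [gaussianExponent, gaussianExponent, h1]
  ring

-- The label `q` enters only through the phase `exp (i q·Bx)`. Hence the inner product is the
-- Fourier transform of `conj (w (p, 0)) f` at frequency `Bᵀ q / 2π`, and Plancherel's theorem
-- applies; the prefactor is the Jacobian of this rescaling.
open FourierTransform in
theorem lintegral_inner_window_schwartz (f : 𝓢(Config n, ℂ)) (p : Fin n → ℝ) :
    ∫⁻ q, ‖⟪(window B Z (Sum.elim p q)).toLp 2 (volume : Measure (Config n)), f.toLp 2 volume⟫_ℂ‖ₑ ^ 2 =
      ENNReal.ofReal ((2 * Real.pi) ^ n / |B.det|) * ∫⁻ x, ‖window B Z (Sum.elim p 0) x‖ₑ ^ 2 * ‖f x‖ₑ ^ 2 := by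
  have hg : (fun x => (starRingEnd ℂ) (window B Z (Sum.elim p 0) x)).HasTemperateGrowth :=
    Function.HasTemperateGrowth.comp (g := fun z : ℂ => (starRingEnd ℂ) z)
      ((Complex.conjCLE : ℂ →L[ℝ] ℂ).hasTemperateGrowth) (SchwartzMap.hasTemperateGrowth _)
  set F : 𝓢(Config n, ℂ) := SchwartzMap.smulLeftCLM ℂ (fun x => (starRingEnd ℂ) (window B Z (Sum.elim p 0) x)) f
    with hF
  have hFx : ∀ x, F x = (starRingEnd ℂ) (window B Z (Sum.elim p 0) x) * f x := fun x =>
    SchwartzMap.smulLeftCLM_apply_apply hg f x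
  set M : Matrix (Fin n) (Fin n) ℝ := (2 * Real.pi)⁻¹ • Bᵀ with hM
  have hMdet : M.det = ((2 * Real.pi) ^ n)⁻¹ * B.det := by
    rw [hM, Matrix.det_smul, Fintype.card_fin, Matrix.det_transpose, inv_pow]
  have hpi : 0 < (2 * Real.pi) ^ n := by positivity
  have hM0 : M.det ≠ 0 := by rw [hMdet]; exact mul_ne_zero (inv_ne_zero hpi.ne') hB
  have h1 : ∀ q, ⟪(window B Z (Sum.elim p q)).toLp 2 (volume : Measure (Config n)), f.toLp 2 volume⟫_ℂ =
      𝓕 F (WithLp.toLp 2 (M *ᵥ q)) := by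
    intro q
    refine (SchwartzMap.inner_toL2_toL2_eq _ _ volume).trans ?_
    rw [SchwartzMap.fourier_coe, Real.fourier_eq']
    congr 1
    funext x
    rw [window_apply_sum_elim hB hpos hZB, hFx, RCLike.inner_apply, map_mul, ← Complex.exp_conj, map_mul,
      Complex.conj_I, Complex.conj_ofReal, smul_eq_mul]
    have h2 : ⟪x, WithLp.toLp 2 (M *ᵥ q)⟫_ℝ = (2 * Real.pi)⁻¹ * (q ⬝ᵥ (B *ᵥ WithLp.ofLp x)) := by
      rw [EuclideanSpace.inner_eq_star_dotProduct, star_trivial]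
      change (M *ᵥ q) ⬝ᵥ WithLp.ofLp x = _
      rw [hM, Matrix.smul_mulVec, smul_dotProduct, dotProduct_mulVec_transpose, smul_eq_mul]
    rw [h2]
    have h3 : -2 * Real.pi * ((2 * Real.pi)⁻¹ * (q ⬝ᵥ (B *ᵥ WithLp.ofLp x))) = -(q ⬝ᵥ (B *ᵥ WithLp.ofLp x)) := by
      have := Real.pi_pos
      field_simp
    rw [h3]
    push_cast
    ring_nf
  simp_rw [h1]
  rw [lintegral_comp_mulVec hM0 fun u => ‖𝓕 F (WithLp.toLp 2 u)‖ₑ ^ 2, ← lintegral_config]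
  have h2 : ∫⁻ ξ : Config n, ‖𝓕 F ξ‖ₑ ^ 2 = ∫⁻ x, ‖F x‖ₑ ^ 2 := by
    rw [← enorm_toLp_sq, ← enorm_toLp_sq, ofReal_norm_sq_eq_enorm, ofReal_norm_sq_eq_enorm, norm_toLp_sq, norm_toLp_sq,
      SchwartzMap.integral_norm_sq_fourier]
  change _ * ∫⁻ ξ : Config n, ‖𝓕 F ξ‖ₑ ^ 2 = _
  rw [h2]
  congr 1
  · rw [hMdet, abs_mul, abs_of_pos (inv_pos.2 hpi), mul_inv, inv_inv, div_eq_mul_inv]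
  · refine lintegral_congr fun x => ?_
    rw [hFx, enorm_mul, mul_pow, RCLike.enorm_conj]

/-- For the resolution of the identity on Schwartz functions, Plancherel in `q` leaves `∫ |w (p,
0)(x)|² dp`, which equals `|det B|` for every `x`. Density of the Schwartz functions does the rest.
-/
theorem isCoherentFamily_window :
    IsCoherentFamily fun z => (window B Z z).toLp 2 (volume : Measure (Config n)) := by
  have hB' : 0 < |B.det| := abs_pos.2 hB
  have hpi : 0 < Real.sqrt Real.pi ^ n := pow_pos (Real.sqrt_pos.2 Real.pi_pos) _
  have hcont := continuous_window hB hpos hZB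
  have hm : ∀ f : HilbertSpace n, Continuous fun z => ⟪(window B Z z).toLp 2 (volume : Measure (Config n)), f⟫_ℂ :=
    fun f => hcont.inner continuous_const
  refine ⟨fun z => ?_, norm_inner_window_sq hB hpos hZB, fun f => (hm f).measurable.enorm.pow_const 2, fun f => ?_⟩
  · have h := norm_inner_window_sq hB hpos hZB z z
    rw [inner_self_eq_norm_sq_to_K] at h
    simp only [sub_self, dotProduct_zero, mul_zero, Real.exp_zero] at h
    set r := ‖(window B Z z).toLp 2 (volume : Measure (Config n))‖
    have hr : 0 ≤ r := norm_nonneg _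
    have h2 : ‖((r : ℂ)) ^ 2‖ = r ^ 2 := by rw [norm_pow, Complex.norm_real, Real.norm_of_nonneg hr]
    have h3 : (r ^ 2) ^ 2 = 1 := by rw [← h2]; exact h
    rw [← pow_mul] at h3
    exact (pow_eq_one_iff_of_nonneg hr (by norm_num)).1 h3
  · set c := ENNReal.ofReal (Real.sqrt (2 * Real.pi) ^ n) with hc
    have hc2 : ENNReal.ofReal (Real.sqrt (2 * Real.pi) ^ Fintype.card (Fin n ⊕ Fin n)) = c ^ 2 := by
      rw [hc, ← ENNReal.ofReal_pow (by positivity)]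
      congr 1
      rw [Fintype.card_sum, Fintype.card_fin, ← pow_mul]
      congr 1
      ring
    rw [hc2]
    refine lintegral_inner_sq_eq_of_dense (fun f => (hm f).measurable) c ENNReal.ofReal_ne_top
      (SchwartzMap.denseRange_toLpCLM (F := ℂ) (μ := (volume : Measure (Config n))) (p := 2) (by norm_num)) ?_ f
    rintro _ ⟨f, rfl⟩
    change ∫⁻ z, ‖⟪(window B Z z).toLp 2 (volume : Measure (Config n)), f.toLp 2 volume⟫_ℂ‖ₑ ^ 2 =
      c ^ 2 * ‖f.toLp 2 (volume : Measure (Config n))‖ₑ ^ 2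
    rw [lintegral_sum_pi ((hm _).measurable.enorm.pow_const 2)]
    simp_rw [lintegral_inner_window_schwartz hB hpos hZB f]
    rw [lintegral_const_mul' _ _ ENNReal.ofReal_ne_top]
    simp_rw [ofReal_norm_sq_eq_enorm (window B Z _ _), norm_window_apply_sq hB hpos hZB]
    rw [lintegral_lintegral_swap (Measurable.aemeasurable ?_)]
    · have h1 : ∀ x : Config n, ∫⁻ p : Fin n → ℝ, ENNReal.ofReal (|B.det| / Real.sqrt Real.pi ^ n *
          Real.exp (-(p ⬝ᵥ (1 : Matrix (Fin n) (Fin n) ℝ) *ᵥ p) + ((2 : ℝ) • (B *ᵥ WithLp.ofLp x)) ⬝ᵥ p +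
          -((B *ᵥ WithLp.ofLp x) ⬝ᵥ (B *ᵥ WithLp.ofLp x)))) * ‖f x‖ₑ ^ 2 = ENNReal.ofReal |B.det| * ‖f x‖ₑ ^ 2 := by
        intro x
        rw [lintegral_mul_const' _ _ (by simp), lintegral_real_gaussian Matrix.PosDef.one _ _ _ (by positivity)]
        congr 2
        rw [inv_one, Matrix.one_mulVec, Matrix.det_one, Real.sqrt_one, Fintype.card_fin, smul_dotProduct,
          dotProduct_smul, smul_eq_mul, smul_eq_mul]
        have : ∀ t : ℝ, 1 / 4 * (2 * (2 * t)) + -t = 0 := fun t => by ring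
        rw [this, Real.exp_zero]
        field_simp
      simp_rw [h1]
      rw [lintegral_const_mul' _ _ ENNReal.ofReal_ne_top, ← enorm_toLp_sq, ← mul_assoc,
        ← ENNReal.ofReal_mul (by positivity), hc, ← ENNReal.ofReal_pow (by positivity), ← pow_mul, mul_comm n 2, pow_mul,
        Real.sq_sqrt (by positivity), div_mul_cancel₀ _ hB'.ne']
    · refine Measurable.mul (Measurable.ennreal_ofReal ?_) ?_
      · refine Continuous.measurable ?_
        fun_prop
      · exact ((f.continuous.comp continuous_snd).measurable.enorm).pow_const 2

end Windows

/-! ### Schur complements and the restricted covariance matrix. -/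

section BlockAlgebra
variable {l m : Type} [Fintype l] [DecidableEq l] [Fintype m] [DecidableEq m]

/-- The Schur complement of the first block. -/
def schur (X : Matrix (l ⊕ m) (l ⊕ m) ℝ) : Matrix m m ℝ :=
  X.toBlocks₂₂ - (X.toBlocks₁₂)ᵀ * (X.toBlocks₁₁)⁻¹ * X.toBlocks₁₂

theorem toBlocks₂₁_eq {R : Type*} {X : Matrix (l ⊕ m) (l ⊕ m) R} (hX : Xᵀ = X) : X.toBlocks₂₁ = (X.toBlocks₁₂)ᵀ := by
  conv_lhs => rw [← hX]
  rfl

theorem posDef_toBlocks₁₁ {X : Matrix (l ⊕ m) (l ⊕ m) ℝ} (hX : X.PosDef) : X.toBlocks₁₁.PosDef :=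
  hX.submatrix (Sum.inl_injective (α := l) (β := m))

theorem transpose_eq_of_posDef {X : Matrix l l ℝ} (hX : X.PosDef) : Xᵀ = X := by
  rw [← Matrix.conjTranspose_eq_transpose_of_trivial]; exact hX.isHermitian

theorem posDef_schur {X : Matrix (l ⊕ m) (l ⊕ m) ℝ} (hX : X.PosDef) : (schur X).PosDef := by
  have hA := posDef_toBlocks₁₁ hX
  have hi : Invertible X.toBlocks₁₁ := hA.isUnit.invertible
  have hXT := transpose_eq_of_posDef hX
  have hXe : X = Matrix.fromBlocks X.toBlocks₁₁ X.toBlocks₁₂ (X.toBlocks₁₂)ᴴ X.toBlocks₂₂ := by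
    rw [Matrix.conjTranspose_eq_transpose_of_trivial, ← toBlocks₂₁_eq hXT, Matrix.fromBlocks_toBlocks]
  have hdet : X.det = X.toBlocks₁₁.det * (schur X).det := by
    conv_lhs => rw [hXe, Matrix.det_fromBlocks₁₁]
    rw [schur, Matrix.invOf_eq_nonsing_inv, Matrix.conjTranspose_eq_transpose_of_trivial]
  refine (Matrix.PosSemidef.posDef_iff_isUnit ?_).2 ?_
  · have h := (Matrix.PosDef.fromBlocks₁₁ X.toBlocks₁₂ X.toBlocks₂₂ hA).1 (by rw [← hXe]; exact hX.posSemidef)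
    rw [schur, ← Matrix.conjTranspose_eq_transpose_of_trivial]
    exact h
  · rw [Matrix.isUnit_iff_isUnit_det, isUnit_iff_ne_zero]
    intro h0
    rw [h0, mul_zero] at hdet
    exact hX.det_pos.ne' hdet

theorem inv_eq_fromBlocks {X : Matrix (l ⊕ m) (l ⊕ m) ℝ} (hX : X.PosDef) :
    X⁻¹ = Matrix.fromBlocks
      ((X.toBlocks₁₁)⁻¹ + (X.toBlocks₁₁)⁻¹ * X.toBlocks₁₂ * (schur X)⁻¹ * (X.toBlocks₁₂)ᵀ * (X.toBlocks₁₁)⁻¹)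
      (-((X.toBlocks₁₁)⁻¹ * X.toBlocks₁₂ * (schur X)⁻¹))
      (-((schur X)⁻¹ * (X.toBlocks₁₂)ᵀ * (X.toBlocks₁₁)⁻¹)) (schur X)⁻¹ := by
  have hXT := transpose_eq_of_posDef hX
  have h1 : IsUnit X.toBlocks₁₁.det := (posDef_toBlocks₁₁ hX).det_pos.ne'.isUnit
  have h2 : IsUnit (schur X).det := (posDef_schur hX).det_pos.ne'.isUnit
  have hD : X.toBlocks₂₂ = schur X + (X.toBlocks₁₂)ᵀ * (X.toBlocks₁₁)⁻¹ * X.toBlocks₁₂ := by rw [schur]; abel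
  have hXe : X = Matrix.fromBlocks X.toBlocks₁₁ X.toBlocks₁₂ (X.toBlocks₁₂)ᵀ X.toBlocks₂₂ := by
    rw [← toBlocks₂₁_eq hXT, Matrix.fromBlocks_toBlocks]
  rw [hD] at hXe
  generalize X.toBlocks₁₁ = A at *
  generalize X.toBlocks₁₂ = u at *
  generalize schur X = S at *
  rw [hXe]
  refine Matrix.inv_eq_right_inv ?_
  rw [Matrix.fromBlocks_multiply, ← Matrix.fromBlocks_one]
  simp only [Matrix.mul_add, Matrix.add_mul, Matrix.mul_neg, ← Matrix.mul_assoc, Matrix.mul_nonsing_inv _ h1,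
    Matrix.mul_nonsing_inv _ h2, Matrix.one_mul]
  refine Matrix.fromBlocks_inj.2 ⟨?_, ?_, ?_, ?_⟩ <;> abel

/-- The matrix describing how the window of `A` depends on the configuration of `B`. -/
def windowShift (B : Matrix l l ℝ) (X Y : Matrix (l ⊕ m) (l ⊕ m) ℝ) : Matrix (l ⊕ l) m ℝ :=
  Matrix.fromRows (-((Bᵀ)⁻¹ * X.toBlocks₁₂)) (-((Bᵀ)⁻¹ * Y.toBlocks₁₂))

/-- The restriction of a matrix on phase space to the phase space of `A`. -/
def restrict (G : Matrix ((l ⊕ m) ⊕ (l ⊕ m)) ((l ⊕ m) ⊕ (l ⊕ m)) ℝ) : Matrix (l ⊕ l) (l ⊕ l) ℝ :=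
  G.submatrix (Sum.map Sum.inl Sum.inl) (Sum.map Sum.inl Sum.inl)

/-- The restricted covariance is `Ξ (1 + L S⁻¹ Lᵀ) Ξᵀ`, where `Ξ` sends the label of a window to its
centre in the phase space of `A`. The summand `1` is the covariance of a single window, the other
that of the centres as the configuration of `B` varies. The diagonal blocks `B⁻¹` and `Bᵀ` of the
triangular matrix `Ξ` give it determinant `1`. -/
theorem det_restrict_covariance {Z : Matrix (l ⊕ m) (l ⊕ m) ℂ} (hZ : Zᵀ = Z) (hpos : (Z.map Complex.re).PosDef)
    {B : Matrix l l ℝ} (hB : B.det ≠ 0) (hZB : (Z.map Complex.re).toBlocks₁₁ = Bᵀ * B) :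
    (restrict (covariance Z)).det = (1 + windowShift B (Z.map Complex.re) (Z.map Complex.im) *
      (schur (Z.map Complex.re))⁻¹ * (windowShift B (Z.map Complex.re) (Z.map Complex.im))ᵀ).det := by
  have hcov := covariance_eq_fromBlocks hZ rfl rfl hpos
  set X := Z.map Complex.re with hX
  set Y := Z.map Complex.im with hY
  have hYT : Yᵀ = Y := by rw [hY, ← Matrix.transpose_map, hZ]
  clear_value X Y
  have hu : IsUnit B.det := hB.isUnit
  have huT : IsUnit Bᵀ.det := by rwa [Matrix.det_transpose]
  have hP : (X.toBlocks₁₁)⁻¹ = B⁻¹ * (Bᵀ)⁻¹ := by rw [hZB, Matrix.mul_inv_rev]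
  have hST : (schur X)ᵀ = schur X := transpose_eq_of_posDef (posDef_schur hpos)
  set Ξ : Matrix (l ⊕ l) (l ⊕ l) ℝ := Matrix.fromBlocks B⁻¹ 0 (-(Y.toBlocks₁₁ * B⁻¹)) Bᵀ with hΞ
  have hdet : Ξ.det = 1 := by
    rw [hΞ, Matrix.det_fromBlocks_zero₁₂, Matrix.det_transpose, Matrix.det_nonsing_inv]
    exact Ring.inverse_mul_cancel _ hu
  have hYaT : (Y.toBlocks₁₁)ᵀ = Y.toBlocks₁₁ := by
    conv_rhs => rw [← hYT]
    rfl
  have hΞL : Ξ * windowShift B X Y = Matrix.fromRows (-((X.toBlocks₁₁)⁻¹ * X.toBlocks₁₂))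
      (Y.toBlocks₁₁ * (X.toBlocks₁₁)⁻¹ * X.toBlocks₁₂ - Y.toBlocks₁₂) := by
    rw [hΞ, windowShift, Matrix.fromBlocks_mul_fromRows, hP]
    congr 1
    · simp [Matrix.mul_assoc]
    · simp only [Matrix.neg_mul, Matrix.mul_neg, neg_neg, ← Matrix.mul_assoc, Matrix.mul_nonsing_inv _ huT,
        Matrix.one_mul, sub_eq_add_neg]
  have hΞΞ : Ξ * Ξᵀ = Matrix.fromBlocks (X.toBlocks₁₁)⁻¹ (-((X.toBlocks₁₁)⁻¹ * Y.toBlocks₁₁))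
      (-(Y.toBlocks₁₁ * (X.toBlocks₁₁)⁻¹))
      (X.toBlocks₁₁ + Y.toBlocks₁₁ * (X.toBlocks₁₁)⁻¹ * Y.toBlocks₁₁) := by
    rw [hΞ, Matrix.fromBlocks_transpose, Matrix.fromBlocks_multiply, hP, hZB]
    simp only [Matrix.transpose_neg, Matrix.transpose_mul, Matrix.transpose_zero, Matrix.transpose_transpose,
      Matrix.transpose_nonsing_inv, hYaT]
    congr 1
    · simp
    · simp [Matrix.mul_assoc]
    · simp [Matrix.mul_assoc]
    · simp [Matrix.mul_assoc, add_comm]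
  have hmain : restrict (covariance Z) = Ξ * (1 + windowShift B X Y * (schur X)⁻¹ * (windowShift B X Y)ᵀ) * Ξᵀ := by
    have h1 : Ξ * (1 + windowShift B X Y * (schur X)⁻¹ * (windowShift B X Y)ᵀ) * Ξᵀ =
        Ξ * Ξᵀ + (Ξ * windowShift B X Y) * (schur X)⁻¹ * (Ξ * windowShift B X Y)ᵀ := by
      rw [Matrix.transpose_mul, Matrix.mul_add, Matrix.add_mul, Matrix.mul_one]
      simp only [Matrix.mul_assoc]
    have hYe : Y = Matrix.fromBlocks Y.toBlocks₁₁ Y.toBlocks₁₂ (Y.toBlocks₁₂)ᵀ Y.toBlocks₂₂ := by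
      rw [← toBlocks₂₁_eq hYT, Matrix.fromBlocks_toBlocks]
    have hPT : ((X.toBlocks₁₁)⁻¹)ᵀ = (X.toBlocks₁₁)⁻¹ := transpose_eq_of_posDef (posDef_toBlocks₁₁ hpos).inv
    have h2 : restrict (covariance Z) = Matrix.fromBlocks (X⁻¹).toBlocks₁₁ (-(X⁻¹ * Y).toBlocks₁₁)
        (-(Y * X⁻¹).toBlocks₁₁) (X.toBlocks₁₁ + (Y * X⁻¹ * Y).toBlocks₁₁) := by
      rw [hcov]
      ext (i | i) (j | j) <;> rfl
    rw [h1, hΞΞ, hΞL, h2]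
    have hXi := inv_eq_fromBlocks hpos
    rw [hXi]
    generalize X.toBlocks₁₁ = A at *
    generalize X.toBlocks₁₂ = u at *
    generalize Y.toBlocks₁₁ = Ya at *
    generalize Y.toBlocks₁₂ = y at *
    generalize Y.toBlocks₂₂ = Yb at *
    generalize schur X = S at *
    rw [hYe, Matrix.fromBlocks_multiply, Matrix.fromBlocks_multiply,
      Matrix.fromBlocks_multiply, Matrix.toBlocks_fromBlocks₁₁, Matrix.toBlocks_fromBlocks₁₁,
      Matrix.toBlocks_fromBlocks₁₁, Matrix.toBlocks_fromBlocks₁₁, Matrix.transpose_fromRows, Matrix.fromRows_mul,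
      Matrix.fromRows_mul_fromCols, Matrix.fromBlocks_add]
    simp only [Matrix.transpose_neg, Matrix.transpose_sub, Matrix.transpose_mul, hPT, hYaT]
    refine Matrix.fromBlocks_inj.2 ⟨?_, ?_, ?_, ?_⟩ <;>
      simp only [Matrix.mul_add, Matrix.add_mul, Matrix.mul_sub, Matrix.sub_mul, Matrix.mul_neg, Matrix.neg_mul,
        Matrix.mul_assoc] <;> abel
  rw [hmain, Matrix.det_mul, Matrix.det_mul, Matrix.det_transpose, hdet, one_mul, mul_one]

end BlockAlgebra

/-! ### Slices of a Gaussian, and its entanglement entropy. -/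

section GaussianSlices
variable {NA NB : ℕ}

instance secondCountableTopology_hilbertSpace (n : ℕ) : SecondCountableTopology (HilbertSpace n) := by
  have : Fact ((2 : ℝ≥0∞) ≠ ⊤) := ⟨by simp⟩
  exact Lp.SecondCountableTopology

theorem lintegral_enorm_slice_sq_ne_top (ψ : WaveFunction NA NB) :
    ∫⁻ y, ‖(slice ψ y).toLp 2 (volume : Measure (Config NA))‖ₑ ^ 2 ≠ ⊤ := by
  rw [lintegral_enorm_slice_sq]
  simp

theorem reducedDensity_nonneg (ψ : WaveFunction NA NB) : 0 ≤ reducedDensity ψ := by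
  have h := integral_rankOne_nonneg (μ := volume)
    (φ := fun y => (slice ψ y).toLp 2 (volume : Measure (Config NA))) (continuous_slice_toLp ψ)
    (lintegral_enorm_slice_sq_ne_top ψ)
  unfold reducedDensity
  refine cast ?_ h
  congr 3

theorem enorm_reducedDensity_le (ψ : WaveFunction NA NB) :
    ‖reducedDensity ψ‖ₑ ≤ ∫⁻ y, ‖(slice ψ y).toLp 2 (volume : Measure (Config NA))‖ₑ ^ 2 := by
  refine (enorm_integral_le_lintegral_enorm _).trans (le_of_eq (lintegral_congr fun y => ?_))
  exact enorm_rankOne_self (E := HilbertSpace NA) _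

theorem norm_reducedDensity_le {ψ : WaveFunction NA NB} (hψ : ‖ψ.toLp 2‖ = 1) : ‖reducedDensity ψ‖ ≤ 1 := by
  have h := enorm_reducedDensity_le ψ
  rw [lintegral_enorm_slice_sq, ofReal_norm_sq_eq_enorm, hψ, one_pow, ENNReal.ofReal_one] at h
  rw [← ofReal_norm] at h
  exact ENNReal.ofReal_le_one.1 h

theorem ofReal_re_inner_reducedDensity (ψ : WaveFunction NA NB) (f : HilbertSpace NA) :
    ENNReal.ofReal (RCLike.re ⟪f, reducedDensity ψ f⟫_ℂ) =
      ∫⁻ y : Fin NB → ℝ, ‖⟪(slice ψ (WithLp.toLp 2 y)).toLp 2 (volume : Measure (Config NA)), f⟫_ℂ‖ₑ ^ 2 := by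
  rw [← lintegral_config fun y => ‖⟪(slice ψ (WithLp.toLp 2 y)).toLp 2 (volume : Measure (Config NA)), f⟫_ℂ‖ₑ ^ 2]
  have h := ofReal_re_inner_integral_rankOne (μ := volume)
    (φ := fun y => (slice ψ y).toLp 2 (volume : Measure (Config NA))) (continuous_slice_toLp ψ)
    (lintegral_enorm_slice_sq_ne_top ψ) f
  unfold reducedDensity
  convert h <;> rfl

theorem gaussianExponent_sum_elim {l m : Type} [Fintype l] [DecidableEq l] [Fintype m] [DecidableEq m]
    {Z : Matrix (l ⊕ m) (l ⊕ m) ℂ} (hZ : Zᵀ = Z) (b : l ⊕ m → ℂ) (x : l → ℝ) (y : m → ℝ) :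
    gaussianExponent Z b (Sum.elim x y) =
      gaussianExponent Z.toBlocks₁₁ (fun i => b (Sum.inl i) - ∑ j, Z.toBlocks₁₂ i j * y j) x +
        gaussianExponent Z.toBlocks₂₂ (fun j => b (Sum.inr j)) y := by
  have h1 : ∑ j, ∑ i, Z (Sum.inr j) (Sum.inl i) * y j * x i = ∑ i, ∑ j, Z (Sum.inl i) (Sum.inr j) * y j * x i := by
    rw [Finset.sum_comm]
    refine Finset.sum_congr rfl fun i _ => Finset.sum_congr rfl fun j _ => ?_
    conv_lhs => rw [← hZ]
    rfl
  simp only [gaussianExponent, Fintype.sum_sum_type, Sum.elim_inl, Sum.elim_inr, Finset.sum_add_distrib, sub_mul,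
    Finset.sum_sub_distrib, Finset.sum_mul, Matrix.toBlocks₁₁, Matrix.toBlocks₁₂, Matrix.toBlocks₂₂, Matrix.of_apply]
  rw [h1]
  have h2 : ∑ i, ∑ j, Z (Sum.inl i) (Sum.inr j) * x i * y j = ∑ i, ∑ j, Z (Sum.inl i) (Sum.inr j) * y j * x i :=
    Finset.sum_congr rfl fun i _ => Finset.sum_congr rfl fun j _ => by ring
  rw [h2]
  ring

theorem complete_square {m : Type} [Fintype m] [DecidableEq m] {S : Matrix m m ℝ} (hS : S.PosDef) (d y : m → ℝ) :
    -(y ⬝ᵥ S *ᵥ y) + 2 * (d ⬝ᵥ y) = -((y - S⁻¹ *ᵥ d) ⬝ᵥ S *ᵥ (y - S⁻¹ *ᵥ d)) + (S⁻¹ *ᵥ d) ⬝ᵥ d := by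
  have h1 : S *ᵥ (S⁻¹ *ᵥ d) = d := by
    rw [Matrix.mulVec_mulVec, Matrix.mul_nonsing_inv _ hS.det_pos.ne'.isUnit, Matrix.one_mulVec]
  have h2 : (S⁻¹ *ᵥ d) ⬝ᵥ S *ᵥ y = d ⬝ᵥ y := by
    rw [Matrix.dotProduct_mulVec, ← Matrix.mulVec_transpose, transpose_eq_of_posDef hS, h1]
  rw [Matrix.mulVec_sub, h1, sub_dotProduct, dotProduct_sub, dotProduct_sub, h2, dotProduct_comm y d]
  ring

/-- The last term on the left comes from the inverse normalization constant of the windows. It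
cancels the part `uᵀ P u` of the quadratic form of `B`, so the weight of the superposition is
governed by the Schur complement `S` alone. -/
theorem complete_square_of_blocks {l m : Type} [Fintype l] [DecidableEq l] [Fintype m] [DecidableEq m]
    {P B : Matrix l l ℝ} {u : Matrix l m ℝ} {S : Matrix m m ℝ} (hS : S.PosDef) (hPT : Pᵀ = P)
    (hP : P = B⁻¹ * (Bᵀ)⁻¹) (r : l → ℝ) (e y : m → ℝ) :
    -(y ⬝ᵥ (S + uᵀ * P * u) *ᵥ y) + 2 * (e ⬝ᵥ y) + ((Bᵀ)⁻¹ *ᵥ (r - u *ᵥ y)) ⬝ᵥ ((Bᵀ)⁻¹ *ᵥ (r - u *ᵥ y)) =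
      (S⁻¹ *ᵥ (e - uᵀ *ᵥ (P *ᵥ r))) ⬝ᵥ (e - uᵀ *ᵥ (P *ᵥ r)) + r ⬝ᵥ P *ᵥ r -
        (y - S⁻¹ *ᵥ (e - uᵀ *ᵥ (P *ᵥ r))) ⬝ᵥ S *ᵥ (y - S⁻¹ *ᵥ (e - uᵀ *ᵥ (P *ᵥ r))) := by
  have h2 : ∀ v : l → ℝ, ((Bᵀ)⁻¹ *ᵥ v) ⬝ᵥ ((Bᵀ)⁻¹ *ᵥ v) = v ⬝ᵥ P *ᵥ v := fun v => by
    rw [← Matrix.transpose_nonsing_inv, dotProduct_mulVec_transpose, Matrix.mulVec_mulVec,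
      Matrix.transpose_nonsing_inv, hP]
  have h4 := complete_square hS (e - uᵀ *ᵥ (P *ᵥ r)) y
  have h5 : (u *ᵥ y) ⬝ᵥ P *ᵥ r = r ⬝ᵥ P *ᵥ (u *ᵥ y) := by
    rw [Matrix.dotProduct_mulVec, ← Matrix.mulVec_transpose, hPT, dotProduct_comm]
  have h6 : (uᵀ *ᵥ (P *ᵥ r)) ⬝ᵥ y = r ⬝ᵥ P *ᵥ (u *ᵥ y) := by
    rw [dotProduct_mulVec_transpose, dotProduct_comm, h5]
  have h7 : y ⬝ᵥ (uᵀ * P * u) *ᵥ y = (u *ᵥ y) ⬝ᵥ P *ᵥ (u *ᵥ y) := by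
    rw [← Matrix.mulVec_mulVec, ← Matrix.mulVec_mulVec, dotProduct_comm, dotProduct_mulVec_transpose, dotProduct_comm]
  rw [sub_dotProduct e, h6] at h4
  rw [h2, Matrix.mulVec_sub P, dotProduct_sub, sub_dotProduct r, sub_dotProduct r, h5, Matrix.add_mulVec,
    dotProduct_add, h7]
  linarith

variable {Z : Matrix (Modes NA NB) (Modes NA NB) ℂ} (hZ : Zᵀ = Z) (hpos : (Z.map Complex.re).PosDef)
  (b : Modes NA NB → ℂ) {B : Matrix (Fin NA) (Fin NA) ℝ} (hB : B.det ≠ 0)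
  (hZB : (Z.map Complex.re).toBlocks₁₁ = Bᵀ * B)

/-- The label of the window of `A` at the configuration `y` of `B`. -/
def windowLabel (Z : Matrix (Modes NA NB) (Modes NA NB) ℂ) (b : Modes NA NB → ℂ) (B : Matrix (Fin NA) (Fin NA) ℝ)
    (y : Fin NB → ℝ) : Fin NA ⊕ Fin NA → ℝ :=
  Sum.elim ((Bᵀ)⁻¹ *ᵥ ((fun i => (b (Sum.inl i)).re) - (Z.map Complex.re).toBlocks₁₂ *ᵥ y))
    ((Bᵀ)⁻¹ *ᵥ ((fun i => (b (Sum.inl i)).im) - (Z.map Complex.im).toBlocks₁₂ *ᵥ y))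

theorem windowLabel_eq (y y₀ : Fin NB → ℝ) : windowLabel Z b B y =
    windowLabel Z b B y₀ + windowShift B (Z.map Complex.re) (Z.map Complex.im) *ᵥ (y - y₀) := by
  funext i
  rw [windowShift, Matrix.fromRows_mulVec]
  rcases i with i | i <;>
    simp [windowLabel, Matrix.mulVec_sub, ← Matrix.mulVec_mulVec, Matrix.neg_mulVec] <;> ring

include hB in
theorem windowParameter_windowLabel (y : Fin NB → ℝ) : windowParameter B (windowLabel Z b B y) =
    fun i => b (Sum.inl i) - ∑ j, Z.toBlocks₁₂ i j * y j := by
  have huT : IsUnit Bᵀ.det := by rw [Matrix.det_transpose]; exact hB.isUnit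
  have h1 : (fun k => (windowLabel Z b B y (Sum.inl k) : ℂ) + Complex.I * windowLabel Z b B y (Sum.inr k)) =
      ((Bᵀ)⁻¹).map Complex.ofReal *ᵥ fun i => b (Sum.inl i) - ∑ j, Z.toBlocks₁₂ i j * y j := by
    funext k
    simp only [windowLabel, Sum.elim_inl, Sum.elim_inr, Matrix.mulVec, dotProduct, Matrix.map_apply, Pi.sub_apply,
      Complex.ofReal_sum, Complex.ofReal_mul, Complex.ofReal_sub, Finset.mul_sum, ← Finset.sum_add_distrib]
    refine Finset.sum_congr rfl fun i _ => ?_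
    have h2 : b (Sum.inl i) - ∑ j, Z.toBlocks₁₂ i j * (y j : ℂ) =
        ((b (Sum.inl i)).re - ∑ j, ((Z.map Complex.re).toBlocks₁₂ i j : ℂ) * y j) +
        Complex.I * ((b (Sum.inl i)).im - ∑ j, ((Z.map Complex.im).toBlocks₁₂ i j : ℂ) * y j) := by
      have h3 : ∑ j, Z.toBlocks₁₂ i j * (y j : ℂ) = ∑ j, ((Z.map Complex.re).toBlocks₁₂ i j : ℂ) * y j +
          Complex.I * ∑ j, ((Z.map Complex.im).toBlocks₁₂ i j : ℂ) * y j := by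
        rw [Finset.mul_sum, ← Finset.sum_add_distrib]
        refine Finset.sum_congr rfl fun j _ => ?_
        have := Complex.re_add_im (Z.toBlocks₁₂ i j)
        conv_lhs => rw [← this]
        simp only [Matrix.toBlocks₁₂, Matrix.of_apply, Matrix.map_apply]
        ring
      rw [h3]
      conv_lhs => rw [← Complex.re_add_im (b (Sum.inl i))]
      ring
    rw [h2]
    ring
  rw [windowParameter, h1, Matrix.mulVec_mulVec, ← map_ofReal_mul, Matrix.mul_nonsing_inv _ huT]
  have : (1 : Matrix (Fin NA) (Fin NA) ℝ).map Complex.ofReal = 1 := by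
    ext i j; simp [Matrix.one_apply, apply_ite]
  rw [this, Matrix.one_mulVec]

include hZ hpos hB hZB

/-- At fixed `y` the cross terms of the exponent only shift the linear coefficient in `x` to `b_A -
Z_AB y`; the quadratic part stays `Z_AA`. So the slices are windows of one family, differing in
label and scalar factor. -/
theorem slice_gaussian (c : ℂ) (y : Fin NB → ℝ) :
    slice (c • gaussian (coordEquiv NA NB) Z b) (WithLp.toLp 2 y) =
      (c * Complex.exp (gaussianExponent Z.toBlocks₂₂ (fun j => b (Sum.inr j)) y) *
        ((windowConst B fun k => windowLabel Z b B y (Sum.inl k) : ℝ) : ℂ)⁻¹) •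
        window B Z.toBlocks₁₁ (windowLabel Z b B y) := by
  have hposA : (Z.toBlocks₁₁.map Complex.re).PosDef := posDef_toBlocks₁₁ hpos
  ext x
  rw [slice_apply, _root_.smul_apply, _root_.smul_apply, gaussian_apply _ hpos, window, _root_.smul_apply,
    gaussian_apply _ hposA, windowParameter_windowLabel b hB]
  have h1 : coordEquiv NA NB (x, WithLp.toLp 2 y) = Sum.elim (modeEquiv NA x) y := by
    funext k
    rcases k with k | k <;> rfl
  have h2 : ((windowConst B fun k => windowLabel Z b B y (Sum.inl k) : ℝ) : ℂ) ≠ 0 :=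
    Complex.ofReal_ne_zero.2 (windowConst_pos hB _).ne'
  rw [h1, gaussianExponent_sum_elim hZ, Complex.exp_add]
  simp only [smul_eq_mul]
  field_simp

theorem isGaussianSuperposition_slice {c : ℂ} (hc : ‖(c • gaussian (coordEquiv NA NB) Z b).toLp 2‖ = 1) :
    IsGaussianSuperposition (fun z => (window B Z.toBlocks₁₁ z).toLp 2 (volume : Measure (Config NA)))
      (schur (Z.map Complex.re)) (windowShift B (Z.map Complex.re) (Z.map Complex.im))
      fun y => (slice (c • gaussian (coordEquiv NA NB) Z b) (WithLp.toLp 2 y)).toLp 2 (volume : Measure (Config NA)) := by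
  set ψ := c • gaussian (coordEquiv NA NB) Z b with hψ
  set X := Z.map Complex.re with hX
  have hS := posDef_schur hpos
  refine ⟨(continuous_slice_toLp ψ).comp (PiLp.continuous_toLp 2 _), ?_, ?_⟩
  · rw [← lintegral_config fun y => ‖(slice ψ (WithLp.toLp 2 y)).toLp 2 (volume : Measure (Config NA))‖ₑ ^ 2]
    refine (lintegral_enorm_slice_sq ψ).trans ?_
    rw [ofReal_norm_sq_eq_enorm, hc]
    simp
  · set r : Fin NA → ℝ := fun i => (b (Sum.inl i)).re with hr
    -- The linear coefficient left after completing the square, so that `(schur X)⁻¹ d` is the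
    -- centre of the weight.
    set d : Fin NB → ℝ := (fun j => (b (Sum.inr j)).re) - (X.toBlocks₁₂)ᵀ *ᵥ ((X.toBlocks₁₁)⁻¹ *ᵥ r) with hd
    refine ⟨‖c‖ ^ 2 * (|B.det| / Real.sqrt Real.pi ^ NA)⁻¹ *
      Real.exp (((schur X)⁻¹ *ᵥ d) ⬝ᵥ d + r ⬝ᵥ (X.toBlocks₁₁)⁻¹ *ᵥ r), (schur X)⁻¹ *ᵥ d,
      windowLabel Z b B ((schur X)⁻¹ *ᵥ d), fun y => c * Complex.exp (gaussianExponent Z.toBlocks₂₂ (fun j => b (Sum.inr j)) y) *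
        ((windowConst B fun k => windowLabel Z b B y (Sum.inl k) : ℝ) : ℂ)⁻¹, by positivity, fun y => ?_, fun y => ?_⟩
    · rw [norm_mul, norm_mul, norm_inv, Complex.norm_real, Real.norm_eq_abs, mul_pow, mul_pow, inv_pow, sq_abs,
        windowConst_sq, norm_cexp_gaussianExponent, ← Real.exp_nat_mul, mul_inv, ← Real.exp_neg, neg_neg]
      rw [show ∀ a b c d : ℝ, a * b * (c * d) = a * c * (b * d) from fun a b c d => by ring,
        mul_assoc (_ * _) (Real.exp _) (Real.exp _), ← Real.exp_add, ← Real.exp_add]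
      congr 2
      have h3 : Z.toBlocks₂₂.map Complex.re = schur X + (X.toBlocks₁₂)ᵀ * (X.toBlocks₁₁)⁻¹ * X.toBlocks₁₂ := by
        rw [schur, sub_add_cancel]
        rfl
      have hPT : ((X.toBlocks₁₁)⁻¹)ᵀ = (X.toBlocks₁₁)⁻¹ := transpose_eq_of_posDef (posDef_toBlocks₁₁ hpos).inv
      have h4 := complete_square_of_blocks (B := B) (u := X.toBlocks₁₂) hS hPT
        (by rw [hZB, Matrix.mul_inv_rev]) r (fun j => (b (Sum.inr j)).re) y
      have h1 : (fun k => windowLabel Z b B y (Sum.inl k)) = (Bᵀ)⁻¹ *ᵥ (r - X.toBlocks₁₂ *ᵥ y) := rfl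
      rw [← hd] at h4
      rw [h1, h3]
      push_cast
      linarith
    · simp only []
      rw [← windowLabel_eq b y, hψ, slice_gaussian hZ hpos b hB hZB]
      exact (SchwartzMap.toLpCLM ℂ ℂ 2 (volume : Measure (Config NA))).map_smul _ _

set_option maxHeartbeats 1000000 in
omit hB hZB in
/-- The entanglement entropy of a Gaussian wave function is, up to a bounded term, half the logarithm of
the determinant of the covariance matrix of `A`. -/
theorem entanglementEntropy_gaussian_bounds {c : ℂ} (hc : ‖(c • gaussian (coordEquiv NA NB) Z b).toLp 2‖ = 1) :
    ENNReal.ofReal (1 / 2 * Real.log (restrict (covariance Z)).det) ≤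
        entanglementEntropy (c • gaussian (coordEquiv NA NB) Z b) ∧
      entanglementEntropy (c • gaussian (coordEquiv NA NB) Z b) ≤
        ENNReal.ofReal (1 / 2 * Real.log (restrict (covariance Z)).det + (1 + Real.sqrt 2 ^ (NA + NA))) := by
  obtain ⟨B, hZB, hB⟩ := exists_transpose_mul_self (posDef_toBlocks₁₁ hpos)
  have hφ := isGaussianSuperposition_slice hZ hpos b hB hZB hc
  have hw := isCoherentFamily_window (Z := Z.toBlocks₁₁) hB (posDef_toBlocks₁₁ hpos) hZB
  have hS := posDef_schur hpos
  have hρ1 := norm_reducedDensity_le (ψ := c • gaussian (coordEquiv NA NB) Z b) hc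
  have hρ0 := reducedDensity_nonneg (c • gaussian (coordEquiv NA NB) Z b)
  have hρ := ofReal_re_inner_reducedDensity (c • gaussian (coordEquiv NA NB) Z b)
  have hlow := hφ.le_vonNeumannEntropy hw hS hρ0 hρ
  have hup := hφ.vonNeumannEntropy_le hw hS hρ0 hρ1 hρ
  rw [← det_restrict_covariance hZ hpos hB hZB] at hlow hup
  rw [Fintype.card_sum, Fintype.card_fin] at hup
  exact ⟨hlow, hup⟩

end GaussianSlices

/-! ### Dependence of the restricted determinant on the inner product. -/

section Comparison
variable {ι : Type} [Fintype ι] [DecidableEq ι]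

theorem exists_posSemidef_sub_smul {A B : Matrix ι ι ℝ} (hA : A.PosDef) (hB : B.PosDef) :
    ∃ c : ℝ, 0 < c ∧ (A - c • B).PosSemidef := by
  obtain ⟨ε, hε, h⟩ := exists_posDef_lower_bound hA
  set K := ∑ i, ∑ j, |B i j| with hK
  have hK0 : 0 ≤ K := Finset.sum_nonneg fun i _ => Finset.sum_nonneg fun j _ => abs_nonneg _
  have hB' : ∀ x : ι → ℝ, x ⬝ᵥ B *ᵥ x ≤ K * ‖x‖ ^ 2 := by
    intro x
    simp only [hK, dotProduct, Matrix.mulVec, Finset.sum_mul, Finset.mul_sum]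
    refine Finset.sum_le_sum fun i _ => Finset.sum_le_sum fun j _ => (le_abs_self _).trans ?_
    rw [abs_mul, abs_mul]
    have h1 : |x i| ≤ ‖x‖ := norm_le_pi_norm x i
    have h2 : |x j| ≤ ‖x‖ := norm_le_pi_norm x j
    calc |x i| * (|B i j| * |x j|) = |B i j| * (|x i| * |x j|) := by ring
      _ ≤ |B i j| * (‖x‖ * ‖x‖) := by gcongr
      _ = _ := by ring
  -- `ε` bounds `A` from below and `K` bounds `B` from above, both against the squared supremum
  -- norm; `K + 1` avoids division by zero.
  refine ⟨ε / (K + 1), by positivity, Matrix.PosSemidef.of_dotProduct_mulVec_nonneg ?_ fun x => ?_⟩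
  · exact hA.isHermitian.sub (by
      rw [Matrix.IsHermitian, Matrix.conjTranspose_smul, hB.isHermitian]; simp)
  · rw [star_trivial, Matrix.sub_mulVec, dotProduct_sub, Matrix.smul_mulVec, dotProduct_smul, smul_eq_mul]
    have h1 : ε / (K + 1) * (x ⬝ᵥ B *ᵥ x) ≤ ε * ‖x‖ ^ 2 := by
      calc _ ≤ ε / (K + 1) * (K * ‖x‖ ^ 2) := by gcongr; exact hB' x
        _ ≤ ε / (K + 1) * ((K + 1) * ‖x‖ ^ 2) := by gcongr; linarith
        _ = _ := by field_simp
    linarith [h x]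

theorem det_ne_zero_of_symplectic {m : Type} [Fintype m] [DecidableEq m] {M : Matrix (m ⊕ m) (m ⊕ m) ℝ}
    (hM : Mᵀ * Omega m * M = Omega m) : M.det ≠ 0 := by
  intro h0
  have h1 := congrArg Matrix.det hM
  have h2 := congrArg Matrix.det (omega_mul_omega (m := m))
  rw [Matrix.det_mul, h0, mul_zero] at h1
  rw [Matrix.det_mul, ← h1, mul_zero] at h2
  have h3 : IsUnit (-1 : Matrix (m ⊕ m) (m ⊕ m) ℝ).det := (Matrix.isUnit_iff_isUnit_det _).1 isUnit_one.neg
  exact h3.ne_zero h2.symm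

variable {l m : Type} [Fintype l] [DecidableEq l] [Fintype m] [DecidableEq m]

theorem posDef_restrict {G : Matrix ((l ⊕ m) ⊕ (l ⊕ m)) ((l ⊕ m) ⊕ (l ⊕ m)) ℝ} (hG : G.PosDef) :
    (restrict G).PosDef :=
  hG.submatrix (Sum.map_injective.2 ⟨Sum.inl_injective, Sum.inl_injective⟩)

theorem posDef_mul_mul_transpose {M G : Matrix ι ι ℝ} (hM : M.det ≠ 0) (hG : G.PosDef) : (M * G * Mᵀ).PosDef := by
  have hT : IsUnit Mᵀ := (Matrix.isUnit_iff_isUnit_det _).2 (by rw [Matrix.det_transpose]; exact hM.isUnit)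
  have h := hG.conjTranspose_mul_mul_same (B := Mᵀ) (Matrix.mulVec_injective_iff_isUnit.2 hT)
  simpa [Matrix.conjTranspose_eq_transpose_of_trivial] using h

/-- The order relation `c B ≤ A` survives congruence by `M` and passage to a principal block, and
the determinant is monotone. The constant does not involve `M`, which makes the final estimate
uniform in time. -/
theorem pow_mul_det_restrict_le {A B : Matrix ((l ⊕ m) ⊕ (l ⊕ m)) ((l ⊕ m) ⊕ (l ⊕ m)) ℝ} (hB : B.PosDef) {c : ℝ}
    (hc : 0 < c) (hAB : (A - c • B).PosSemidef)
    {M : Matrix ((l ⊕ m) ⊕ (l ⊕ m)) ((l ⊕ m) ⊕ (l ⊕ m)) ℝ} (hM : M.det ≠ 0) :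
    c ^ Fintype.card (l ⊕ l) * (restrict (M * B * Mᵀ)).det ≤ (restrict (M * A * Mᵀ)).det := by
  rw [← Matrix.det_smul]
  refine det_le_det_of_posSemidef_sub ((posDef_restrict (posDef_mul_mul_transpose hM hB)).smul hc) ?_
  have h : restrict (M * A * Mᵀ) - c • restrict (M * B * Mᵀ) = restrict (M * (A - c • B) * Mᵀ) := by
    rw [Matrix.mul_sub, Matrix.sub_mul, Matrix.mul_smul, Matrix.smul_mul]
    rfl
  rw [h]
  have h2 := hAB.mul_mul_conjTranspose_same M
  rw [Matrix.conjTranspose_eq_transpose_of_trivial] at h2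
  exact h2.submatrix _

/-- The determinant is that of `1` plus a positive semidefinite matrix. Its logarithm is thus
nonnegative, so `ENNReal.ofReal` does not truncate the upper bound on the entropy. -/
theorem one_le_det_restrict_covariance {Z : Matrix (l ⊕ m) (l ⊕ m) ℂ} (hZ : Zᵀ = Z)
    (hpos : (Z.map Complex.re).PosDef) : 1 ≤ (restrict (covariance Z)).det := by
  obtain ⟨B, hZB, hB⟩ := exists_transpose_mul_self (posDef_toBlocks₁₁ hpos)
  rw [det_restrict_covariance hZ hpos hB hZB]
  refine le_of_eq_of_le Matrix.det_one.symm (det_le_det_of_posSemidef_sub Matrix.PosDef.one ?_)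
  rw [add_sub_cancel_left]
  exact posSemidef_mul_inv_mul_transpose (posDef_schur hpos) _

/-- Changing the inner product changes the logarithms of the determinants by a bounded amount. -/
theorem exists_abs_log_det_restrict_sub_le {A B : Matrix ((l ⊕ m) ⊕ (l ⊕ m)) ((l ⊕ m) ⊕ (l ⊕ m)) ℝ}
    (hA : A.PosDef) (hB : B.PosDef) :
    ∃ C : ℝ, ∀ M : Matrix ((l ⊕ m) ⊕ (l ⊕ m)) ((l ⊕ m) ⊕ (l ⊕ m)) ℝ, M.det ≠ 0 →
      |Real.log (restrict (M * A * Mᵀ)).det - Real.log (restrict (M * B * Mᵀ)).det| ≤ C := by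
  obtain ⟨c, hc, h1⟩ := exists_posSemidef_sub_smul hA hB
  obtain ⟨d, hd, h2⟩ := exists_posSemidef_sub_smul hB hA
  refine ⟨|Real.log (c ^ Fintype.card (l ⊕ l))| + |Real.log (d ^ Fintype.card (l ⊕ l))|, fun M hM => ?_⟩
  have hA' := (posDef_restrict (posDef_mul_mul_transpose hM hA)).det_pos
  have hB' := (posDef_restrict (posDef_mul_mul_transpose hM hB)).det_pos
  have h3 := Real.log_le_log (by positivity) (pow_mul_det_restrict_le hB hc h1 hM)
  have h4 := Real.log_le_log (by positivity) (pow_mul_det_restrict_le hA hd h2 hM)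
  rw [Real.log_mul (by positivity) (by positivity)] at h3 h4
  rw [abs_le]
  constructor <;>
    linarith [neg_abs_le (Real.log (c ^ Fintype.card (l ⊕ l))), neg_abs_le (Real.log (d ^ Fintype.card (l ⊕ l))),
      abs_nonneg (Real.log (c ^ Fintype.card (l ⊕ l))), abs_nonneg (Real.log (d ^ Fintype.card (l ⊕ l)))]

end Comparison

/-! ### Volumes of parallelepipeds in the subsystem. -/

section Volume
variable {NA NB N : ℕ}

theorem exists_eq_mul_basisMatrix (D : SplitBasis NA NB N) {ι : Type} [Fintype ι] [DecidableEq ι]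
    (v : Module.Basis ι ℝ (subsystem D)) (e : Fin NA ⊕ Fin NA ≃ ι) :
    ∃ C : Matrix (Fin NA ⊕ Fin NA) (Fin NA ⊕ Fin NA) ℝ, C.det ≠ 0 ∧
      (Matrix.of fun r a => (v (e r) : DualPhaseSpace N) a) =
        C * (basisMatrix D).submatrix (Sum.map Sum.inl Sum.inl) id := by
  have hli : LinearIndependent ℝ fun r : Fin NA ⊕ Fin NA => D (Sum.map Sum.inl Sum.inl r) :=
    D.linearIndependent.comp _ (Sum.map_injective.2 ⟨Sum.inl_injective, Sum.inl_injective⟩)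
  let bA : Module.Basis (Fin NA ⊕ Fin NA) ℝ (subsystem D) := Module.Basis.span hli
  refine ⟨(bA.toMatrix (v.reindex e.symm))ᵀ, ?_, ?_⟩
  · rw [Matrix.det_transpose]
    intro h0
    have h1 := congrArg Matrix.det (bA.toMatrix_mul_toMatrix_flip (v.reindex e.symm))
    rw [Matrix.det_mul, h0, zero_mul, Matrix.det_one] at h1
    exact zero_ne_one h1
  · ext r a
    have h1 := congrArg (fun w : subsystem D => (w : DualPhaseSpace N) a) (bA.sum_repr (v (e r)))
    have h2 : ∀ s, (bA s : DualPhaseSpace N) = D (Sum.map Sum.inl Sum.inl s) := fun s => by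
      exact congrArg Subtype.val (Module.Basis.span_apply hli s)
    simp only [AddSubmonoidClass.coe_finsetSum, Finset.sum_apply, Submodule.coe_smul, Pi.smul_apply, smul_eq_mul, h2] at h1
    rw [Matrix.of_apply, ← h1, Matrix.mul_apply]
    refine Finset.sum_congr rfl fun s _ => ?_
    simp [Module.Basis.toMatrix_apply, basisMatrix]

/-- The volume growth of a parallelepiped in `A*` is governed by the restriction to `A` of the transported
inner product. -/
theorem exists_parallelepipedVolume_eq (D : SplitBasis NA NB N) (v : Module.Basis (Fin (2 * NA)) ℝ (subsystem D))
    (G : Matrix (Fin N ⊕ Fin N) (Fin N ⊕ Fin N) ℝ) :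
    ∃ c : ℝ, 0 < c ∧ ∀ (M : ℝ → Matrix (Fin N ⊕ Fin N) (Fin N ⊕ Fin N) ℝ) (t : ℝ),
      parallelepipedVolume G (fun r => (M t)ᵀ *ᵥ (v r : DualPhaseSpace N)) =
        c * Real.sqrt (restrict (flowMatrix D M t * (basisMatrix D * G * (basisMatrix D)ᵀ) *
          (flowMatrix D M t)ᵀ)).det := by
  have e : Fin NA ⊕ Fin NA ≃ Fin (2 * NA) := finSumFinEquiv.trans (finCongr (two_mul NA).symm)
  obtain ⟨C, hC, hv⟩ := exists_eq_mul_basisMatrix D v e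
  refine ⟨|C.det|, abs_pos.2 hC, fun M t => ?_⟩
  set V : Matrix (Fin NA ⊕ Fin NA) (Fin N ⊕ Fin N) ℝ := Matrix.of fun r a => (v (e r) : DualPhaseSpace N) a with hV
  set P : Matrix (Fin NA ⊕ Fin NA) (Fin N ⊕ Fin N) ℝ := (basisMatrix D).submatrix (Sum.map Sum.inl Sum.inl) id with hP
  have h1 : (Matrix.of fun r s => ((M t)ᵀ *ᵥ (v r : DualPhaseSpace N)) ⬝ᵥ
      (G *ᵥ ((M t)ᵀ *ᵥ (v s : DualPhaseSpace N)))).submatrix e e = V * (M t * G * (M t)ᵀ) * Vᵀ := by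
    ext r s
    simp only [Matrix.submatrix_apply, Matrix.of_apply]
    rw [dotProduct_mulVec_transpose, Matrix.mulVec_mulVec, Matrix.mulVec_mulVec]
    have h (K : Matrix (Fin N ⊕ Fin N) (Fin N ⊕ Fin N) ℝ) :
        (V * K * Vᵀ) r s = (v (e r) : DualPhaseSpace N) ⬝ᵥ (K *ᵥ (v (e s) : DualPhaseSpace N)) := by
      rw [Matrix.mul_assoc]
      rfl
    rw [h, Matrix.mul_assoc]
  -- The rows of `P` are the observables of `D_A`, and `Mᵀ` acts on observables as right
  -- multiplication of rows by `M`. In Darboux coordinates this is selection of the `A`-rows of the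
  -- flow.
  have h2 : restrict (flowMatrix D M t * (basisMatrix D * G * (basisMatrix D)ᵀ) * (flowMatrix D M t)ᵀ) =
      P * (M t * G * (M t)ᵀ) * Pᵀ := by
    have h3 : flowMatrix D M t * basisMatrix D = basisMatrix D * M t := by
      rw [flowMatrix, Matrix.mul_assoc, reprMatrix_mul_basisMatrix, Matrix.mul_one]
    have h4 : flowMatrix D M t * (basisMatrix D * G * (basisMatrix D)ᵀ) * (flowMatrix D M t)ᵀ =
        (flowMatrix D M t * basisMatrix D) * G * (flowMatrix D M t * basisMatrix D)ᵀ := by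
      rw [Matrix.transpose_mul]
      simp only [Matrix.mul_assoc]
    rw [h4, h3, Matrix.transpose_mul, restrict]
    simp only [← Matrix.mul_assoc]
    rfl
  have h5 : V * (M t * G * (M t)ᵀ) * Vᵀ = C * (P * (M t * G * (M t)ᵀ) * Pᵀ) * Cᵀ := by
    rw [hv, Matrix.transpose_mul]
    simp only [Matrix.mul_assoc]
  rw [parallelepipedVolume, ← Matrix.det_submatrix_equiv_self e, h1, h5, ← h2, Matrix.det_mul, Matrix.det_mul,
    Matrix.det_transpose, mul_comm C.det, mul_assoc, ← sq, Real.sqrt_mul' _ (sq_nonneg _), Real.sqrt_sq_eq_abs, mul_comm]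

end Volume

/-! ### The estimate uniform in time. -/

section Growth
variable {NA NB N : ℕ}

/-- The entanglement entropy of an evolving Gaussian state and the logarithmic volume of a parallelepiped
in `A*` differ by a bounded amount. -/
theorem exists_abs_entanglementEntropy_sub_log_le {D : SplitBasis NA NB N} (hD : IsDarboux D)
    {H : QuadraticHamiltonian N} {M : ℝ → Matrix (Fin N ⊕ Fin N) (Fin N ⊕ Fin N) ℝ} (hM : IsClassicalFlow H M)
    {G : Matrix (Fin N ⊕ Fin N) (Fin N ⊕ Fin N) ℝ} (hG : G.PosDef) (v : Module.Basis (Fin (2 * NA)) ℝ (subsystem D))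
    {J : Matrix (Fin N ⊕ Fin N) (Fin N ⊕ Fin N) ℝ} (hJ : IsCompatibleComplexStructure J)
    {ζ : Fin N ⊕ Fin N → ℝ} {ψ : ℝ → WaveFunction NA NB} (h0 : IsGaussianState D J ζ (ψ 0))
    (hψ : IsSchrodingerSolution D H ψ) :
    ∃ C : ℝ, ∀ t, 0 ≤ t → entanglementEntropy (ψ t) ≠ ⊤ ∧
      |(entanglementEntropy (ψ t)).toReal - Real.log
        (parallelepipedVolume G (fun r => (M t)ᵀ *ᵥ (v r : DualPhaseSpace N)) /
          parallelepipedVolume G fun r => (v r : DualPhaseSpace N))| ≤ C := by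
  set Z₀ := gaussianMatrix (darbouxMatrix D J)
  have hZ : Z₀ᵀ = Z₀ := gaussianMatrix_transpose (darbouxMatrix_sq D hJ) (posDef_darbouxMatrix hD hJ)
  have hpos : (Z₀.map Complex.re).PosDef := map_re_gaussianMatrix (posDef_darbouxMatrix hD hJ)
  have hsymp : ∀ t, 0 ≤ t → (flowMatrix D M t)ᵀ * Omega _ * flowMatrix D M t = Omega _ := fun t ht =>
    (isLinearFlow_flowMatrix hD hM).symplectic (fun t ht => quadraticPart_transpose D H ht) ht
  have hG' : (basisMatrix D * G * (basisMatrix D)ᵀ).PosDef := by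
    have hinj : Function.Injective ((basisMatrix D)ᵀ *ᵥ ·) := by
      intro x y hxy
      have h1 : (reprMatrix D)ᵀ * (basisMatrix D)ᵀ = 1 := by
        rw [← Matrix.transpose_mul, basisMatrix_mul_reprMatrix, Matrix.transpose_one]
      have h2 := congrArg ((reprMatrix D)ᵀ *ᵥ ·) hxy
      simpa only [Matrix.mulVec_mulVec, h1, Matrix.one_mulVec] using h2
    have h := hG.conjTranspose_mul_mul_same hinj
    simpa [Matrix.conjTranspose_eq_transpose_of_trivial] using h
  -- Comparison of the initial covariance with `G` written in Darboux coordinates, valid for every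
  -- invertible matrix and hence along the whole flow.
  obtain ⟨C, hC⟩ := exists_abs_log_det_restrict_sub_le (posDef_covariance hZ hpos) hG'
  obtain ⟨c, hc, hvol⟩ := exists_parallelepipedVolume_eq D v G
  set V := parallelepipedVolume G fun r => (v r : DualPhaseSpace N) with hV
  have hlogvol : ∀ t, 0 ≤ t → 0 < parallelepipedVolume G (fun r => (M t)ᵀ *ᵥ (v r : DualPhaseSpace N)) ∧
      Real.log (parallelepipedVolume G (fun r => (M t)ᵀ *ᵥ (v r : DualPhaseSpace N))) = Real.log c +
        1 / 2 * Real.log (restrict (flowMatrix D M t * (basisMatrix D * G * (basisMatrix D)ᵀ) *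
          (flowMatrix D M t)ᵀ)).det := by
    intro t ht
    have hd := (posDef_restrict (posDef_mul_mul_transpose (det_ne_zero_of_symplectic (hsymp t ht)) hG')).det_pos
    rw [hvol M t]
    refine ⟨mul_pos hc (Real.sqrt_pos.2 hd), ?_⟩
    rw [Real.log_mul hc.ne' (Real.sqrt_pos.2 hd).ne', Real.log_sqrt hd.le]
    ring
  -- The initial volume is the transported volume at time `0`, where the flow is the identity.
  have hVpos : 0 < V := by
    have h := (hlogvol 0 le_rfl).1
    simpa only [hM.init, Matrix.transpose_one, Matrix.one_mulVec] using h
  -- The terms come, in order, from the change of inner product, the change of basis in `A*`, the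
  -- normalization by the initial volume, and the gap between the two entropy bounds.
  refine ⟨1 / 2 * C + |Real.log c| + |Real.log V| + (1 + Real.sqrt 2 ^ (NA + NA)), fun t ht => ?_⟩
  obtain ⟨hnorm, b, a, hψt⟩ := exists_eq_smul_gaussian_of_isSchrodingerSolution hD hM hJ h0 hψ ht
  rw [hψt] at hnorm
  have hb := entanglementEntropy_gaussian_bounds (transport_transpose (hsymp t ht) hZ hpos)
    (posDef_re_transport (hsymp t ht) hZ hpos) b hnorm
  rw [← hψt, covariance_transport (hsymp t ht) hZ hpos] at hb
  have hfin : entanglementEntropy (ψ t) ≠ ⊤ := ne_top_of_le_ne_top ENNReal.ofReal_ne_top hb.2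
  refine ⟨hfin, ?_⟩
  have hCt := abs_le.1 (hC _ (det_ne_zero_of_symplectic (hsymp t ht)))
  have hlow := (ENNReal.ofReal_le_iff_le_toReal hfin).1 hb.1
  have hC0 : 0 ≤ C := (abs_nonneg _).trans (hC _ (det_ne_zero_of_symplectic (hsymp t ht)))
  have hs : 0 ≤ Real.sqrt 2 ^ (NA + NA) := by positivity
  have hup : (entanglementEntropy (ψ t)).toReal ≤ 1 / 2 * Real.log (restrict (flowMatrix D M t * covariance Z₀ *
      (flowMatrix D M t)ᵀ)).det + (1 + Real.sqrt 2 ^ (NA + NA)) := by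
    refine (ENNReal.toReal_mono ENNReal.ofReal_ne_top hb.2).trans (ENNReal.toReal_ofReal ?_).le
    rw [← covariance_transport (hsymp t ht) hZ hpos]
    have := Real.log_nonneg (one_le_det_restrict_covariance (transport_transpose (hsymp t ht) hZ hpos)
      (posDef_re_transport (hsymp t ht) hZ hpos))
    positivity
  rw [Real.log_div (hlogvol t ht).1.ne' hVpos.ne', (hlogvol t ht).2, abs_le]
  constructor <;>
    linarith [neg_abs_le (Real.log c), le_abs_self (Real.log c), neg_abs_le (Real.log V), le_abs_self (Real.log V),
      hCt.1, hCt.2]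

end Growth

end GaussianEntanglement

end

theorem theorem1 {NA NB N : ℕ}
    (D : SplitBasis NA NB N) (hD : IsDarboux D)
    (H : QuadraticHamiltonian N)
    (M : ℝ → Matrix (Fin N ⊕ Fin N) (Fin N ⊕ Fin N) ℝ) (hM : IsClassicalFlow H M)
    (G : Matrix (Fin N ⊕ Fin N) (Fin N ⊕ Fin N) ℝ) (hG : G.PosDef)
    (v : Module.Basis (Fin (2 * NA)) ℝ (subsystem D)) (Λ : ℝ)
    (hΛ : IsVolumeExponent G M (fun r => (v r : DualPhaseSpace N)) Λ)
    (J₀ : Matrix (Fin N ⊕ Fin N) (Fin N ⊕ Fin N) ℝ) (hJ₀ : IsCompatibleComplexStructure J₀)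
    (ζ₀ : Fin N ⊕ Fin N → ℝ)
    (ψ : ℝ → WaveFunction NA NB) (hψ₀ : IsGaussianState D J₀ ζ₀ (ψ 0))
    (hψ : IsSchrodingerSolution D H ψ) :
    (∀ t, 0 ≤ t → entanglementEntropy (ψ t) ≠ ⊤) ∧
      Filter.Tendsto (fun t : ℝ => (entanglementEntropy (ψ t)).toReal / t)
        Filter.atTop (𝓝 Λ) := by
  obtain ⟨C, hC⟩ := exists_abs_entanglementEntropy_sub_log_le hD hM hG v hJ₀ hψ₀ hψ
  refine ⟨fun t ht => (hC t ht).1, ?_⟩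
  -- The two quotients differ by at most `C / t`, so they share their limit.
  refine hΛ.congr_dist ?_
  refine squeeze_zero' (Filter.Eventually.of_forall fun t => dist_nonneg) ?_
    (tendsto_const_nhds.div_atTop Filter.tendsto_id : Filter.Tendsto (fun t : ℝ => C / t) Filter.atTop (𝓝 0))
  filter_upwards [Filter.eventually_gt_atTop 0] with t ht
  rw [dist_comm, Real.dist_eq, one_div, inv_mul_eq_div, ← sub_div, abs_div, abs_of_pos ht]
  exact div_le_div_of_nonneg_right (hC t ht.le).2 ht.le
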